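/- Let $\Gamma\subset PSL_2(\mathbb R)$ be a discrete, cocompact, torsion-free subgroup and let $M=PSL_2(\mathbb R)/\Gamma$, the unit tangent bundle of the compact hyperbolic surface $\Sigma=\Gamma\backslash\mathbb H$ (curvature $-1$): the coset $g\Gamma$ has the footpoint $\Gamma g^{-1}i$. Fix $c\neq0$ and let $a_0=\begin{pmatrix}1/2&0\\0&-1/2\end{pmatrix}$, $a_+=\begin{pmatrix}0&c\\0&0\end{pmatrix}$, $a_-=\begin{pmatrix}0&0\\1/(2c)&0\end{pmatrix}$, so that $[a_+,a_-]=a_0$ and $[a_0,a_\pm]=\pm a_\pm$. Let $e_0,e_+,e_-$ be the right-invariant vector fields on $M$ generating the flows $x\mapsto\exp(ta_0)x,\ \exp(ta_+)x,\ \exp(ta_-)x$, and let $\omega_0,\omega_+,\omega_-$ be the dual right-invariant $1$-forms. The geodesic flow is the flow of $e_0$ (its trajectories are the curves $\omega_+=\omega_-=0$), the $(+)$-horocycle flow is the flow of $e_-$ (trajectories $\omega_+=\omega_0=0$) and the $(-)$-horocycle flow is the flow of $e_+$ (trajectories $\omega_-=\omega_0=0$). Put $h_+=e_0\wedge e_-$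 and $h_-=e_0\wedge e_+$. 1. The tensors $h_+$ and $h_-$ are Poisson tensors, different at every point, and their Casimir foliations (the common kernels of the covectors $\alpha$ with $h(\alpha,\cdot)=0$) are the codimension-one foliations $\omega_+=0$ and $\omega_-=0$, respectively. These are the Anosov foliations of the geodesic flow $\varphi_t$: $\ker\omega_\pm$ is spanned by $e_0$ and $e_\mp$, and $d\varphi_t(e_\mp)=e^{\mp t}e_\mp$. 2. The $(\pm)$-horocycle flows are Hamiltonian with the same Hamiltonian $1$-form $\omega_0$ and the Poisson tensors $h_\pm$: on the leaves of the Casimir foliation $\omega_0$ is locally the differential of a smooth function $F$, and the system $df/dt=\{f,F\}$ is the $(\pm)$-horocycle flow. More precisely, for every real $r\neq0$ the Poisson tensor $r\,h_\pm$ and the $1$-form $\omega_0$ generate the flow of $-r\,e_\mp$, which is the horocycle flow with speed and direction scaled by $-r$. 3. Let $\gamma$ be a closed geodesic, that is, a closed trajectory $\gamma(t)=\varphi_t(x)$, $0\le t\le T$, $\varphi_T(x)=x$, $T>0$, of the geodesic flow. It projects to a geodesic of $\Sigma$ parametrized by arc length, and the period of $\omega_0$ is non-zero and equal to the hyperbolic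 length of the projection: $\oint_\gamma\omega_0=l(\gamma)>0$. If $T$ is the least positive period, then the leaf of $\omega_+=0$ and the leaf of $\omega_-=0$ that contain $\gamma$ are cylinders (injectively immersed copies of $(\mathbb R/T\mathbb Z)\times\mathbb R$) with $\gamma$ as the core circle. -/

import Mathlib

open Set Filter Topology MeasureTheory UpperHalfPlane
open scoped Manifold ContDiff MatrixGroups ENNReal

noncomputable section

namespace Horocycle

/-! ### Poisson geometry on a smooth manifold -/

section Poisson

variable {E : Type*} [NormedAddCommGroup E] [NormedSpace ℝ E] {H : Type*} [TopologicalSpace H]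
  (I : ModelWithCorners ℝ E H) {N : Type*} [TopologicalSpace N] [ChartedSpace H N]

/-- The cotangent space of `N` at `x`. -/
abbrev Cotangent (x : N) : Type _ := TangentSpace I x →L[ℝ] ℝ

/-- A (not necessarily continuous) tensor field `h^{ij}`: a bilinear form on every cotangent space. -/
abbrev TensorField (N : Type*) [TopologicalSpace N] [ChartedSpace H N] : Type _ :=
  ∀ x : N, Cotangent I x →ₗ[ℝ] Cotangent I x →ₗ[ℝ] ℝ

/-- The bivector field `X ∧ Y`: `(α, β) ↦ α(X) β(Y) - α(Y) β(X)`. -/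
def wedge (X Y : ∀ x : N, TangentSpace I x) : TensorField I N := fun x =>
  LinearMap.mk₂ ℝ (fun α β : Cotangent I x => α (X x) * β (Y x) - α (Y x) * β (X x))
    (fun _ _ _ => by simp only [_root_.add_apply]; ring)
    (fun _ _ _ => by simp only [_root_.smul_apply, smul_eq_mul]; ring)
    (fun _ _ _ => by simp only [_root_.add_apply]; ring)
    (fun _ _ _ => by simp only [_root_.smul_apply, smul_eq_mul]; ring)

/-- The bracket `{f, g} = h^{ij} ∂ᵢf ∂ⱼg`. -/
def bracket (h : TensorField I N) (f g : N → ℝ) : N → ℝ := fun x =>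
  h x (mvfderiv I f x) (mvfderiv I g x)

/-- `h` is a smooth Poisson tensor: skew-symmetric, smooth (brackets of smooth functions are
smooth), with the Jacobi identity. The Leibniz rule holds by the definition of the bracket. -/
structure IsPoissonTensor (h : TensorField I N) : Prop where
  skew : ∀ (x : N) (α : Cotangent I x), h x α α = 0
  smooth : ∀ f g : N → ℝ, ContMDiff I 𝓘(ℝ) ∞ f → ContMDiff I 𝓘(ℝ) ∞ g →
    ContMDiff I 𝓘(ℝ) ∞ (bracket I h f g)
  jacobi : ∀ f g k : N → ℝ, ContMDiff I 𝓘(ℝ) ∞ f → ContMDiff I 𝓘(ℝ) ∞ g →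
    ContMDiff I 𝓘(ℝ) ∞ k → ∀ x : N,
    bracket I h (bracket I h f g) k x + bracket I h (bracket I h g k) f x +
      bracket I h (bracket I h k f) g x = 0

variable {I} in
/-- The Casimir (annihilator) distribution of `h`: the common kernel of all covectors `α` with
`h(α, ·) = 0`. -/
def casimirDistribution (h : TensorField I N) (x : N) : Submodule ℝ (TangentSpace I x) where
  carrier := {v | ∀ α : Cotangent I x, h x α = 0 → α v = 0}
  zero_mem' α _ := map_zero α
  add_mem' hv hw α hα := by rw [map_add, hv α hα, hw α hα, add_zero]
  smul_mem' r v hv α hα := by rw [map_smul, hv α hα, smul_zero]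

variable {I} in
/-- The distribution `α = 0` defined by a 1-form. -/
def kernel (α : ∀ x : N, Cotangent I x) (x : N) : Submodule ℝ (TangentSpace I x) :=
  LinearMap.ker (α x).toLinearMap

/-- The distribution `D` is (completely integrable and) tangent to a smooth foliation of
codimension one: locally it is `df = 0` for a smooth function `f` without critical points. -/
def IsCodimOneFoliation (D : ∀ x : N, Submodule ℝ (TangentSpace I x)) : Prop :=
  ∀ x : N, ∃ U : Set N, IsOpen U ∧ x ∈ U ∧ ∃ f : N → ℝ, ContMDiffOn I 𝓘(ℝ) ∞ f U ∧
    ∀ y ∈ U, mvfderiv I f y ≠ 0 ∧ D y = LinearMap.ker (mvfderiv I f y).toLinearMap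

/-- The velocity vector of a curve. -/
def velocity (γ : ℝ → N) (t : ℝ) : TangentSpace I (γ t) := mfderiv 𝓘(ℝ, ℝ) I γ t (1 : ℝ)

/-- The leaf through `x`: the points that can be joined to `x` by a `C¹` curve tangent to `D`. -/
def leaf (D : ∀ x : N, Submodule ℝ (TangentSpace I x)) (x : N) : Set N :=
  {y | ∃ γ : ℝ → N, ContMDiff 𝓘(ℝ, ℝ) I 1 γ ∧ γ 0 = x ∧ γ 1 = y ∧ ∀ t, velocity I γ t ∈ D (γ t)}

/-- The line integral of a 1-form along `γ` restricted to `[a, b]`. -/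
def lineIntegral (α : ∀ x : N, Cotangent I x) (γ : ℝ → N) (a b : ℝ) : ℝ :=
  ∫ t in a..b, α (γ t) (velocity I γ t)

/-- The curve `γ`, of period `T`, lies on a cylindrical leaf of `D` and is the core of it: the leaf
is the image of an injective immersion, tangent to `D`, of the cylinder `(ℝ / Tℤ) × ℝ`, and `γ`
is the image of the circle `(ℝ / Tℤ) × {0}`. -/
def IsCoreOfCylindricalLeaf (D : ∀ x : N, Submodule ℝ (TangentSpace I x)) (γ : ℝ → N) (T : ℝ) :
    Prop :=
  ∃ Ψ : ℝ × ℝ → N, ContMDiff 𝓘(ℝ, ℝ × ℝ) I ∞ Ψ ∧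
    (∀ p, Function.Injective (mfderiv 𝓘(ℝ, ℝ × ℝ) I Ψ p)) ∧
    (∀ p v, mfderiv 𝓘(ℝ, ℝ × ℝ) I Ψ p v ∈ D (Ψ p)) ∧
    (∀ p q, Ψ p = Ψ q ↔ p.2 = q.2 ∧ ∃ k : ℤ, p.1 - q.1 = k * T) ∧
    range Ψ = leaf I D (γ 0) ∧
    ∀ u, Ψ (u, 0) = γ u

variable [IsManifold I ∞ N]

/-- Smooth vector fields. -/
def IsSmoothField (X : ∀ x : N, TangentSpace I x) : Prop :=
  ContMDiff I I.tangent ∞ (fun x => (⟨x, X x⟩ : TangentBundle I N))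

/-- Smooth 1-forms: smooth on smooth vector fields. -/
def IsSmoothForm (α : ∀ x : N, Cotangent I x) : Prop :=
  ∀ X : ∀ x : N, TangentSpace I x, IsSmoothField I X → ContMDiff I 𝓘(ℝ) ∞ (fun x => α x (X x))

/-- The flow `φ` is Hamiltonian with Poisson tensor `h` and Hamiltonian 1-form `α`: along the leaves
of the Casimir foliation `α` is locally the differential of a smooth function `F` (that is, `α` is
closed on the leaves), and `φ` is the flow of the smooth vector field `X = h(·, α)`; so on functions
`df/dt = {f, F}`. -/
def IsHamiltonianFlow (h : TensorField I N) (α : ∀ x : N, Cotangent I x) (φ : ℝ → N → N) : Prop :=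
  IsPoissonTensor I h ∧ IsSmoothForm I α ∧
  (∀ x : N, ∃ U : Set N, IsOpen U ∧ x ∈ U ∧ ∃ F : N → ℝ, ContMDiffOn I 𝓘(ℝ) ∞ F U ∧
    ∀ y ∈ U, ∀ v ∈ casimirDistribution h y, α y v = mvfderiv I F y v) ∧
  ∃ X : ∀ x : N, TangentSpace I x, IsSmoothField I X ∧
    (∀ (x : N) (β : Cotangent I x), β (X x) = h x β (α x)) ∧
    ∀ x : N, φ 0 x = x ∧ IsMIntegralCurve (I := I) (fun t => φ t x) X

end Poisson

/-! ### `PSL(2, ℝ)` and its action on the hyperbolic plane -/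

theorem center_eq {B : SL(2, ℝ)} (hB : B ∈ Subgroup.center SL(2, ℝ)) : B = 1 ∨ B = -1 := by
  obtain ⟨r, hr, h⟩ := Matrix.SpecialLinearGroup.mem_center_iff.1 hB
  have hr2 : r ^ 2 = 1 := by simpa using hr
  rcases sq_eq_one_iff.1 hr2 with h1 | h1
  · left; apply Subtype.ext; rw [← h, h1]; simp
  · right; apply Subtype.ext; rw [← h, h1]; ext i j; fin_cases i <;> fin_cases j <;> simp

theorem rel_eq {A B : SL(2, ℝ)} (h : QuotientGroup.leftRel (Subgroup.center SL(2, ℝ)) A B) :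
    B = A ∨ B = -A := by
  rw [QuotientGroup.leftRel_apply] at h
  rcases center_eq h with h | h
  · left; exact (inv_mul_eq_one.1 h).symm
  · right; rw [inv_mul_eq_iff_eq_mul] at h; rw [h]; simp

theorem neg_smul_up (A : SL(2, ℝ)) (z : ℍ) : (-A) • z = A • z := by
  ext
  simp only [UpperHalfPlane.coe_specialLinearGroup_apply]
  simp only [Matrix.SpecialLinearGroup.coe_neg, Matrix.neg_apply, map_neg]
  push_cast
  rw [← neg_div_neg_eq]
  congr 1 <;> simp <;> ring

/-- The action of `PSL(2, ℝ)` on the upper half-plane by Möbius transformations. -/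
instance pslAction : MulAction PSL(2, ℝ) ℍ where
  smul q z := Quotient.liftOn' q (fun A : SL(2, ℝ) => A • z) fun A B h => by
    rcases rel_eq h with h | h
    · rw [h]
    · rw [h]; exact (neg_smul_up A z).symm
  one_smul z := one_smul SL(2, ℝ) z
  mul_smul p q z := by
    induction p using QuotientGroup.induction_on with
    | H A => induction q using QuotientGroup.induction_on with
      | H B => exact mul_smul A B z

theorem mk_smul_up (A : SL(2, ℝ)) (z : ℍ) : (A : PSL(2, ℝ)) • z = A • z := rfl

instance pslIsometric : IsIsometricSMul PSL(2, ℝ) ℍ where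
  isometry_smul p := by
    induction p using QuotientGroup.induction_on with
    | H A => exact isometry_smul ℍ A

/-! ### Coordinates on the big cell of `PSL(2, ℝ)` -/

/-- `g ↦ (g₁₀ / g₀₀, 2 log |g₀₀|, g₀₁ / g₀₀)`. -/
def cellCoordsSL (A : SL(2, ℝ)) : ℝ × ℝ × ℝ :=
  (A 1 0 / A 0 0, 2 * Real.log (A 0 0), A 0 1 / A 0 0)

/-- `cellCoordsSL` on `PSL(2, ℝ)`. -/
def cellCoords (p : PSL(2, ℝ)) : ℝ × ℝ × ℝ :=
  Quotient.liftOn' p cellCoordsSL fun A B h => by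
    rcases rel_eq h with h | h
    · rw [h]
    · rw [h]
      simp [cellCoordsSL]

/-- The big cell `g₀₀ ≠ 0`. -/
def cellSet : Set PSL(2, ℝ) :=
  {p | Quotient.liftOn' p (fun A : SL(2, ℝ) => A 0 0 ≠ 0) fun A B h => by
    rcases rel_eq h with h | h
    · rw [h]
    · rw [h]
      simp}

/-- `n₋(s) a(u) n₊(t)`, the lower unipotent times diagonal times upper unipotent matrix. -/
def cellMatrix (v : ℝ × ℝ × ℝ) : SL(2, ℝ) :=
  ⟨!![Real.exp (v.2.1 / 2), Real.exp (v.2.1 / 2) * v.2.2;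
      v.1 * Real.exp (v.2.1 / 2),
      v.1 * Real.exp (v.2.1 / 2) * v.2.2 + Real.exp (-(v.2.1 / 2))], by
    rw [Matrix.det_fin_two_of]
    have : Real.exp (v.2.1 / 2) * Real.exp (-(v.2.1 / 2)) = 1 := by
      rw [← Real.exp_add]; simp
    linear_combination this⟩

theorem continuous_entry (i j : Fin 2) : Continuous fun A : SL(2, ℝ) => A i j :=
  (continuous_subtype_val (p := fun A : Matrix (Fin 2) (Fin 2) ℝ => A.det = 1)).matrix_elem i j

theorem continuous_cellMatrix : Continuous cellMatrix := by
  refine Continuous.subtype_mk ?_ _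
  refine continuous_matrix fun i j => ?_
  fin_cases i <;> fin_cases j <;> simp <;> fun_prop

theorem cellCoordsSL_cellMatrix (v : ℝ × ℝ × ℝ) : cellCoordsSL (cellMatrix v) = v := by
  have h := (Real.exp_pos (v.2.1 / 2)).ne'
  ext <;> simp [cellCoordsSL, cellMatrix]
  ring

theorem cellMatrix_cellCoordsSL (A : SL(2, ℝ)) (h : A 0 0 ≠ 0) :
    (cellMatrix (cellCoordsSL A) : PSL(2, ℝ)) = A := by
  have hdet : A 0 0 * A 1 1 - A 0 1 * A 1 0 = 1 := by
    rw [← Matrix.det_fin_two]; exact A.2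
  have key : ∀ B : SL(2, ℝ), 0 < B 0 0 → cellMatrix (cellCoordsSL B) = B := by
    intro B hB
    have hdet : B 0 0 * B 1 1 - B 0 1 * B 1 0 = 1 := by
      rw [← Matrix.det_fin_two]; exact B.2
    have e1 : Real.exp (2 * Real.log (B 0 0) / 2) = B 0 0 := by
      rw [mul_div_cancel_left₀ _ two_ne_zero, Real.exp_log hB]
    apply Subtype.ext
    ext i j
    fin_cases i <;> fin_cases j <;>
      simp only [cellMatrix, cellCoordsSL, Real.exp_neg, e1] <;> simp <;> field_simp
    linarith
  rcases lt_or_gt_of_ne h with h | h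
  · have h1 := key (-A) (by simpa using h)
    have h2 : cellCoordsSL (-A) = cellCoordsSL A := by simp [cellCoordsSL]
    rw [h2] at h1
    rw [h1, QuotientGroup.eq, Subgroup.mem_center_iff]
    intro B
    have : (-A)⁻¹ * A = -1 := by
      rw [inv_mul_eq_iff_eq_mul]; simp
    rw [this]; simp
  · rw [key A h]

theorem isOpen_cellSet : IsOpen cellSet := by
  rw [← (QuotientGroup.isOpenQuotientMap_mk (N := Subgroup.center SL(2, ℝ))).isQuotientMap.isOpen_preimage]
  exact isOpen_ne_fun (continuous_entry 0 0) continuous_const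

theorem continuousAt_cellCoordsSL {A : SL(2, ℝ)} (h : A 0 0 ≠ 0) :
    ContinuousAt cellCoordsSL A := by
  have c := fun i j => (continuous_entry i j).continuousAt (x := A)
  exact ((c 1 0).div (c 0 0) h).prodMk
    ((continuousAt_const.mul ((c 0 0).log h)).prodMk ((c 0 1).div (c 0 0) h))

/-- The chart `n₋(s) a(u) n₊(t) ↦ (s, u, t)` on the big cell. -/
def cellChart : OpenPartialHomeomorph PSL(2, ℝ) (ℝ × ℝ × ℝ) where
  toFun := cellCoords
  invFun v := (cellMatrix v : PSL(2, ℝ))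
  source := cellSet
  target := univ
  map_source' _ _ := mem_univ _
  map_target' v _ := (Real.exp_pos (v.2.1 / 2)).ne'
  left_inv' p hp := by
    induction p using QuotientGroup.induction_on with
    | H A => exact cellMatrix_cellCoordsSL A hp
  right_inv' v _ := cellCoordsSL_cellMatrix v
  open_source := isOpen_cellSet
  open_target := isOpen_univ
  continuousOn_toFun p hp := by
    induction p using QuotientGroup.induction_on with
    | H A =>
      refine ContinuousAt.continuousWithinAt ?_
      exact QuotientGroup.isOpenQuotientMap_mk.continuousAt_comp_iff.1
        (continuousAt_cellCoordsSL hp)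
  continuousOn_invFun :=
    (QuotientGroup.continuous_mk.comp continuous_cellMatrix).continuousOn

/-- The chart of `PSL(2, ℝ)` centred at `g`: the big cell translated on the right by `g`. -/
def pslChart (g : PSL(2, ℝ)) : OpenPartialHomeomorph PSL(2, ℝ) (ℝ × ℝ × ℝ) :=
  (Homeomorph.mulRight g⁻¹).toOpenPartialHomeomorph.trans cellChart

theorem mem_pslChart_source {g p : PSL(2, ℝ)} : p ∈ (pslChart g).source ↔ p * g⁻¹ ∈ cellSet := by
  simp [pslChart, cellChart]

theorem one_mem_cellSet : (1 : PSL(2, ℝ)) ∈ cellSet := one_ne_zero (α := ℝ)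

instance pslCharted : ChartedSpace (ℝ × ℝ × ℝ) PSL(2, ℝ) where
  atlas := range pslChart
  chartAt := pslChart
  mem_chart_source g := by
    rw [mem_pslChart_source, mul_inv_cancel]; exact one_mem_cellSet
  chart_mem_atlas g := mem_range_self g

/-- Right translation by a fixed element is smooth in the coordinates of the big cell. -/
theorem contDiffAt_cellCoords_mul (k : PSL(2, ℝ)) (v : ℝ × ℝ × ℝ)
    (h : (cellMatrix v : PSL(2, ℝ)) * k ∈ cellSet) :
    ContDiffAt ℝ ∞ (fun w => cellCoords ((cellMatrix w : PSL(2, ℝ)) * k)) v := by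
  induction k using QuotientGroup.induction_on with
  | H B =>
    have h0 : (cellMatrix v * B) 0 0 ≠ 0 := h
    have e : ∀ i j, ContDiffAt ℝ ∞ (fun w => (cellMatrix w * B) i j) v := by
      intro i j
      simp only [Matrix.SpecialLinearGroup.coe_mul, Matrix.mul_apply, Fin.sum_univ_two]
      have : ∀ i j, ContDiffAt ℝ ∞ (fun w => cellMatrix w i j) v := by
        intro i j
        fin_cases i <;> fin_cases j <;> simp [cellMatrix] <;> fun_prop
      exact ((this _ _).mul contDiffAt_const).add ((this _ _).mul contDiffAt_const)
    exact ((e 1 0).div (e 0 0) h0).prodMk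
      ((contDiffAt_const.mul ((e 0 0).log h0)).prodMk ((e 0 1).div (e 0 0) h0))

/-! ### The quotient `PSL(2, ℝ) / Γ` as a smooth 3-manifold -/

/-- The space `PSL(2, ℝ) / Γ` of cosets `gΓ`. Attaching to `g` the image under `g⁻¹` of the downward
unit vector at `i` identifies it with the unit tangent bundle of the surface `Γ \\ ℍ`. -/
abbrev M (Γ : Subgroup PSL(2, ℝ)) : Type := PSL(2, ℝ) ⧸ Γ

variable (Γ : Subgroup PSL(2, ℝ)) [DiscreteTopology Γ]

theorem isLocalHomeomorph_mk : IsLocalHomeomorph (QuotientGroup.mk : PSL(2, ℝ) → M Γ) :=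
  (Γ.isQuotientCoveringMap ⟨inferInstance⟩).isCoveringMap.isLocalHomeomorph

/-- The smooth structure for which `PSL(2, ℝ) → PSL(2, ℝ) / Γ` is a local diffeomorphism. -/
instance quotientCharted : ChartedSpace (ℝ × ℝ × ℝ) (M Γ) :=
  (isLocalHomeomorph_mk Γ).chartedSpace QuotientGroup.mk_surjective

instance quotientManifold : IsManifold 𝓘(ℝ, ℝ × ℝ × ℝ) ∞ (M Γ) := by
  apply isManifold_of_contDiffOn
  rintro e e' ⟨x, rfl⟩ ⟨y, rfl⟩
  generalize (QuotientGroup.mk_surjective (s := Γ)).hasRightInverse.choose x = g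
  generalize (QuotientGroup.mk_surjective (s := Γ)).hasRightInverse.choose y = k
  set σ := (isLocalHomeomorph_mk Γ).localInverseAt g with hσ
  set τ := (isLocalHomeomorph_mk Γ).localInverseAt k with hτ
  have hσs : ∀ p, σ.symm p = (p : M Γ) := fun p => by rw [hσ, IsLocalHomeomorph.localInverseAt_symm]
  have hτs : ∀ p, τ.symm p = (p : M Γ) := fun p => by rw [hτ, IsLocalHomeomorph.localInverseAt_symm]
  change ContDiffOn ℝ ∞ (((σ.trans (pslChart g)).symm.trans (τ.trans (pslChart k))))
    (((σ.trans (pslChart g)).symm.trans (τ.trans (pslChart k))).source ∩ range id)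
  rw [range_id, inter_univ]
  have hsrc : IsOpen ((σ.trans (pslChart g)).symm.trans (τ.trans (pslChart k))).source :=
    OpenPartialHomeomorph.open_source _
  intro v hv
  refine ContDiffAt.contDiffWithinAt ?_
  -- the transition map
  let P : ℝ × ℝ × ℝ → PSL(2, ℝ) := fun w => (cellMatrix w : PSL(2, ℝ)) * g
  have hP : Continuous P := by
    have h0 : Continuous fun w => (cellMatrix w : PSL(2, ℝ)) :=
      QuotientGroup.continuous_mk.comp continuous_cellMatrix
    exact h0.mul continuous_const
  have hsymm : ∀ w, (pslChart g).symm w = P w := fun w => by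
    change (cellMatrix w : PSL(2, ℝ)) * g⁻¹⁻¹ = _
    rw [inv_inv]
  have hmem : ∀ w ∈ ((σ.trans (pslChart g)).symm.trans (τ.trans (pslChart k))).source,
      (P w : M Γ) ∈ τ.source ∧ τ (P w : M Γ) * k⁻¹ ∈ cellSet := by
    intro w hw
    simp only [OpenPartialHomeomorph.trans_source, OpenPartialHomeomorph.symm_source,
      mem_inter_iff, mem_preimage, OpenPartialHomeomorph.coe_trans_symm,
      Function.comp_apply, hsymm, hσs, mem_pslChart_source] at hw
    exact hw.2
  have hval : ∀ w, ((σ.trans (pslChart g)).symm.trans (τ.trans (pslChart k))) w =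
      cellCoords (τ (P w : M Γ) * k⁻¹) := by
    intro w
    simp only [OpenPartialHomeomorph.coe_trans, OpenPartialHomeomorph.coe_trans_symm,
      Function.comp_apply, hsymm, hσs]
    rfl
  obtain ⟨hv1, hv2⟩ := hmem v hv
  have hmk : (τ (P v : M Γ) : M Γ) = (P v : M Γ) := by rw [← hτs, τ.left_inv hv1]
  set γ : PSL(2, ℝ) := (P v)⁻¹ * τ (P v : M Γ) with hγ
  have hγΓ : γ ∈ Γ := QuotientGroup.eq.1 hmk.symm
  have hγv : P v * γ = τ (P v : M Γ) := by rw [hγ]; group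
  have hev : ∀ᶠ w in 𝓝 v, P w * γ = τ (P w : M Γ) := by
    have h1 : ∀ᶠ w in 𝓝 v, P w * γ ∈ τ.target := by
      have h2 : Continuous fun w => P w * γ := hP.mul continuous_const
      refine h2.continuousAt.eventually_mem (τ.open_target.mem_nhds ?_)
      rw [hγv]; exact τ.map_source hv1
    filter_upwards [h1, hsrc.mem_nhds hv] with w hw1 hw2
    have := τ.right_inv hw1
    rw [hτs] at this
    rw [← this]
    congr 1
    exact (QuotientGroup.mk_mul_of_mem (P w) hγΓ)
  have heq : ∀ᶠ w in 𝓝 v, ((σ.trans (pslChart g)).symm.trans (τ.trans (pslChart k))) w =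
      cellCoords ((cellMatrix w : PSL(2, ℝ)) * (g * γ * k⁻¹)) := by
    filter_upwards [hev] with w hw
    rw [hval, ← hw]
    simp only [P, mul_assoc]
  refine ContDiffAt.congr_of_eventuallyEq (contDiffAt_cellCoords_mul _ v ?_) heq
  have : (cellMatrix v : PSL(2, ℝ)) * (g * γ * k⁻¹) = P v * γ * k⁻¹ := by
    simp only [P, mul_assoc]
  rw [this, hγv]; exact hv2


/-! ### The flows and the invariant frame -/

def diagMatrix (t : ℝ) : SL(2, ℝ) :=
  ⟨!![Real.exp (t / 2), 0; 0, Real.exp (-(t / 2))], by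
    rw [Matrix.det_fin_two_of, ← Real.exp_add]; simp⟩

def upperMatrix (s : ℝ) : SL(2, ℝ) := ⟨!![1, s; 0, 1], by simp [Matrix.det_fin_two_of]⟩

def lowerMatrix (s : ℝ) : SL(2, ℝ) := ⟨!![1, 0; s, 1], by simp [Matrix.det_fin_two_of]⟩

variable {Γ}

theorem velocity_orbit {A : ℝ → SL(2, ℝ)} (hA : Continuous A) (hA0 : A 0 = 1)
    {v : ℝ × ℝ × ℝ} (hv : HasDerivAt (fun t => cellCoordsSL (A t)) v 0) (x : M Γ) :
    (mfderiv 𝓘(ℝ, ℝ) 𝓘(ℝ, ℝ × ℝ × ℝ) (fun t => (A t : PSL(2, ℝ)) • x) 0 (1 : ℝ) :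
      ℝ × ℝ × ℝ) = v := by
  have h0 : ((A 0 : SL(2, ℝ)) : PSL(2, ℝ)) • x = x := by
    rw [hA0]; exact one_smul PSL(2, ℝ) x
  have hcont : Continuous fun t => ((A t : SL(2, ℝ)) : PSL(2, ℝ)) :=
    QuotientGroup.continuous_mk.comp hA
  have hev : ∀ᶠ t in 𝓝 (0 : ℝ), chartAt (ℝ × ℝ × ℝ) x ((A t : PSL(2, ℝ)) • x) =
      cellCoordsSL (A t) := by
    let g : PSL(2, ℝ) := (QuotientGroup.mk_surjective (s := Γ)).hasRightInverse.choose x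
    have hgx : (g : M Γ) = x :=
      (QuotientGroup.mk_surjective (s := Γ)).hasRightInverse.choose_spec x
    set σ := (isLocalHomeomorph_mk Γ).localInverseAt g with hσ
    have hσs : ∀ p, σ.symm p = (p : M Γ) := fun p => by
      rw [hσ, IsLocalHomeomorph.localInverseAt_symm]
    have h1 : ∀ᶠ t in 𝓝 (0 : ℝ), (A t : PSL(2, ℝ)) * g ∈ σ.target := by
      have h2 : Continuous fun t => (A t : PSL(2, ℝ)) * g := hcont.mul continuous_const
      refine h2.continuousAt.eventually_mem (σ.open_target.mem_nhds ?_)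
      have h3 : ((A 0 : SL(2, ℝ)) : PSL(2, ℝ)) * g = g := by
        rw [hA0]; exact one_mul g
      rw [h3]
      exact (isLocalHomeomorph_mk Γ).self_mem_localInverseAt_target
    filter_upwards [h1] with t ht
    have h2 : (A t : PSL(2, ℝ)) • x = (((A t : PSL(2, ℝ)) * g : PSL(2, ℝ)) : M Γ) := by
      rw [← hgx]; rfl
    have h3 := σ.right_inv ht
    rw [hσs] at h3
    change cellCoords (σ ((A t : PSL(2, ℝ)) • x) * g⁻¹) = _
    rw [h2, h3, mul_inv_cancel_right]
    rfl
  have hcx : ContinuousAt (fun t => (A t : PSL(2, ℝ)) • x) 0 := by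
    obtain ⟨g, rfl⟩ := QuotientGroup.mk_surjective x
    exact (QuotientGroup.continuous_mk.comp (hcont.mul continuous_const)).continuousAt
  have hw : HasDerivAt (writtenInExtChartAt 𝓘(ℝ, ℝ) 𝓘(ℝ, ℝ × ℝ × ℝ) (0 : ℝ)
      (fun t => (A t : PSL(2, ℝ)) • x)) v 0 := by
    refine hv.congr_of_eventuallyEq ?_
    filter_upwards [hev] with t ht
    simp only [writtenInExtChartAt, h0, extChartAt_model_space_eq_id]
    exact ht
  have hm : HasMFDerivAt 𝓘(ℝ, ℝ) 𝓘(ℝ, ℝ × ℝ × ℝ) (fun t => (A t : PSL(2, ℝ)) • x) (0 : ℝ)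
      (ContinuousLinearMap.toSpanSingleton ℝ v) := by
    refine ⟨hcx, ?_⟩
    have := hw.hasFDerivAt.hasFDerivWithinAt (s := range 𝓘(ℝ, ℝ))
    exact this
  rw [hm.mfderiv]
  exact one_smul ℝ v

/-- The model of the 3-manifold `PSL(2, ℝ) / Γ`. -/
abbrev model : ModelWithCorners ℝ (ℝ × ℝ × ℝ) (ℝ × ℝ × ℝ) := 𝓘(ℝ, ℝ × ℝ × ℝ)

/-- The geodesic flow, `x ↦ exp(t a₀) x` with `a₀ = diag(1/2, -1/2)`. -/
def geodesicFlow (t : ℝ) (x : M Γ) : M Γ := (diagMatrix t : PSL(2, ℝ)) • x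

/-- The (+)-horocycle flow, `x ↦ exp(t a₋) x` where `a₋` has the single entry `1 / (2c)` in the lower
left corner. The constant `c` is the freedom of scaling in the choice of the frame; in all cases
the matrices satisfy `[a₊, a₋] = a₀`, `[a₀, a₊] = a₊`, `[a₀, a₋] = -a₋`. -/
def horocyclePlus (c : ℝˣ) (t : ℝ) (x : M Γ) : M Γ :=
  (lowerMatrix (t / (2 * c)) : PSL(2, ℝ)) • x

/-- The (-)-horocycle flow, `x ↦ exp(t a₊) x` where `a₊` has the single entry `c` in the upper right
corner. -/
def horocycleMinus (c : ℝˣ) (t : ℝ) (x : M Γ) : M Γ :=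
  (upperMatrix (c * t) : PSL(2, ℝ)) • x

/-- The right-invariant vector field `e₀`, the generator of the geodesic flow. (The velocity at time
`0` is a vector at `geodesicFlow 0 x`, which is `x`.) -/
def e0 (x : M Γ) : TangentSpace model x := velocity model (fun t => geodesicFlow t x) 0

/-- The right-invariant vector field `e₊`, the generator of `exp(t a₊)`. -/
def ePlus (c : ℝˣ) (x : M Γ) : TangentSpace model x :=
  velocity model (fun t => horocycleMinus c t x) 0

/-- The right-invariant vector field `e₋`, the generator of `exp(t a₋)`. -/
def eMinus (c : ℝˣ) (x : M Γ) : TangentSpace model x :=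
  velocity model (fun t => horocyclePlus c t x) 0

theorem continuous_SL {A : ℝ → SL(2, ℝ)} (h : ∀ i j, Continuous fun t => A t i j) :
    Continuous A := by
  have : A = fun t => ⟨(A t).1, (A t).2⟩ := rfl
  rw [this]
  exact Continuous.subtype_mk (continuous_matrix h) _

theorem e0_eq (x : M Γ) : e0 x = ((0, 1, 0) : ℝ × ℝ × ℝ) := by
  refine velocity_orbit (A := diagMatrix) (continuous_SL fun i j => ?_) ?_ ?_ x
  · fin_cases i <;> fin_cases j <;> simp [diagMatrix] <;> fun_prop
  · ext i j; fin_cases i <;> fin_cases j <;> simp [diagMatrix]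
  · have : (fun t => cellCoordsSL (diagMatrix t)) = fun t => ((0, t, 0) : ℝ × ℝ × ℝ) := by
      funext t; simp [cellCoordsSL, diagMatrix]; ring
    rw [this]
    exact (hasDerivAt_const _ _).prodMk ((hasDerivAt_id _).prodMk (hasDerivAt_const _ _))

theorem ePlus_eq (c : ℝˣ) (x : M Γ) : ePlus c x = ((0, 0, (c : ℝ)) : ℝ × ℝ × ℝ) := by
  refine velocity_orbit (A := fun t => upperMatrix (c * t)) (continuous_SL fun i j => ?_) ?_ ?_ x
  · fin_cases i <;> fin_cases j <;> simp [upperMatrix] <;> fun_prop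
  · ext i j; fin_cases i <;> fin_cases j <;> simp [upperMatrix]
  · have : (fun t => cellCoordsSL (upperMatrix (c * t))) =
        fun t => ((0, 0, (c : ℝ) * t) : ℝ × ℝ × ℝ) := by
      funext t; simp [cellCoordsSL, upperMatrix]
    rw [this]
    exact (hasDerivAt_const _ _).prodMk
      ((hasDerivAt_const _ _).prodMk (by simpa using (hasDerivAt_id (0 : ℝ)).const_mul (c : ℝ)))

theorem eMinus_eq (c : ℝˣ) (x : M Γ) :
    eMinus c x = ((1 / (2 * (c : ℝ)), 0, 0) : ℝ × ℝ × ℝ) := by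
  refine velocity_orbit (A := fun t => lowerMatrix (t / (2 * c))) (continuous_SL fun i j => ?_)
    ?_ ?_ x
  · fin_cases i <;> fin_cases j <;> simp [lowerMatrix] <;> fun_prop
  · ext i j; fin_cases i <;> fin_cases j <;> simp [lowerMatrix]
  · have : (fun t => cellCoordsSL (lowerMatrix (t / (2 * c)))) =
        fun t => ((t / (2 * (c : ℝ)), 0, 0) : ℝ × ℝ × ℝ) := by
      funext t; simp [cellCoordsSL, lowerMatrix]
    rw [this]
    exact ((hasDerivAt_id (0 : ℝ)).div_const _).prodMk
      ((hasDerivAt_const _ _).prodMk (hasDerivAt_const _ _))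

theorem linearIndependent_frame (c : ℝˣ) (x : M Γ) :
    LinearIndependent ℝ ![e0 x, ePlus c x, eMinus c x] := by
  have hc : (c : ℝ) ≠ 0 := c.ne_zero
  rw [e0_eq, ePlus_eq, eMinus_eq]
  refine (Fintype.linearIndependent_iff (R := ℝ) (M := ℝ × ℝ × ℝ)).2 ?_
  intro g hg
  simp only [Fin.sum_univ_three] at hg
  have h1 := congrArg (fun p : ℝ × ℝ × ℝ => p.1) hg
  have h2 := congrArg (fun p : ℝ × ℝ × ℝ => p.2.1) hg
  have h3 := congrArg (fun p : ℝ × ℝ × ℝ => p.2.2) hg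
  simp [hc] at h1 h2 h3
  intro i; fin_cases i <;> simp [*]

/-- The frame `e₀, e₊, e₋`. -/
def frame (c : ℝˣ) (x : M Γ) : Module.Basis (Fin 3) ℝ (TangentSpace model x) :=
  basisOfLinearIndependentOfCardEqFinrank (linearIndependent_frame c x) (by
    change _ = Module.finrank ℝ (ℝ × ℝ × ℝ); simp)

/-- The 1-forms dual to the frame `e₀, e₊, e₋`. -/
def coframe (c : ℝˣ) (i : Fin 3) (x : M Γ) : Cotangent model x :=
  haveI : FiniteDimensional ℝ (TangentSpace model x) := (frame c x).finiteDimensional_of_finite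
  haveI : T2Space (TangentSpace model x) := inferInstanceAs (T2Space (ℝ × ℝ × ℝ))
  LinearMap.toContinuousLinearMap ((frame c x).coord i)

/-- The right-invariant form `ω₀`. -/
def omega0 (c : ℝˣ) (x : M Γ) : Cotangent model x := coframe c 0 x

/-- The right-invariant form `ω₊`. -/
def omegaPlus (c : ℝˣ) (x : M Γ) : Cotangent model x := coframe c 1 x

/-- The right-invariant form `ω₋`. -/
def omegaMinus (c : ℝˣ) (x : M Γ) : Cotangent model x := coframe c 2 x

/-- The tensor `h₊ = e₀ ∧ e₋`. -/
def hPlus (c : ℝˣ) : TensorField model (M Γ) := wedge model e0 (eMinus c)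

/-- The tensor `h₋ = e₀ ∧ e₊`. -/
def hMinus (c : ℝˣ) : TensorField model (M Γ) := wedge model e0 (ePlus c)

/-! ### The hyperbolic surface -/

/-- The surface `Γ \ ℍ`. -/
def Surface (Γ : Subgroup PSL(2, ℝ)) : Type := MulAction.orbitRel.Quotient Γ ℍ

/-- The point of the surface represented by a point of the hyperbolic plane. -/
def Surface.mk (Γ : Subgroup PSL(2, ℝ)) (z : ℍ) : Surface Γ :=
  Quotient.mk (MulAction.orbitRel Γ ℍ) z

/-- The hyperbolic distance on `Γ \ ℍ` (of curvature `-1`): the infimum of the distances between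
representatives. -/
def surfaceDist (Γ : Subgroup PSL(2, ℝ)) (p q : Surface Γ) : ℝ≥0∞ :=
  ⨅ (z : ℍ) (w : ℍ) (_ : Surface.mk Γ z = p) (_ : Surface.mk Γ w = q), edist z w

theorem surfaceDist_le (Γ : Subgroup PSL(2, ℝ)) (z w : ℍ) :
    surfaceDist Γ (Surface.mk Γ z) (Surface.mk Γ w) ≤ edist z w :=
  iInf_le_of_le z (iInf_le_of_le w (iInf_le_of_le rfl (iInf_le_of_le rfl le_rfl)))

theorem exists_of_surfaceDist_lt (Γ : Subgroup PSL(2, ℝ)) {p q : Surface Γ} {r : ℝ≥0∞}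
    (h : surfaceDist Γ p q < r) :
    ∃ z w : ℍ, Surface.mk Γ z = p ∧ Surface.mk Γ w = q ∧ edist z w < r := by
  simp only [surfaceDist, iInf_lt_iff] at h
  obtain ⟨z, w, h1, h2, h3⟩ := h
  exact ⟨z, w, h1, h2, h3⟩

theorem surfaceDist_triangle (Γ : Subgroup PSL(2, ℝ)) (p q r : Surface Γ) :
    surfaceDist Γ p r ≤ surfaceDist Γ p q + surfaceDist Γ q r := by
  refine ENNReal.le_of_forall_pos_le_add fun ε hε hfin => ?_
  have hε2 : ((ε / 2 : NNReal) : ℝ≥0∞) ≠ 0 := by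
    simpa using hε.ne'
  obtain ⟨h1, h2⟩ := ENNReal.add_lt_top.1 hfin
  obtain ⟨z, w, hz, hw, hzw⟩ := exists_of_surfaceDist_lt Γ (ENNReal.lt_add_right h1.ne hε2)
  obtain ⟨u, v, hu, hv, huv⟩ := exists_of_surfaceDist_lt Γ (ENNReal.lt_add_right h2.ne hε2)
  obtain ⟨g, hg⟩ : ∃ g : Γ, g • u = w :=
    Quotient.exact (s := MulAction.orbitRel Γ ℍ) (hw.trans hu.symm)
  have hv2 : Surface.mk Γ (g • v) = r :=
    (Quotient.sound (s := MulAction.orbitRel Γ ℍ) ⟨g, rfl⟩).trans hv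
  have hd : edist w (g • v) = edist u v := by
    rw [← hg]; exact edist_smul_left (g : PSL(2, ℝ)) u v
  have hsum : ((ε / 2 : NNReal) : ℝ≥0∞) + ((ε / 2 : NNReal) : ℝ≥0∞) = ε := by
    rw [← ENNReal.coe_add, add_halves]
  calc surfaceDist Γ p r ≤ edist z (g • v) := by
        rw [← hz, ← hv2]; exact surfaceDist_le Γ z (g • v)
    _ ≤ edist z w + edist w (g • v) := edist_triangle _ _ _
    _ ≤ (surfaceDist Γ p q + (ε / 2 : NNReal)) + (surfaceDist Γ q r + (ε / 2 : NNReal)) := by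
        rw [hd]; exact add_le_add hzw.le huv.le
    _ = surfaceDist Γ p q + surfaceDist Γ q r + ε := by
        rw [add_add_add_comm, hsum]

instance surfaceMetric (Γ : Subgroup PSL(2, ℝ)) : PseudoEMetricSpace (Surface Γ) where
  edist := surfaceDist Γ
  edist_self p := by
    obtain ⟨z, rfl⟩ : ∃ z, Surface.mk Γ z = p := Quotient.exists_rep p
    exact le_antisymm ((surfaceDist_le Γ z z).trans (edist_self z).le) bot_le
  edist_comm := by
    have key : ∀ p q, surfaceDist Γ p q ≤ surfaceDist Γ q p := fun p q => by
      refine le_of_forall_gt fun r hr => ?_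
      obtain ⟨z, w, rfl, rfl, h⟩ := exists_of_surfaceDist_lt Γ hr
      rw [edist_comm] at h
      exact (surfaceDist_le Γ w z).trans_lt h
    exact fun p q => le_antisymm (key p q) (key q p)
  edist_triangle := surfaceDist_triangle Γ

/-- The projection of the unit tangent bundle to the surface, `gΓ ↦ Γ g⁻¹ i`. -/
def footpoint (x : M Γ) : Surface Γ :=
  Quotient.liftOn' x (fun g => Surface.mk Γ (g⁻¹ • UpperHalfPlane.I)) fun g k h => by
    rw [QuotientGroup.leftRel_apply] at h
    refine Quotient.sound (s := MulAction.orbitRel Γ ℍ) ⟨⟨g⁻¹ * k, h⟩, ?_⟩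
    change (g⁻¹ * k) • (k⁻¹ • UpperHalfPlane.I) = g⁻¹ • UpperHalfPlane.I
    rw [smul_smul, mul_inv_cancel_right]

/-- The length of the projection to the surface of the part of `γ` over `[a, b]`. -/
def projectedLength (γ : ℝ → M Γ) (a b : ℝ) : ℝ≥0∞ :=
  eVariationOn (fun t => footpoint (γ t)) (Icc a b)

/-- The projection of `γ` to the surface is a geodesic parametrized by arc length. -/
def ProjectsToGeodesic (γ : ℝ → M Γ) : Prop :=
  ∀ t, ∃ δ > 0, ∀ r s, |r - t| < δ → |s - t| < δ →
    edist (footpoint (γ r)) (footpoint (γ s)) = ENNReal.ofReal |r - s|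

end Horocycle

end

open Horocycle

noncomputable section

namespace Horocycle

/-! The argument reduces the statement to algebra with 2 × 2 matrices. The chart at `x` is inverse
to `w ↦ cellMatrix w • x` and sends `x` to `0` (`chartAt_symm_apply`, `chartAt_self`). A tangent
vector at `x` is a triple of numbers read in the chart at `x` itself, so the constant triples are
the right-invariant vector fields. In this trivialization `e₀`, `e₊`, `e₋` are multiples of the unit
vectors and `ω₀`, `ω₊`, `ω₋` are multiples of the coordinates; `frameMap` translates it into a
single fixed chart, where smoothness is tested.

Poisson tensors: `X ∧ Y` satisfies the Jacobi identity as soon as `[X, Y] = μ Y`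
(`isPoissonTensor_smul_wedge`). For `X = e₀` and a horocyclic field `Y` this relation is the
infinitesimal form of the conjugation rule of diagonal and unipotent matrices
(`IsHorocyclic.commutator`). Contracting `e₀ ∧ e_∓` with `ω₀` leaves `-e_∓`, the horocycle field.

Foliations: the leaves of `ω₊ = 0` are orbits of left multiplication by lower triangular matrices,
which rescale the first row of `g`. Hence `g₀₁ / g₀₀` is a first integral and `2 log |g₀₀|` is a
potential of `ω₀` on the leaves. For `ω₋ = 0` the upper triangular matrices and the second row give
`g₁₀ / g₁₁` and `-2 log g₁₁`.

Cylinders: the leaf through a closed geodesic is the image of `(u, s) ↦ N s • φ_u x`. An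
identification beyond the period `T` would give an `N s` with `s ≠ 0` that fixes `x`. The flow along
the closed geodesic, in the right direction of time, contracts `N s` to the identity inside the
stabilizer of `x`, which is discrete: a contradiction (`IsHorocyclic.eq_zero_of_smul_eq`).

Lengths: `ω₀(e₀) = 1`, so the period of `ω₀` is `T`. The action on the hyperbolic plane is proper
and `Γ` is torsion-free, so each point is moved by a definite amount by all non-trivial elements
(`exists_le_dist_smul`). Therefore short arcs of the lifted geodesic project isometrically, and the
projection has length `T`. -/

theorem continuous_smul_point {Γ : Subgroup PSL(2, ℝ)} {X : Type*} [TopologicalSpace X]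
    {A : X → PSL(2, ℝ)} {p : X} (hA : ContinuousAt A p) (x : M Γ) : ContinuousAt (fun p => A p • x) p := by
  obtain ⟨g, rfl⟩ := QuotientGroup.mk_surjective x
  exact QuotientGroup.continuous_mk.continuousAt.comp (hA.mul continuousAt_const)

/-! ### Charts of the quotient as orbit maps -/

section Charts

variable {Γ : Subgroup PSL(2, ℝ)} [DiscreteTopology Γ]

/-- The local section and the translated big cell are based at the same lift of `x`, so going back
through the chart multiplies this lift by `cellMatrix w` on the left. There is no condition on `w`:
the inverse of the local section is the quotient map everywhere. -/
theorem chartAt_symm_apply (x : M Γ) (w : ℝ × ℝ × ℝ) :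
    (chartAt (ℝ × ℝ × ℝ) x).symm w = (cellMatrix w : PSL(2, ℝ)) • x := by
  let g : PSL(2, ℝ) := (QuotientGroup.mk_surjective (s := Γ)).hasRightInverse.choose x
  have hgx : (g : M Γ) = x :=
    (QuotientGroup.mk_surjective (s := Γ)).hasRightInverse.choose_spec x
  change ((isLocalHomeomorph_mk Γ).localInverseAt g).symm ((cellMatrix w : PSL(2, ℝ)) * g⁻¹⁻¹) = _
  rw [IsLocalHomeomorph.localInverseAt_symm, inv_inv]
  conv_rhs => rw [← hgx]
  rfl


theorem cellMatrix_zero : cellMatrix 0 = 1 := by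
  ext i j; fin_cases i <;> fin_cases j <;> simp [cellMatrix]

theorem cellCoords_mk (A : SL(2, ℝ)) : cellCoords (A : PSL(2, ℝ)) = cellCoordsSL A := rfl

/-- For `q` near `1` the product `q * σ y` stays on the sheet of the local section `σ`, so it is the
lift of `q • y`. This is the passage from the manifold to matrices on which all later derivatives
rest. -/
theorem eventually_chartAt_smul {x y : M Γ} (hy : y ∈ (chartAt (ℝ × ℝ × ℝ) x).source) :
    ∀ᶠ q in 𝓝 (1 : PSL(2, ℝ)), chartAt (ℝ × ℝ × ℝ) x (q • y) =
      cellCoords (q * (cellMatrix (chartAt (ℝ × ℝ × ℝ) x y) : PSL(2, ℝ))) := by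
  let g : PSL(2, ℝ) := (QuotientGroup.mk_surjective (s := Γ)).hasRightInverse.choose x
  set σ := (isLocalHomeomorph_mk Γ).localInverseAt g with hσ
  have hσs : ∀ p, σ.symm p = (p : M Γ) := fun p => by
    rw [hσ, IsLocalHomeomorph.localInverseAt_symm]
  have hy' : y ∈ (σ.trans (pslChart g)).source := hy
  rw [OpenPartialHomeomorph.trans_source] at hy'
  obtain ⟨hy1, hy2⟩ := hy'
  have hy3 : σ y * g⁻¹ ∈ cellSet := mem_pslChart_source.1 hy2
  have hmk : ((σ y : PSL(2, ℝ)) : M Γ) = y := by rw [← hσs, σ.left_inv hy1]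
  have hcell : (cellMatrix (chartAt (ℝ × ℝ × ℝ) x y) : PSL(2, ℝ)) = σ y * g⁻¹ := by
    change (cellMatrix (cellCoords (σ y * g⁻¹)) : PSL(2, ℝ)) = _
    exact cellChart.left_inv hy3
  have h1 : ∀ᶠ q in 𝓝 (1 : PSL(2, ℝ)), q * σ y ∈ σ.target := by
    have h2 : Continuous fun q : PSL(2, ℝ) => q * σ y := continuous_id.mul continuous_const
    refine h2.continuousAt.eventually_mem (σ.open_target.mem_nhds ?_)
    rw [one_mul]; exact σ.map_source hy1
  filter_upwards [h1] with q hq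
  have h2 : q • y = ((q * σ y : PSL(2, ℝ)) : M Γ) := by
    conv_lhs => rw [← hmk]
    rfl
  have h3 := σ.right_inv hq
  rw [hσs] at h3
  change cellCoords (σ (q • y) * g⁻¹) = _
  rw [h2, h3, hcell, mul_assoc]

/-- Every point is the origin of its own preferred chart. Vectors at `x` are therefore measured by
derivatives of orbit maps at the identity, that is, in the right-invariant frame. -/
theorem chartAt_self (x : M Γ) : chartAt (ℝ × ℝ × ℝ) x x = 0 := by
  let g : PSL(2, ℝ) := (QuotientGroup.mk_surjective (s := Γ)).hasRightInverse.choose x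
  have hgx : (g : M Γ) = x :=
    (QuotientGroup.mk_surjective (s := Γ)).hasRightInverse.choose_spec x
  set σ := (isLocalHomeomorph_mk Γ).localInverseAt g with hσ
  have hσs : ∀ p, σ.symm p = (p : M Γ) := fun p => by
    rw [hσ, IsLocalHomeomorph.localInverseAt_symm]
  have h3 := σ.right_inv (isLocalHomeomorph_mk Γ).self_mem_localInverseAt_target
  rw [hσs, hgx] at h3
  change cellCoords (σ x * g⁻¹) = _
  rw [h3, mul_inv_cancel]
  change cellCoordsSL 1 = 0
  simp [cellCoordsSL]

theorem eventually_chartAt_smul_self (x : M Γ) :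
    ∀ᶠ q in 𝓝 (1 : PSL(2, ℝ)), chartAt (ℝ × ℝ × ℝ) x (q • x) = cellCoords q := by
  filter_upwards [eventually_chartAt_smul (mem_chart_source (ℝ × ℝ × ℝ) x)] with q hq
  rw [hq, chartAt_self, cellMatrix_zero]
  exact congrArg cellCoords (mul_one q)

variable {E : Type*} [NormedAddCommGroup E] [NormedSpace ℝ E]

theorem continuousAt_mk {X : Type*} [TopologicalSpace X] {A : X → SL(2, ℝ)} {p : X}
    (hA : ContinuousAt A p) : ContinuousAt (fun p => (A p : PSL(2, ℝ))) p :=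
  QuotientGroup.continuous_mk.continuousAt.comp hA

theorem eventually_chartAt_orbit {X : Type*} [TopologicalSpace X] {A : X → SL(2, ℝ)} {p : X}
    (hA : ContinuousAt A p) (h1 : A p = 1) {x y : M Γ}
    (hy : y ∈ (chartAt (ℝ × ℝ × ℝ) x).source) :
    ∀ᶠ q in 𝓝 p, chartAt (ℝ × ℝ × ℝ) x ((A q : PSL(2, ℝ)) • y) =
      cellCoordsSL (A q * cellMatrix (chartAt (ℝ × ℝ × ℝ) x y)) := by
  have h := continuousAt_mk hA
  rw [ContinuousAt, h1] at h
  exact h.eventually (eventually_chartAt_smul hy)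

theorem eventually_chartAt_orbit_self {X : Type*} [TopologicalSpace X] {A : X → SL(2, ℝ)} {p : X}
    (hA : ContinuousAt A p) (h1 : A p = 1) (x : M Γ) :
    ∀ᶠ q in 𝓝 p, chartAt (ℝ × ℝ × ℝ) x ((A q : PSL(2, ℝ)) • x) = cellCoordsSL (A q) := by
  have h := continuousAt_mk hA
  rw [ContinuousAt, h1] at h
  exact h.eventually (eventually_chartAt_smul_self x)

/-- The derivative of an orbit map `p ↦ A p • x` where `A p = 1`. -/
theorem hasMFDerivAt_orbit {A : E → SL(2, ℝ)} {p : E} (hA : ContinuousAt A p) (h1 : A p = 1)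
    {L : E →L[ℝ] ℝ × ℝ × ℝ} (hL : HasFDerivAt (fun q => cellCoordsSL (A q)) L p) (x : M Γ) :
    HasMFDerivAt 𝓘(ℝ, E) model (fun q => (A q : PSL(2, ℝ)) • x) p L := by
  have h0 : ((A p : SL(2, ℝ)) : PSL(2, ℝ)) • x = x := by
    rw [h1]; exact one_smul PSL(2, ℝ) x
  refine ⟨continuous_smul_point (continuousAt_mk hA) x, ?_⟩
  have hw : HasFDerivAt (writtenInExtChartAt 𝓘(ℝ, E) model p
      (fun q => (A q : PSL(2, ℝ)) • x)) L p := by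
    refine hL.congr_of_eventuallyEq ?_
    filter_upwards [eventually_chartAt_orbit_self hA h1 x] with t ht
    simp only [writtenInExtChartAt, h0, extChartAt_model_space_eq_id]
    exact ht
  exact hw.hasFDerivWithinAt (s := range 𝓘(ℝ, E))

theorem continuousAt_SL {X : Type*} [TopologicalSpace X] {A : X → SL(2, ℝ)} {p : X}
    (h : ∀ i j, ContinuousAt (fun t => A t i j) p) : ContinuousAt A p := by
  have : ContinuousAt (fun t => (A t).1) p :=
    tendsto_pi_nhds.2 fun i => tendsto_pi_nhds.2 fun j => h i j
  exact tendsto_subtype_rng.2 this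

theorem contDiffAt_cellCoordsSL {n : WithTop ℕ∞} {A : E → SL(2, ℝ)} {p : E}
    (h : ∀ i j, ContDiffAt ℝ n (fun t => A t i j) p) (h0 : A p 0 0 ≠ 0) :
    ContDiffAt ℝ n (fun q => cellCoordsSL (A q)) p :=
  ((h 1 0).div (h 0 0) h0).prodMk
    ((contDiffAt_const.mul ((h 0 0).log h0)).prodMk ((h 0 1).div (h 0 0) h0))

theorem contDiffAt_entry_mul {n : WithTop ℕ∞} {A B : E → SL(2, ℝ)} {p : E}
    (hA : ∀ i j, ContDiffAt ℝ n (fun t => A t i j) p)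
    (hB : ∀ i j, ContDiffAt ℝ n (fun t => B t i j) p) (i j : Fin 2) :
    ContDiffAt ℝ n (fun t => (A t * B t) i j) p := by
  simp only [Matrix.SpecialLinearGroup.coe_mul, Matrix.mul_apply, Fin.sum_univ_two]
  exact ((hA _ _).mul (hB _ _)).add ((hA _ _).mul (hB _ _))

/-- Orbit maps `p ↦ A p • x` are smooth. -/
theorem contMDiffAt_orbit {A : E → SL(2, ℝ)} {p : E}
    (hA : ∀ i j, ContDiffAt ℝ ∞ (fun t => A t i j) p) (x : M Γ) :
    ContMDiffAt 𝓘(ℝ, E) model ∞ (fun q => (A q : PSL(2, ℝ)) • x) p := by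
  -- Dividing by `A p` on the right makes the family pass through the identity at `p`, so that the
  -- chart centred at `A p • x` sees only cell coordinates of `B`.
  set B : E → SL(2, ℝ) := fun q => A q * (A p)⁻¹ with hB
  have hBp : B p = 1 := mul_inv_cancel _
  have hBs : ∀ i j, ContDiffAt ℝ ∞ (fun t => B t i j) p := fun i j =>
    contDiffAt_entry_mul hA (fun _ _ => contDiffAt_const) i j
  set y : M Γ := (A p : PSL(2, ℝ)) • x with hy
  have hBy : ∀ q, (A q : PSL(2, ℝ)) • x = (B q : PSL(2, ℝ)) • y := fun q => by
    rw [hy, smul_smul, ← QuotientGroup.mk_mul, hB, inv_mul_cancel_right]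
  have hBc : ContinuousAt B p := continuousAt_SL fun i j => (hBs i j).continuousAt
  refine contMDiffAt_iff.2 ⟨continuous_smul_point
    (continuousAt_mk (continuousAt_SL fun i j => (hA i j).continuousAt)) x, ?_⟩
  have : ContDiffAt ℝ ∞ (fun q => cellCoordsSL (B q)) p :=
    contDiffAt_cellCoordsSL hBs (by rw [hBp]; simp)
  refine (this.congr_of_eventuallyEq ?_).contDiffWithinAt
  filter_upwards [eventually_chartAt_orbit_self hBc hBp y] with q hq
  rw [← hq, ← hBy]
  rfl

theorem contMDiff_orbit {A : E → SL(2, ℝ)} (hA : ∀ i j, ContDiff ℝ ∞ fun t => A t i j) (x : M Γ) :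
    ContMDiff 𝓘(ℝ, E) model ∞ (fun q => (A q : PSL(2, ℝ)) • x) :=
  fun _ => contMDiffAt_orbit (fun i j => (hA i j).contDiffAt) x

theorem contDiff_cellMatrix (i j : Fin 2) : ContDiff ℝ ∞ fun w => cellMatrix w i j := by
  fin_cases i <;> fin_cases j <;> simp [cellMatrix] <;> fun_prop

/-- Smoothness at `x` can be tested along `w ↦ cellMatrix w • x`. -/
theorem contMDiffAt_of_cell {H : Type*} [TopologicalSpace H] {I : ModelWithCorners ℝ E H}
    {N : Type*} [TopologicalSpace N] [ChartedSpace H N] {f : M Γ → N} {x : M Γ}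
    (h : ContMDiffAt 𝓘(ℝ, ℝ × ℝ × ℝ) I ∞
      (fun w : ℝ × ℝ × ℝ => f ((cellMatrix w : PSL(2, ℝ)) • x)) 0) :
    ContMDiffAt model I ∞ f x := by
  have hc : ContMDiffAt model 𝓘(ℝ, ℝ × ℝ × ℝ) ∞ (chartAt (ℝ × ℝ × ℝ) x) x :=
    contMDiffAt_of_mem_maximalAtlas (IsManifold.chart_mem_maximalAtlas x) (mem_chart_source _ x)
  rw [← chartAt_self x] at h
  refine (h.comp x hc).congr_of_eventuallyEq ?_
  filter_upwards [(chartAt (ℝ × ℝ × ℝ) x).open_source.mem_nhds (mem_chart_source _ x)] with y hy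
  simp only [Function.comp_apply]
  rw [← chartAt_symm_apply, (chartAt (ℝ × ℝ × ℝ) x).left_inv hy]

/-- Left translations are smooth. -/
theorem contMDiff_smul (B : SL(2, ℝ)) :
    ContMDiff model model ∞ (fun x : M Γ => (B : PSL(2, ℝ)) • x) := by
  refine fun x => contMDiffAt_of_cell ?_
  have := contMDiffAt_orbit (A := fun w => B * cellMatrix w) (p := 0)
    (contDiffAt_entry_mul (fun _ _ => contDiffAt_const)
      fun i j => (contDiff_cellMatrix i j).contDiffAt) x
  simpa only [QuotientGroup.mk_mul, mul_smul] using this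

end Charts

/-! ### The right-invariant trivialization of the tangent bundle -/

section Frame

/-- The derivative at `0` of `w' ↦ cellCoordsSL (cellMatrix w' * cellMatrix w)`: it expresses a
right-invariant vector field in the coordinates of the big cell. -/
def frameMap (w : ℝ × ℝ × ℝ) : ℝ × ℝ × ℝ →L[ℝ] ℝ × ℝ × ℝ :=
  let a := ContinuousLinearMap.fst ℝ ℝ (ℝ × ℝ)
  let b := (ContinuousLinearMap.fst ℝ ℝ ℝ).comp (ContinuousLinearMap.snd ℝ ℝ (ℝ × ℝ))
  let d := (ContinuousLinearMap.snd ℝ ℝ ℝ).comp (ContinuousLinearMap.snd ℝ ℝ (ℝ × ℝ))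
  (a - w.1 • b - w.1 ^ 2 • d).prod ((b + (2 * w.1) • d).prod (Real.exp (-w.2.1) • d))

theorem frameMap_apply (w v : ℝ × ℝ × ℝ) : frameMap w v =
    (v.1 - w.1 * v.2.1 - w.1 ^ 2 * v.2.2, v.2.1 + 2 * w.1 * v.2.2, Real.exp (-w.2.1) * v.2.2) := by
  simp [frameMap]

theorem contDiff_frameMap_apply (v : ℝ × ℝ × ℝ) : ContDiff ℝ ∞ fun w => frameMap w v := by
  simp only [frameMap_apply]
  fun_prop

/-- This is the lower-diagonal-upper factorization of a product of two such factorizations.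
Commuting the inner upper and lower unipotent factors produces the denominator `1 + v.2.2 * w.1`,
which is positive for `v` near `0`. -/
theorem cellCoordsSL_cellMatrix_mul (w v : ℝ × ℝ × ℝ) (h : 0 < 1 + v.2.2 * w.1) :
    cellCoordsSL (cellMatrix v * cellMatrix w) =
      (v.1 + Real.exp (-v.2.1) * w.1 / (1 + v.2.2 * w.1),
        v.2.1 + w.2.1 + 2 * Real.log (1 + v.2.2 * w.1),
        w.2.2 + Real.exp (-w.2.1) * v.2.2 / (1 + v.2.2 * w.1)) := by
  have e2 : ∀ x : ℝ, Real.exp (-x) = (Real.exp (x / 2))⁻¹ ^ 2 := fun x => by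
    rw [← Real.exp_neg, ← Real.exp_nat_mul]; congr 1; push_cast; ring
  have hv := Real.exp_pos (v.2.1 / 2)
  have hw := Real.exp_pos (w.2.1 / 2)
  have h00 : (cellMatrix v * cellMatrix w) 0 0 =
      Real.exp (v.2.1 / 2) * Real.exp (w.2.1 / 2) * (1 + v.2.2 * w.1) := by
    rw [Matrix.SpecialLinearGroup.coe_mul, Matrix.mul_apply, Fin.sum_univ_two]
    simp [cellMatrix]; ring
  have h01 : (cellMatrix v * cellMatrix w) 0 1 =
      Real.exp (v.2.1 / 2) * (Real.exp (w.2.1 / 2) * w.2.2 * (1 + v.2.2 * w.1) +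
        v.2.2 * (Real.exp (w.2.1 / 2))⁻¹) := by
    rw [Matrix.SpecialLinearGroup.coe_mul, Matrix.mul_apply, Fin.sum_univ_two]
    simp [cellMatrix, Real.exp_neg]; ring
  have h10 : (cellMatrix v * cellMatrix w) 1 0 =
      (v.1 * Real.exp (v.2.1 / 2) * (1 + v.2.2 * w.1) + (Real.exp (v.2.1 / 2))⁻¹ * w.1) *
        Real.exp (w.2.1 / 2) := by
    rw [Matrix.SpecialLinearGroup.coe_mul, Matrix.mul_apply, Fin.sum_univ_two]
    simp [cellMatrix, Real.exp_neg]; ring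
  have hne := h.ne'
  simp only [cellCoordsSL, h00, h01, h10]
  refine Prod.ext ?_ (Prod.ext ?_ ?_)
  · simp only [e2]; field_simp
  · simp only
    rw [Real.log_mul (mul_pos hv hw).ne' hne, Real.log_mul hv.ne' hw.ne', Real.log_exp,
      Real.log_exp]
    ring
  · simp only [e2]; field_simp

theorem hasFDerivAt_cellCoordsSL_cellMatrix_mul (w : ℝ × ℝ × ℝ) :
    HasFDerivAt (fun v => cellCoordsSL (cellMatrix v * cellMatrix w)) (frameMap w) 0 := by
  have hev : ∀ᶠ v : ℝ × ℝ × ℝ in 𝓝 0, 0 < 1 + v.2.2 * w.1 := by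
    have : Continuous fun v : ℝ × ℝ × ℝ => 1 + v.2.2 * w.1 := by fun_prop
    exact this.continuousAt.eventually (lt_mem_nhds (by simp))
  refine HasFDerivAt.congr_of_eventuallyEq ?_
    (hev.mono fun v hv => cellCoordsSL_cellMatrix_mul w v hv)
  have ha : HasFDerivAt (fun v : ℝ × ℝ × ℝ => v.1) _ 0 := hasFDerivAt_fst (𝕜 := ℝ)
  have hs : HasFDerivAt (fun v : ℝ × ℝ × ℝ => v.2) _ 0 := hasFDerivAt_snd (𝕜 := ℝ)
  have hb : HasFDerivAt (fun v : ℝ × ℝ × ℝ => v.2.1) _ 0 := hs.fst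
  have hd : HasFDerivAt (fun v : ℝ × ℝ × ℝ => v.2.2) _ 0 := hs.snd
  have hD := (hd.mul_const w.1).const_add 1
  have h0 : (1 : ℝ) + (0 : ℝ × ℝ × ℝ).2.2 * w.1 ≠ 0 := by simp
  have hi := HasDerivAt.comp_hasFDerivAt (f := fun v : ℝ × ℝ × ℝ => 1 + v.2.2 * w.1) 0
    (hasDerivAt_inv h0) hD
  have h1 := ha.fun_add ((hb.fun_neg.exp.mul_const w.1).fun_mul hi)
  have h2 := (hb.add_const w.2.1).fun_add ((hD.log h0).const_mul 2)
  have h3 := ((hd.const_mul (Real.exp (-w.2.1))).fun_mul hi).const_add w.2.2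
  have := h1.prodMk (h2.prodMk h3)
  simp only [Function.comp_def, ← div_eq_mul_inv] at this
  refine this.congr_fderiv ?_
  ext <;> simp [frameMap] <;> ring

variable {Γ : Subgroup PSL(2, ℝ)} [DiscreteTopology Γ]

/-- The derivative of a chart. -/
theorem hasMFDerivAt_chartAt {x y : M Γ} (hy : y ∈ (chartAt (ℝ × ℝ × ℝ) x).source) :
    HasMFDerivAt model 𝓘(ℝ, ℝ × ℝ × ℝ) (chartAt (ℝ × ℝ × ℝ) x) y
      (frameMap (chartAt (ℝ × ℝ × ℝ) x y)) := by
  refine ⟨(chartAt (ℝ × ℝ × ℝ) x).continuousAt hy, ?_⟩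
  refine HasFDerivAt.hasFDerivWithinAt ?_
  have h0 : extChartAt model y y = 0 := chartAt_self y
  rw [h0]
  refine (hasFDerivAt_cellCoordsSL_cellMatrix_mul _).congr_of_eventuallyEq ?_
  filter_upwards [eventually_chartAt_orbit continuous_cellMatrix.continuousAt cellMatrix_zero hy]
    with w hw
  rw [← hw, ← chartAt_symm_apply]
  rfl

/-- The triple `v` refers to the chart at `y`, while the trivialization refers to the chart at `x`;
the derivative of the change of charts is `frameMap`. -/
theorem trivializationAt_eq_frameMap {x y : M Γ} (hy : y ∈ (chartAt (ℝ × ℝ × ℝ) x).source)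
    (v : TangentSpace model y) :
    (trivializationAt (ℝ × ℝ × ℝ) (TangentSpace model) x ⟨y, v⟩).2 =
      frameMap (chartAt (ℝ × ℝ × ℝ) x y) v := by
  rw [TangentBundle.trivializationAt_apply]
  have h : HasFDerivWithinAt (writtenInExtChartAt model 𝓘(ℝ, ℝ × ℝ × ℝ) y
      (chartAt (ℝ × ℝ × ℝ) x)) (frameMap (chartAt (ℝ × ℝ × ℝ) x y)) (range model)
      (extChartAt model y y) := (hasMFDerivAt_chartAt hy).2
  have := h.fderivWithin ((ModelWithCorners.uniqueDiffOn model) _ (mem_range_self _))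
  exact congrArg (fun L : ℝ × ℝ × ℝ →L[ℝ] ℝ × ℝ × ℝ => L v) this

theorem contMDiffAt_chartAt (x : M Γ) :
    ContMDiffAt model 𝓘(ℝ, ℝ × ℝ × ℝ) ∞ (chartAt (ℝ × ℝ × ℝ) x) x :=
  contMDiffAt_of_mem_maximalAtlas (IsManifold.chart_mem_maximalAtlas x) (mem_chart_source _ x)

theorem eventually_mem_chartAt_source (x : M Γ) :
    ∀ᶠ y in 𝓝 x, y ∈ (chartAt (ℝ × ℝ × ℝ) x).source :=
  (chartAt (ℝ × ℝ × ℝ) x).open_source.mem_nhds (mem_chart_source _ x)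

/-- Smooth vector fields in terms of the right-invariant trivialization of the tangent bundle. -/
theorem isSmoothField_iff {X : ∀ x : M Γ, TangentSpace model x} :
    IsSmoothField model X ↔ ∀ x : M Γ, ContMDiffAt model 𝓘(ℝ, ℝ × ℝ × ℝ) ∞
      (fun y => frameMap (chartAt (ℝ × ℝ × ℝ) x y) (X y)) x := by
  refine forall_congr' fun x => (Bundle.contMDiffAt_section x).trans ?_
  exact Filter.EventuallyEq.contMDiffAt_iff
    ((eventually_mem_chartAt_source x).mono fun y hy => trivializationAt_eq_frameMap hy (X y))

/-- Right-invariant vector fields are smooth. -/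
theorem isSmoothField_const (v : ℝ × ℝ × ℝ) :
    IsSmoothField model (fun _ => v : ∀ x : M Γ, TangentSpace model x) :=
  isSmoothField_iff.2 fun x => (contDiff_frameMap_apply v).contMDiff.contMDiffAt.comp x
    (contMDiffAt_chartAt x)

section Coframe

variable (c : ℝˣ) (x : M Γ)

theorem coframe_frame (i j : Fin 3) :
    coframe c i x (![e0 x, ePlus c x, eMinus c x] j) = if j = i then 1 else 0 := by
  have h : ![e0 x, ePlus c x, eMinus c x] j = frame c x j := by simp [frame]
  rw [h]
  change (frame c x).coord i (frame c x j) = _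
  rw [Module.Basis.coord_apply, Module.Basis.repr_self, Finsupp.single_apply]

theorem decomp (v : ℝ × ℝ × ℝ) : (v : TangentSpace model x) =
    v.2.1 • e0 x + (v.2.2 / c) • ePlus c x + (2 * c * v.1) • eMinus c x := by
  rw [e0_eq, ePlus_eq, eMinus_eq]
  have := c.ne_zero
  change (v : ℝ × ℝ × ℝ) = v.2.1 • ((0, 1, 0) : ℝ × ℝ × ℝ) + (v.2.2 / c) • ((0, 0, (c : ℝ)) : ℝ × ℝ × ℝ)
    + (2 * c * v.1) • ((1 / (2 * (c : ℝ)), 0, 0) : ℝ × ℝ × ℝ)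
  ext <;> simp
  field_simp

theorem omega0_apply (v : ℝ × ℝ × ℝ) : omega0 c x v = v.2.1 := by
  have h := coframe_frame c x 0
  have h0 := h 0; have h1 := h 1; have h2 := h 2
  simp at h0 h1 h2
  have := congrArg (omega0 c x) (decomp c x v)
  rw [map_add, map_add, map_smul, map_smul, map_smul] at this
  rw [omega0] at *
  rw [h0, h1, h2] at this
  simpa using this

theorem omegaPlus_apply (v : ℝ × ℝ × ℝ) : omegaPlus c x v = v.2.2 / c := by
  have h := coframe_frame c x 1
  have h0 := h 0; have h1 := h 1; have h2 := h 2
  simp at h0 h1 h2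
  have := congrArg (omegaPlus c x) (decomp c x v)
  rw [map_add, map_add, map_smul, map_smul, map_smul] at this
  rw [omegaPlus] at *
  rw [h0, h1, h2] at this
  simpa using this

theorem omegaMinus_apply (v : ℝ × ℝ × ℝ) : omegaMinus c x v = 2 * c * v.1 := by
  have h := coframe_frame c x 2
  have h0 := h 0; have h1 := h 1; have h2 := h 2
  simp at h0 h1 h2
  have := congrArg (omegaMinus c x) (decomp c x v)
  rw [map_add, map_add, map_smul, map_smul, map_smul] at this
  rw [omegaMinus] at *
  rw [h0, h1, h2] at this
  simpa using this

theorem mem_kernel_omegaPlus (v : ℝ × ℝ × ℝ) : (v : TangentSpace model x) ∈ kernel (omegaPlus c) x ↔ v.2.2 = 0 := by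
  change omegaPlus c x v = 0 ↔ _
  rw [omegaPlus_apply]; simp

theorem mem_kernel_omegaMinus (v : ℝ × ℝ × ℝ) : (v : TangentSpace model x) ∈ kernel (omegaMinus c) x ↔ v.1 = 0 := by
  change omegaMinus c x v = 0 ↔ _
  rw [omegaMinus_apply]; simp

theorem kernel_omegaPlus_eq_span :
    kernel (omegaPlus c) x = Submodule.span ℝ {e0 x, eMinus c x} := by
  apply le_antisymm
  · intro v hv
    have h0 := (mem_kernel_omegaPlus c x v).1 hv
    rw [Submodule.mem_span_pair]
    refine ⟨(v : ℝ × ℝ × ℝ).2.1, 2 * c * (v : ℝ × ℝ × ℝ).1, ?_⟩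
    have := decomp c x v
    rw [h0, zero_div, zero_smul, add_zero] at this
    exact this.symm
  · rw [Submodule.span_le]
    rintro v (rfl | rfl)
    · rw [SetLike.mem_coe, e0_eq]; exact (mem_kernel_omegaPlus c x _).2 rfl
    · rw [SetLike.mem_coe, eMinus_eq]; exact (mem_kernel_omegaPlus c x _).2 rfl

theorem kernel_omegaMinus_eq_span :
    kernel (omegaMinus c) x = Submodule.span ℝ {e0 x, ePlus c x} := by
  apply le_antisymm
  · intro v hv
    have h0 := (mem_kernel_omegaMinus c x v).1 hv
    rw [Submodule.mem_span_pair]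
    refine ⟨(v : ℝ × ℝ × ℝ).2.1, (v : ℝ × ℝ × ℝ).2.2 / c, ?_⟩
    have := decomp c x v
    rw [h0, mul_zero, zero_smul, add_zero] at this
    exact this.symm
  · rw [Submodule.span_le]
    rintro v (rfl | rfl)
    · rw [SetLike.mem_coe, e0_eq]; exact (mem_kernel_omegaMinus c x _).2 rfl
    · rw [SetLike.mem_coe, ePlus_eq]; exact (mem_kernel_omegaMinus c x _).2 rfl

end Coframe

/-- One component of the inverse of `frameMap w`. It shows that the right-invariant coefficient
along `e₀` depends smoothly on the point and on the components in a fixed chart, which is what the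
smoothness of `ω₀` needs. -/
theorem diag_eq_frameMap (w v : ℝ × ℝ × ℝ) : v.2.1 =
    (frameMap w v).2.1 - 2 * w.1 * Real.exp w.2.1 * (frameMap w v).2.2 := by
  simp only [frameMap_apply, Real.exp_neg]
  field_simp
  ring

theorem isSmoothForm_omega0 (c : ℝˣ) : IsSmoothForm model (omega0 (Γ := Γ) c) := by
  intro X hX x
  have h := isSmoothField_iff.1 hX x
  have hφ := contMDiffAt_chartAt x
  have hG : ContDiff ℝ ∞ fun p : (ℝ × ℝ × ℝ) × (ℝ × ℝ × ℝ) =>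
      p.2.2.1 - 2 * p.1.1 * Real.exp p.1.2.1 * p.2.2.2 := by fun_prop
  refine (hG.contMDiff.contMDiffAt.comp x (hφ.prodMk_space h)).congr_of_eventuallyEq
    (Eventually.of_forall fun y => ?_)
  exact (omega0_apply c y (X y)).trans (diag_eq_frameMap _ _)

/-! ### Local first integrals and potentials -/

theorem mvfderiv_eq {E H N : Type*} [NormedAddCommGroup E] [NormedSpace ℝ E] [TopologicalSpace H]
    {I : ModelWithCorners ℝ E H} [TopologicalSpace N] [ChartedSpace H N] {f : N → ℝ} {x : N}
    {L : TangentSpace I x →L[ℝ] ℝ} (h : HasMFDerivAt I 𝓘(ℝ) f x L) : mvfderiv I f x = L := by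
  rw [mvfderiv, h.mfderiv]; rfl

theorem mvfderiv_comp_chartAt {Φ : ℝ × ℝ × ℝ → ℝ} {Φ' : ℝ × ℝ × ℝ →L[ℝ] ℝ} {x y : M Γ}
    (hy : y ∈ (chartAt (ℝ × ℝ × ℝ) x).source)
    (h : HasFDerivAt Φ Φ' (chartAt (ℝ × ℝ × ℝ) x y)) (v : ℝ × ℝ × ℝ) :
    mvfderiv model (fun z => Φ (chartAt (ℝ × ℝ × ℝ) x z)) y v =
      Φ' (frameMap (chartAt (ℝ × ℝ × ℝ) x y) v) := by
  have := mvfderiv_eq (h.hasMFDerivAt.comp y (hasMFDerivAt_chartAt hy))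
  exact congrArg (fun L : ℝ × ℝ × ℝ →L[ℝ] ℝ => L v) this

/-- The domain `g₁₁ > 0` in the coordinates of the big cell. -/
def oppositeCell : Set (ℝ × ℝ × ℝ) := {w | 0 < w.1 * Real.exp w.2.1 * w.2.2 + 1}

theorem isOpen_oppositeCell : IsOpen oppositeCell :=
  isOpen_lt continuous_const (by fun_prop)

/-- `g₁₀ / g₁₁` in the coordinates of the big cell. -/
def oppositeSlope (w : ℝ × ℝ × ℝ) : ℝ :=
  w.1 * Real.exp w.2.1 * (w.1 * Real.exp w.2.1 * w.2.2 + 1)⁻¹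

/-- `-2 log g₁₁` in the coordinates of the big cell. -/
def oppositeHeight (w : ℝ × ℝ × ℝ) : ℝ :=
  w.2.1 - 2 * Real.log (w.1 * Real.exp w.2.1 * w.2.2 + 1)

theorem contDiffOn_oppositeSlope : ContDiffOn ℝ ∞ oppositeSlope oppositeCell := by
  unfold oppositeSlope
  refine ContDiffOn.mul (by fun_prop) (ContDiffOn.inv (by fun_prop) fun w hw => (ne_of_gt hw))

theorem contDiffOn_oppositeHeight : ContDiffOn ℝ ∞ oppositeHeight oppositeCell := by
  unfold oppositeHeight
  refine ContDiffOn.sub (by fun_prop) (contDiffOn_const.mul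
    (ContDiffOn.log (by fun_prop) fun w hw => (ne_of_gt hw)))

/-- Left multiplication by an upper triangular matrix rescales the second row of `g` and preserves
the quotient of its entries; so only the lower unipotent component `v.1` contributes. -/
theorem hasFDerivAt_oppositeSlope {w : ℝ × ℝ × ℝ} (hw : w ∈ oppositeCell) :
    ∃ L : ℝ × ℝ × ℝ →L[ℝ] ℝ, HasFDerivAt oppositeSlope L w ∧ ∀ v,
      L (frameMap w v) =
        v.1 * Real.exp w.2.1 / (w.1 * Real.exp w.2.1 * w.2.2 + 1) ^ 2 := by
  have ha : HasFDerivAt (fun v : ℝ × ℝ × ℝ => v.1) _ w := hasFDerivAt_fst (𝕜 := ℝ)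
  have hs : HasFDerivAt (fun v : ℝ × ℝ × ℝ => v.2) _ w := hasFDerivAt_snd (𝕜 := ℝ)
  have hb : HasFDerivAt (fun v : ℝ × ℝ × ℝ => v.2.1) _ w := hs.fst
  have hd : HasFDerivAt (fun v : ℝ × ℝ × ℝ => v.2.2) _ w := hs.snd
  have hq := ha.fun_mul hb.exp
  have hD := (hq.fun_mul hd).add_const 1
  have h0 : w.1 * Real.exp w.2.1 * w.2.2 + 1 ≠ 0 := ne_of_gt hw
  refine ⟨_, hq.fun_mul (HasDerivAt.comp_hasFDerivAt
    (f := fun v : ℝ × ℝ × ℝ => v.1 * Real.exp v.2.1 * v.2.2 + 1) w (hasDerivAt_inv h0) hD), fun v => ?_⟩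
  simp [frameMap_apply, Real.exp_neg]
  field_simp
  ring

/-- For `v.1 = 0` the motion is left multiplication by upper triangular matrices. It multiplies
`g₁₁` by the lower right entry, which for `diagMatrix t` is `exp (-t / 2)`, so `-2 log g₁₁` grows at
the rate `v.2.1`. -/
theorem hasFDerivAt_oppositeHeight {w : ℝ × ℝ × ℝ} (hw : w ∈ oppositeCell) :
    ∃ L : ℝ × ℝ × ℝ →L[ℝ] ℝ, HasFDerivAt oppositeHeight L w ∧ ∀ v : ℝ × ℝ × ℝ, v.1 = 0 →
      L (frameMap w v) = v.2.1 := by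
  have ha : HasFDerivAt (fun v : ℝ × ℝ × ℝ => v.1) _ w := hasFDerivAt_fst (𝕜 := ℝ)
  have hs : HasFDerivAt (fun v : ℝ × ℝ × ℝ => v.2) _ w := hasFDerivAt_snd (𝕜 := ℝ)
  have hb : HasFDerivAt (fun v : ℝ × ℝ × ℝ => v.2.1) _ w := hs.fst
  have hd : HasFDerivAt (fun v : ℝ × ℝ × ℝ => v.2.2) _ w := hs.snd
  have hq := ha.fun_mul hb.exp
  have hD := (hq.fun_mul hd).add_const 1
  have h0 : w.1 * Real.exp w.2.1 * w.2.2 + 1 ≠ 0 := ne_of_gt hw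
  refine ⟨_, hb.sub ((hD.log h0).const_mul 2), fun v hv => ?_⟩
  simp [frameMap_apply, Real.exp_neg, hv]
  field_simp
  ring

theorem contMDiffOn_comp_chartAt {Φ : ℝ × ℝ × ℝ → ℝ} {S : Set (ℝ × ℝ × ℝ)}
    (h : ContDiffOn ℝ ∞ Φ S) (x : M Γ) :
    ContMDiffOn model 𝓘(ℝ) ∞ (fun z => Φ (chartAt (ℝ × ℝ × ℝ) x z))
      ((chartAt (ℝ × ℝ × ℝ) x).source ∩ chartAt (ℝ × ℝ × ℝ) x ⁻¹' S) :=
  h.contMDiffOn.comp ((contMDiffOn_of_mem_maximalAtlas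
    (IsManifold.chart_mem_maximalAtlas x)).mono inter_subset_left) fun _ hz => hz.2

theorem isOpen_chartAt_preimage (x : M Γ) {S : Set (ℝ × ℝ × ℝ)} (hS : IsOpen S) :
    IsOpen ((chartAt (ℝ × ℝ × ℝ) x).source ∩ chartAt (ℝ × ℝ × ℝ) x ⁻¹' S) :=
  (chartAt (ℝ × ℝ × ℝ) x).isOpen_inter_preimage hS

theorem mem_chartAt_preimage (x : M Γ) {S : Set (ℝ × ℝ × ℝ)} (hS : 0 ∈ S) :
    x ∈ (chartAt (ℝ × ℝ × ℝ) x).source ∩ chartAt (ℝ × ℝ × ℝ) x ⁻¹' S :=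
  ⟨mem_chart_source _ x, by rw [mem_preimage, chartAt_self]; exact hS⟩

theorem zero_mem_oppositeCell : 0 ∈ oppositeCell := by simp [oppositeCell]

/-- Lower triangular matrices rescale the first row of `g`, so `g₀₁ / g₀₀` is a first integral of
`ω₊ = 0`. The exponential factor never vanishes, so it has no critical points. -/
theorem mvfderiv_upperCoord {x y : M Γ} (hy : y ∈ (chartAt (ℝ × ℝ × ℝ) x).source)
    (v : ℝ × ℝ × ℝ) :
    mvfderiv model (fun z => (chartAt (ℝ × ℝ × ℝ) x z).2.2) y v =
      Real.exp (-(chartAt (ℝ × ℝ × ℝ) x y).2.1) * v.2.2 := by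
  have h : HasFDerivAt (fun w : ℝ × ℝ × ℝ => w.2.2) _ (chartAt (ℝ × ℝ × ℝ) x y) :=
    HasFDerivAt.snd (hasFDerivAt_snd (𝕜 := ℝ))
  refine (mvfderiv_comp_chartAt hy h v).trans ?_
  rw [frameMap_apply]
  rfl

/-- The coordinate `2 log |g₀₀|` is the potential of `ω₀` on the leaves of `ω₊ = 0`. Transversally
the derivative has the further term `2 g₁₀ / g₀₀ * v.2.2`, hence the condition on `v`. -/
theorem mvfderiv_diagCoord {x y : M Γ} (hy : y ∈ (chartAt (ℝ × ℝ × ℝ) x).source)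
    {v : ℝ × ℝ × ℝ} (hv : v.2.2 = 0) :
    mvfderiv model (fun z => (chartAt (ℝ × ℝ × ℝ) x z).2.1) y v = v.2.1 := by
  have h : HasFDerivAt (fun w : ℝ × ℝ × ℝ => w.2.1) _ (chartAt (ℝ × ℝ × ℝ) x y) :=
    HasFDerivAt.fst (hasFDerivAt_snd (𝕜 := ℝ))
  refine (mvfderiv_comp_chartAt hy h v).trans ?_
  rw [frameMap_apply]
  simp [hv]

theorem mvfderiv_oppositeSlope {x y : M Γ}
    (hy : y ∈ (chartAt (ℝ × ℝ × ℝ) x).source ∩ chartAt (ℝ × ℝ × ℝ) x ⁻¹' oppositeCell) :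
    ∃ r : ℝ, r ≠ 0 ∧ ∀ v : ℝ × ℝ × ℝ,
      mvfderiv model (fun z => oppositeSlope (chartAt (ℝ × ℝ × ℝ) x z)) y v = r * v.1 := by
  obtain ⟨L, hL, hLv⟩ := hasFDerivAt_oppositeSlope hy.2
  set w := chartAt (ℝ × ℝ × ℝ) x y with hw
  have h0 : w.1 * Real.exp w.2.1 * w.2.2 + 1 ≠ 0 := ne_of_gt hy.2
  refine ⟨Real.exp w.2.1 / (w.1 * Real.exp w.2.1 * w.2.2 + 1) ^ 2,
    div_ne_zero (Real.exp_ne_zero _) (pow_ne_zero 2 h0), fun v => ?_⟩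
  refine (mvfderiv_comp_chartAt hy.1 hL v).trans ((hLv v).trans ?_)
  ring

theorem mvfderiv_oppositeHeight {x y : M Γ}
    (hy : y ∈ (chartAt (ℝ × ℝ × ℝ) x).source ∩ chartAt (ℝ × ℝ × ℝ) x ⁻¹' oppositeCell)
    {v : ℝ × ℝ × ℝ} (hv : v.1 = 0) :
    mvfderiv model (fun z => oppositeHeight (chartAt (ℝ × ℝ × ℝ) x z)) y v = v.2.1 := by
  obtain ⟨L, hL, hLv⟩ := hasFDerivAt_oppositeHeight hy.2
  exact (mvfderiv_comp_chartAt hy.1 hL v).trans (hLv v hv)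

theorem isCodimOneFoliation_omegaPlus (c : ℝˣ) :
    IsCodimOneFoliation model (kernel (omegaPlus (Γ := Γ) c)) := by
  intro x
  refine ⟨_, isOpen_chartAt_preimage x isOpen_univ, mem_chartAt_preimage x (mem_univ _), _,
    contMDiffOn_comp_chartAt (Φ := fun w => w.2.2) (by fun_prop) x, fun y hy => ⟨fun h => ?_, ?_⟩⟩
  · have := mvfderiv_upperCoord hy.1 (0, 0, 1)
    rw [h] at this
    exact (Real.exp_pos _).ne (this.trans (mul_one _))
  · ext v
    refine (mem_kernel_omegaPlus c y v).trans ?_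
    refine Iff.trans ?_ (Eq.congr_left (mvfderiv_upperCoord hy.1 v)).symm
    simp

theorem isCodimOneFoliation_omegaMinus (c : ℝˣ) :
    IsCodimOneFoliation model (kernel (omegaMinus (Γ := Γ) c)) := by
  intro x
  refine ⟨_, isOpen_chartAt_preimage x isOpen_oppositeCell,
    mem_chartAt_preimage x zero_mem_oppositeCell, _,
    contMDiffOn_comp_chartAt contDiffOn_oppositeSlope x, fun y hy => ?_⟩
  obtain ⟨r, hr, hrv⟩ := mvfderiv_oppositeSlope hy
  refine ⟨fun h => ?_, ?_⟩
  · have := hrv (1, 0, 0)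
    rw [h] at this
    exact hr ((this.trans (mul_one _)).symm)
  · ext v
    refine (mem_kernel_omegaMinus c y v).trans ?_
    refine Iff.trans ?_ (Eq.congr_left (hrv v)).symm
    simp [hr]

end Frame

/-! ### The chain rule along parametrized families -/

section Curves

variable {E H N : Type*} [NormedAddCommGroup E] [NormedSpace ℝ E] [TopologicalSpace H]
  {I : ModelWithCorners ℝ E H} [TopologicalSpace N] [ChartedSpace H N]
  {E' H' N' : Type*} [NormedAddCommGroup E'] [NormedSpace ℝ E'] [TopologicalSpace H']
  {I' : ModelWithCorners ℝ E' H'} [TopologicalSpace N'] [ChartedSpace H' N']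

/-- The base point enters through an equation because the orbit maps start at `1 • x`, whereas the
derivative of `f` is wanted at `x`. -/
theorem hasMFDerivAt_comp_of_eq {F : Type*} [NormedAddCommGroup F] [NormedSpace ℝ F]
    {f : N → N'} {γ : F → N} {p : F} {x : N} (h0 : γ p = x)
    (hf : MDifferentiableAt I I' f x) {L : F →L[ℝ] E} (hγ : HasMFDerivAt 𝓘(ℝ, F) I γ p L) :
    HasMFDerivAt 𝓘(ℝ, F) I' (fun q => f (γ q)) p
      (ContinuousLinearMap.comp (mfderiv I I' f x : E →L[ℝ] E') L) := by
  subst h0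
  exact hf.hasMFDerivAt.comp p hγ

theorem comp_toSpanSingleton_one (L : E →L[ℝ] E') (v : E) :
    (L.comp (ContinuousLinearMap.toSpanSingleton ℝ v)) 1 = L v := by
  simp

theorem mfderiv_apply_of_curve {f : N → N'} {γ : ℝ → N} {p : ℝ} {x : N} (h0 : γ p = x)
    (hf : MDifferentiableAt I I' f x) {v : E} {v' : E'}
    (hγ : HasMFDerivAt 𝓘(ℝ, ℝ) I γ p (ContinuousLinearMap.toSpanSingleton ℝ v))
    (hfγ : HasMFDerivAt 𝓘(ℝ, ℝ) I' (fun q => f (γ q)) p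
      (ContinuousLinearMap.toSpanSingleton ℝ v')) :
    (mfderiv I I' f x : E →L[ℝ] E') v = v' := by
  have h := hasMFDerivAt_unique (hasMFDerivAt_comp_of_eq h0 hf hγ) hfγ
  have := congrArg (fun L : ℝ →L[ℝ] E' => L 1) h
  exact (comp_toSpanSingleton_one (E := E) (E' := E') _ v).symm.trans (this.trans (one_smul ℝ v'))

theorem hasFDerivAt_comp_of_eq {F : Type*} [NormedAddCommGroup F] [NormedSpace ℝ F]
    {f : N → ℝ} {γ : F → N} {p : F} {x : N} (h0 : γ p = x)
    (hf : MDifferentiableAt I 𝓘(ℝ) f x) {L : F →L[ℝ] E} (hγ : HasMFDerivAt 𝓘(ℝ, F) I γ p L) :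
    HasFDerivAt (fun q => f (γ q)) ((mvfderiv I f x : E →L[ℝ] ℝ).comp L) p :=
  (hasMFDerivAt_comp_of_eq h0 hf hγ).hasFDerivAt

theorem hasDerivAt_comp_of_eq {f : N → ℝ} {γ : ℝ → N} {p : ℝ} {x : N} (h0 : γ p = x)
    (hf : MDifferentiableAt I 𝓘(ℝ) f x) {v : E}
    (hγ : HasMFDerivAt 𝓘(ℝ, ℝ) I γ p (ContinuousLinearMap.toSpanSingleton ℝ v)) :
    HasDerivAt (fun q => f (γ q)) ((mvfderiv I f x : E →L[ℝ] ℝ) v) p := by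
  exact (comp_toSpanSingleton_one (E := E) (E' := ℝ) (mvfderiv I f x) v) ▸
    (hasFDerivAt_comp_of_eq h0 hf hγ).hasDerivAt

theorem velocity_eq {γ : ℝ → N} {t : ℝ} {v : E}
    (h : HasMFDerivAt 𝓘(ℝ, ℝ) I γ t (ContinuousLinearMap.toSpanSingleton ℝ v)) :
    velocity I γ t = (v : E) := by
  rw [velocity, h.mfderiv]
  exact one_smul ℝ v

end Curves

/-! ### The Jacobi identity for decomposable bivectors -/

section Poisson

variable {E H N : Type*} [NormedAddCommGroup E] [NormedSpace ℝ E] [TopologicalSpace H]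
  {I : ModelWithCorners ℝ E H} [TopologicalSpace N] [ChartedSpace H N]

theorem bracket_smul_wedge (r : ℝ) (X Y : ∀ x : N, TangentSpace I x) (f g : N → ℝ) :
    bracket I (r • wedge I X Y) f g = fun x => r *
      (mvfderiv I f x (X x) * mvfderiv I g x (Y x) -
        mvfderiv I f x (Y x) * mvfderiv I g x (X x)) := rfl

theorem mvfderiv_bracket {r : ℝ} {A B C D : N → ℝ} {x : N}
    (hA : MDifferentiableAt I 𝓘(ℝ) A x) (hB : MDifferentiableAt I 𝓘(ℝ) B x)
    (hC : MDifferentiableAt I 𝓘(ℝ) C x) (hD : MDifferentiableAt I 𝓘(ℝ) D x)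
    (v : TangentSpace I x) :
    mvfderiv I (fun x => r * (A x * B x - C x * D x)) x v =
      r * (A x * mvfderiv I B x v + B x * mvfderiv I A x v -
        (C x * mvfderiv I D x v + D x * mvfderiv I C x v)) := by
  have h := ((hA.hasMFDerivAt.mul hB.hasMFDerivAt).sub (hC.hasMFDerivAt.mul hD.hasMFDerivAt))
  have h2 := h.const_smul r
  have := mvfderiv_eq h2
  refine (congrArg (fun L : TangentSpace I x →L[ℝ] ℝ => L v) this).trans ?_
  rfl

/-- If `[X, Y] = μ Y`, then `X ∧ Y` is a Poisson tensor. -/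
theorem isPoissonTensor_smul_wedge {X Y : ∀ x : N, TangentSpace I x} (r μ : ℝ)
    (hX : ∀ f : N → ℝ, ContMDiff I 𝓘(ℝ) ∞ f →
      ContMDiff I 𝓘(ℝ) ∞ fun x => mvfderiv I f x (X x))
    (hY : ∀ f : N → ℝ, ContMDiff I 𝓘(ℝ) ∞ f →
      ContMDiff I 𝓘(ℝ) ∞ fun x => mvfderiv I f x (Y x))
    (hXY : ∀ f : N → ℝ, ContMDiff I 𝓘(ℝ) ∞ f → ∀ x,
      mvfderiv I (fun y => mvfderiv I f y (Y y)) x (X x) =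
        mvfderiv I (fun y => mvfderiv I f y (X y)) x (Y x) + μ * mvfderiv I f x (Y x)) :
    IsPoissonTensor I (r • wedge I X Y) where
  skew x α := by
    change r * (α (X x) * α (Y x) - α (Y x) * α (X x)) = 0
    ring
  smooth f g hf hg := by
    rw [bracket_smul_wedge]
    exact contMDiff_const.mul (((hX f hf).mul (hY g hg)).sub ((hY f hf).mul (hX g hg)))
  jacobi f g k hf hg hk x := by
    have d : ∀ {f : N → ℝ}, ContMDiff I 𝓘(ℝ) ∞ f → MDifferentiableAt I 𝓘(ℝ) f x := fun hf =>
      (hf x).mdifferentiableAt (by simp)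
    have e := fun (f g : N → ℝ) (hf : ContMDiff I 𝓘(ℝ) ∞ f) (hg : ContMDiff I 𝓘(ℝ) ∞ g) =>
      mvfderiv_bracket (r := r) (d (hX f hf)) (d (hY g hg)) (d (hY f hf)) (d (hX g hg))
    simp only [bracket_smul_wedge]
    -- Each inner bracket is differentiated along both fields, hence the pairs of rewrites. After
    -- `hXY` the second derivatives cancel as for commuting fields. What remains is `μ` times the
    -- cyclic sum of `(Xf Yg - Yf Xg) Yk`, a determinant with rows `X`, `Y`, `Y`.
    rw [e f g hf hg, e f g hf hg, e g k hg hk, e g k hg hk, e k f hk hf, e k f hk hf,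
      hXY f hf, hXY g hg, hXY k hk]
    ring

end Poisson


/-! ### One-parameter groups and their commutators -/

section Flows

/-- A one-parameter group in `SL(2, ℝ)` that is normalized by the diagonal group, with exponent `μ`. -/
structure IsHorocyclic (N : ℝ → SL(2, ℝ)) (μ : ℝ) : Prop where
  add : ∀ s t, N (s + t) = N s * N t
  smooth : ∀ i j, ContDiff ℝ ∞ fun s => N s i j
  conj : ∀ s t, diagMatrix t * N s = N (Real.exp (μ * t) * s) * diagMatrix t

theorem lowerMatrix_add (s t : ℝ) : lowerMatrix (s + t) = lowerMatrix s * lowerMatrix t := by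
  ext i j
  rw [Matrix.SpecialLinearGroup.coe_mul, Matrix.mul_apply, Fin.sum_univ_two]
  fin_cases i <;> fin_cases j <;> simp [lowerMatrix]

theorem upperMatrix_add (s t : ℝ) : upperMatrix (s + t) = upperMatrix s * upperMatrix t := by
  ext i j
  rw [Matrix.SpecialLinearGroup.coe_mul, Matrix.mul_apply, Fin.sum_univ_two]
  fin_cases i <;> fin_cases j <;> simp [upperMatrix, add_comm]

theorem diagMatrix_add (s t : ℝ) : diagMatrix (s + t) = diagMatrix s * diagMatrix t := by
  ext i j
  rw [Matrix.SpecialLinearGroup.coe_mul, Matrix.mul_apply, Fin.sum_univ_two]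
  fin_cases i <;> fin_cases j <;> simp [diagMatrix, ← Real.exp_add] <;> ring

theorem diagMatrix_zero : diagMatrix 0 = 1 := by
  ext i j; fin_cases i <;> fin_cases j <;> simp [diagMatrix]

theorem contDiff_diagMatrix (i j : Fin 2) : ContDiff ℝ ∞ fun t => diagMatrix t i j := by
  fin_cases i <;> fin_cases j <;> simp [diagMatrix] <;> fun_prop

theorem isHorocyclic_lower (k : ℝ) : IsHorocyclic (fun t => lowerMatrix (t / k)) (-1) where
  add s t := by rw [add_div, lowerMatrix_add]
  smooth i j := by fin_cases i <;> fin_cases j <;> simp [lowerMatrix] <;> fun_prop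
  conj s t := by
    have h : Real.exp (-(t / 2)) = Real.exp (-t) * Real.exp (t / 2) := by
      rw [← Real.exp_add]; congr 1; ring
    ext i j
    simp only [Matrix.SpecialLinearGroup.coe_mul, Matrix.mul_apply, Fin.sum_univ_two]
    fin_cases i <;> fin_cases j <;> simp [lowerMatrix, diagMatrix]
    rw [h]; ring

theorem isHorocyclic_upper (k : ℝ) : IsHorocyclic (fun t => upperMatrix (k * t)) 1 where
  add s t := by rw [mul_add, upperMatrix_add]
  smooth i j := by fin_cases i <;> fin_cases j <;> simp [upperMatrix] <;> fun_prop
  conj s t := by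
    have h : Real.exp (t / 2) = Real.exp t * Real.exp (-(t / 2)) := by
      rw [← Real.exp_add]; congr 1; ring
    ext i j
    simp only [Matrix.SpecialLinearGroup.coe_mul, Matrix.mul_apply, Fin.sum_univ_two]
    fin_cases i <;> fin_cases j <;> simp [upperMatrix, diagMatrix]
    rw [h]; ring

theorem IsHorocyclic.zero {N : ℝ → SL(2, ℝ)} {μ : ℝ} (h : IsHorocyclic N μ) : N 0 = 1 := by
  have := h.add 0 0
  rw [add_zero] at this
  exact (left_eq_mul.1 this)

theorem cellCoordsSL_lowerMatrix (s : ℝ) : cellCoordsSL (lowerMatrix s) = (s, 0, 0) := by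
  simp [cellCoordsSL, lowerMatrix]

theorem cellCoordsSL_upperMatrix (s : ℝ) : cellCoordsSL (upperMatrix s) = (0, 0, s) := by
  simp [cellCoordsSL, upperMatrix]

theorem cellCoordsSL_diagMatrix (s : ℝ) : cellCoordsSL (diagMatrix s) = (0, s, 0) := by
  simp [cellCoordsSL, diagMatrix]; ring

theorem hasDerivAt_lower (k t : ℝ) :
    HasDerivAt (fun t => cellCoordsSL (lowerMatrix (t / k))) (1 / k, 0, 0) t := by
  simp only [cellCoordsSL_lowerMatrix]
  exact ((hasDerivAt_id t).div_const k).prodMk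
    ((hasDerivAt_const _ _).prodMk (hasDerivAt_const _ _))

theorem hasDerivAt_upper (k t : ℝ) :
    HasDerivAt (fun t => cellCoordsSL (upperMatrix (k * t))) (0, 0, k) t := by
  simp only [cellCoordsSL_upperMatrix]
  exact (hasDerivAt_const _ _).prodMk
    ((hasDerivAt_const _ _).prodMk (by simpa using (hasDerivAt_id t).const_mul k))

theorem hasDerivAt_diag (t : ℝ) :
    HasDerivAt (fun t => cellCoordsSL (diagMatrix t)) (0, 1, 0) t := by
  simp only [cellCoordsSL_diagMatrix]
  exact (hasDerivAt_const _ _).prodMk ((hasDerivAt_id _).prodMk (hasDerivAt_const _ _))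

theorem one_smul_point {Γ : Subgroup PSL(2, ℝ)} {A : SL(2, ℝ)} (h : A = 1) (x : M Γ) : (A : PSL(2, ℝ)) • x = x := by
  rw [h]; exact one_smul PSL(2, ℝ) x

theorem mk_mul_smul {Γ : Subgroup PSL(2, ℝ)} (A B : SL(2, ℝ)) (x : M Γ) :
    ((A * B : SL(2, ℝ)) : PSL(2, ℝ)) • x = (A : PSL(2, ℝ)) • (B : PSL(2, ℝ)) • x := by
  rw [QuotientGroup.mk_mul, mul_smul]

theorem horocyclePlus_zero {Γ : Subgroup PSL(2, ℝ)} (c : ℝˣ) (x : M Γ) : horocyclePlus c 0 x = x :=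
  one_smul_point (isHorocyclic_lower (2 * c)).zero x

theorem horocycleMinus_zero {Γ : Subgroup PSL(2, ℝ)} (c : ℝˣ) (x : M Γ) : horocycleMinus c 0 x = x :=
  one_smul_point (isHorocyclic_upper c).zero x

variable {Γ : Subgroup PSL(2, ℝ)} [DiscreteTopology Γ]

theorem hasMFDerivAt_congr_curve {γ γ' : ℝ → M Γ} (h : γ = γ') {t : ℝ} {v : ℝ × ℝ × ℝ}
    (hd : HasMFDerivAt 𝓘(ℝ, ℝ) model γ t (ContinuousLinearMap.toSpanSingleton ℝ v)) :
    HasMFDerivAt 𝓘(ℝ, ℝ) model γ' t (ContinuousLinearMap.toSpanSingleton ℝ v) := by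
  subst h
  exact hd

theorem hasMFDerivAt_orbit_curve {A : ℝ → SL(2, ℝ)} {p : ℝ} (hA : ContinuousAt A p) (h1 : A p = 1)
    {v : ℝ × ℝ × ℝ} (hv : HasDerivAt (fun q => cellCoordsSL (A q)) v p) (x : M Γ) :
    HasMFDerivAt 𝓘(ℝ, ℝ) model (fun q => (A q : PSL(2, ℝ)) • x) p
      (ContinuousLinearMap.toSpanSingleton ℝ v) :=
  hasMFDerivAt_orbit hA h1 hv.hasFDerivAt x

/-- The trajectories of a one-parameter group are integral curves of a right-invariant field. -/
theorem hasMFDerivAt_oneParameter {A : ℝ → SL(2, ℝ)} (hs : ∀ i j, ContDiff ℝ ∞ fun s => A s i j)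
    (hadd : ∀ s t, A (s + t) = A s * A t) {v : ℝ × ℝ × ℝ}
    (hv : HasDerivAt (fun q => cellCoordsSL (A q)) v 0) (x : M Γ) (t : ℝ) :
    HasMFDerivAt 𝓘(ℝ, ℝ) model (fun q => (A q : PSL(2, ℝ)) • x) t
      (ContinuousLinearMap.toSpanSingleton ℝ v) := by
  have h0 : A 0 = 1 := by
    have := hadd 0 0
    rw [add_zero] at this
    exact left_eq_mul.1 this
  have hc : Continuous A := continuous_SL fun i j => (hs i j).continuous
  -- Time is restarted at `t`, so that only the derivative at the identity is needed.
  have h : (fun q => (A q : PSL(2, ℝ)) • x) =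
      fun q => (A (q - t) : PSL(2, ℝ)) • ((A t : PSL(2, ℝ)) • x) := by
    funext q
    rw [← mk_mul_smul, ← hadd, sub_add_cancel]
  rw [h]
  refine hasMFDerivAt_orbit_curve (A := fun q => A (q - t))
    (hc.comp (continuous_id.sub continuous_const)).continuousAt (by simp [h0]) ?_ _
  have hv' : HasDerivAt (fun q => cellCoordsSL (A q)) v (t - t) := by rwa [sub_self]
  simpa using hv'.comp_sub_const t t

/-- Right-invariant derivatives through orbit maps. -/
theorem mvfderiv_eq_fderiv {f : M Γ → ℝ} {x : M Γ} (hf : MDifferentiableAt model 𝓘(ℝ) f x)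
    (v : ℝ × ℝ × ℝ) : mvfderiv model f x v =
      fderiv ℝ (fun w => f ((cellMatrix w : PSL(2, ℝ)) • x)) 0 v := by
  have h : HasFDerivAt (fun w => cellCoordsSL (cellMatrix w))
      (ContinuousLinearMap.id ℝ (ℝ × ℝ × ℝ)) 0 := by
    simp only [cellCoordsSL_cellMatrix]
    exact hasFDerivAt_id 0
  have := hasFDerivAt_comp_of_eq (γ := fun w => (cellMatrix w : PSL(2, ℝ)) • x)
    (one_smul_point cellMatrix_zero x) hf
    (hasMFDerivAt_orbit continuous_cellMatrix.continuousAt cellMatrix_zero h x)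
  rw [this.fderiv]
  rfl

theorem contDiff_comp_orbit {E : Type*} [NormedAddCommGroup E] [NormedSpace ℝ E] {f : M Γ → ℝ}
    (hf : ContMDiff model 𝓘(ℝ) ∞ f) {A : E → SL(2, ℝ)} (hA : ∀ i j, ContDiff ℝ ∞ fun t => A t i j)
    (x : M Γ) : ContDiff ℝ ∞ fun p => f ((A p : PSL(2, ℝ)) • x) :=
  (hf.comp (contMDiff_orbit hA x)).contDiff

/-- Right-invariant derivatives of smooth functions are smooth. -/
theorem contMDiff_mvfderiv {f : M Γ → ℝ} (hf : ContMDiff model 𝓘(ℝ) ∞ f) (v : ℝ × ℝ × ℝ) :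
    ContMDiff model 𝓘(ℝ) ∞ fun x => mvfderiv model f x v := by
  refine fun x => contMDiffAt_of_cell (ContDiff.contMDiff ?_).contMDiffAt
  have h : ∀ w : ℝ × ℝ × ℝ, mvfderiv model f ((cellMatrix w : PSL(2, ℝ)) • x) v =
      fderiv ℝ (fun w' => f (((cellMatrix w' * cellMatrix w : SL(2, ℝ)) : PSL(2, ℝ)) • x)) 0 v := by
    intro w
    rw [mvfderiv_eq_fderiv ((hf _).mdifferentiableAt (by simp))]
    simp only [mk_mul_smul]
  simp only [h]
  -- The derivative in `w'` at `0` of a function that is jointly smooth in `(w, w')` is smooth in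
  -- the parameter `w`.
  refine ContDiff.fderiv_apply (f := fun w w' : ℝ × ℝ × ℝ =>
    f (((cellMatrix w' * cellMatrix w : SL(2, ℝ)) : PSL(2, ℝ)) • x)) (m := ∞) ?_ contDiff_const
    contDiff_const (by simp)
  refine contDiff_comp_orbit hf
    (A := fun p : (ℝ × ℝ × ℝ) × (ℝ × ℝ × ℝ) => cellMatrix p.2 * cellMatrix p.1) (fun i j => ?_) x
  refine contDiff_iff_contDiffAt.2 fun p => contDiffAt_entry_mul (fun i j => ?_) (fun i j => ?_) i j
  · exact ((contDiff_cellMatrix i j).comp contDiff_snd).contDiffAt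
  · exact ((contDiff_cellMatrix i j).comp contDiff_fst).contDiffAt

/-- The commutation relation of the geodesic field with a horocyclic field. -/
theorem IsHorocyclic.commutator {N : ℝ → SL(2, ℝ)} {μ : ℝ} (h : IsHorocyclic N μ)
    {v : ℝ × ℝ × ℝ} (hv : HasDerivAt (fun q => cellCoordsSL (N q)) v 0) {f : M Γ → ℝ}
    (hf : ContMDiff model 𝓘(ℝ) ∞ f) (x : M Γ) :
    mvfderiv model (fun y => mvfderiv model f y v) x ((0, 1, 0) : ℝ × ℝ × ℝ) =
      mvfderiv model (fun y => mvfderiv model f y ((0, 1, 0) : ℝ × ℝ × ℝ)) x v +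
        -μ * mvfderiv model f x v := by
  set d : ℝ × ℝ × ℝ := (0, 1, 0) with hd
  -- Both flows are recorded in one function on the plane, so that the commutator becomes a
  -- comparison of its mixed second derivatives at the origin.
  set G : ℝ × ℝ → ℝ := fun p => f (((N p.1 * diagMatrix p.2 : SL(2, ℝ)) : PSL(2, ℝ)) • x) with hG
  have hGs : ContDiff ℝ ∞ G := contDiff_comp_orbit hf
    (A := fun p : ℝ × ℝ => N p.1 * diagMatrix p.2) (fun i j => contDiff_iff_contDiffAt.2 fun p =>
      contDiffAt_entry_mul (fun i j => ((h.smooth i j).comp contDiff_fst).contDiffAt)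
        (fun i j => ((contDiff_diagMatrix i j).comp contDiff_snd).contDiffAt) i j) x
  have md : ∀ {g : M Γ → ℝ}, ContMDiff model 𝓘(ℝ) ∞ g → ∀ y, MDifferentiableAt model 𝓘(ℝ) g y :=
    fun hg y => (hg y).mdifferentiableAt (by simp)
  have hN : ∀ {g : M Γ → ℝ}, ContMDiff model 𝓘(ℝ) ∞ g → ∀ y,
      HasDerivAt (fun s => g ((N s : PSL(2, ℝ)) • y)) (mvfderiv model g y v) 0 := fun hg y =>
    hasDerivAt_comp_of_eq (one_smul_point h.zero y) (md hg y)
      (hasMFDerivAt_oneParameter h.smooth h.add hv y 0)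
  have hD : ∀ {g : M Γ → ℝ}, ContMDiff model 𝓘(ℝ) ∞ g → ∀ y,
      HasDerivAt (fun s => g ((diagMatrix s : PSL(2, ℝ)) • y)) (mvfderiv model g y d) 0 :=
    fun hg y => hasDerivAt_comp_of_eq (one_smul_point diagMatrix_zero y) (md hg y)
      (hasMFDerivAt_oneParameter contDiff_diagMatrix diagMatrix_add (hasDerivAt_diag 0) y 0)
  have hG1 : ∀ p, HasFDerivAt G (fderiv ℝ G p) p := fun p =>
    (hGs.differentiable (by simp) p).hasFDerivAt
  have hdG : ContDiff ℝ ∞ (fderiv ℝ G) := hGs.fderiv_right (by simp)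
  have hG2 : ∀ p, HasFDerivAt (fderiv ℝ G) (fderiv ℝ (fderiv ℝ G) p) p := fun p =>
    (hdG.differentiable (by simp) p).hasFDerivAt
  -- first derivatives along the two-parameter family
  have e1 : ∀ t, mvfderiv model f ((diagMatrix t : PSL(2, ℝ)) • x) v = fderiv ℝ G (0, t) (1, 0) := by
    intro t
    refine (hN hf _).unique ?_
    have : HasDerivAt (fun s : ℝ => ((s, t) : ℝ × ℝ)) (1, 0) 0 :=
      (hasDerivAt_id (0 : ℝ)).prodMk (hasDerivAt_const _ _)
    have := (hG1 (0, t)).comp_hasDerivAt (0 : ℝ) this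
    simpa only [hG, Function.comp_def, mk_mul_smul] using this
  -- Here the diagonal flow acts after `N s`. The conjugation rule turns `t ↦ diagMatrix t * N s`
  -- into the plane curve `(exp (μ t) s, t)`, whose initial velocity is `(μ s, 1)`; the entry `μ s`
  -- is the origin of the commutator term.
  have e2 : ∀ s, mvfderiv model f ((N s : PSL(2, ℝ)) • x) d =
      fderiv ℝ G (s, 0) (μ * s, 1) := by
    intro s
    refine (hD hf _).unique ?_
    have h1 : HasDerivAt (fun t : ℝ => Real.exp (μ * t) * s) (μ * s) 0 := by
      simpa using (((hasDerivAt_id (0 : ℝ)).const_mul μ).exp).mul_const s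
    have h2 : HasDerivAt (fun t : ℝ => ((Real.exp (μ * t) * s, t) : ℝ × ℝ)) (μ * s, 1) 0 :=
      h1.prodMk (hasDerivAt_id _)
    have h3 : HasFDerivAt G (fderiv ℝ G (s, 0)) (Real.exp (μ * 0) * s, 0) := by
      simpa using hG1 (s, 0)
    have := HasFDerivAt.comp_hasDerivAt
      (f := fun t : ℝ => ((Real.exp (μ * t) * s, t) : ℝ × ℝ)) (0 : ℝ) h3 h2
    have he : (fun t => f ((diagMatrix t : PSL(2, ℝ)) • (N s : PSL(2, ℝ)) • x)) =
        fun t => G (Real.exp (μ * t) * s, t) := by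
      funext t
      simp only [hG, ← mk_mul_smul, h.conj]
    rw [he]
    exact this
  have e3 : mvfderiv model (fun y => mvfderiv model f y v) x d =
      fderiv ℝ (fderiv ℝ G) (0, 0) (0, 1) (1, 0) := by
    refine (hD (contMDiff_mvfderiv hf v) x).unique ?_
    simp only [e1]
    have : HasDerivAt (fun t : ℝ => ((0, t) : ℝ × ℝ)) (0, 1) 0 :=
      (hasDerivAt_const _ _).prodMk (hasDerivAt_id (0 : ℝ))
    have := ((hG2 (0, 0)).comp_hasDerivAt (0 : ℝ) this).clm_apply
      (hasDerivAt_const (0 : ℝ) ((1, 0) : ℝ × ℝ))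
    simpa using this
  have e4 : mvfderiv model (fun y => mvfderiv model f y d) x v =
      fderiv ℝ (fderiv ℝ G) (0, 0) (1, 0) (0, 1) + fderiv ℝ G (0, 0) (μ, 0) := by
    refine (hN (contMDiff_mvfderiv hf d) x).unique ?_
    simp only [e2]
    have h1 : HasDerivAt (fun s : ℝ => ((s, 0) : ℝ × ℝ)) (1, 0) 0 :=
      (hasDerivAt_id (0 : ℝ)).prodMk (hasDerivAt_const _ _)
    have h2 : HasDerivAt (fun s : ℝ => ((μ * s, 1) : ℝ × ℝ)) (μ, 0) 0 :=
      (by simpa using (hasDerivAt_id (0 : ℝ)).const_mul μ : HasDerivAt (fun s => μ * s) μ 0).prodMk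
        (hasDerivAt_const _ _)
    have := (HasFDerivAt.comp_hasDerivAt (f := fun s : ℝ => ((s, 0) : ℝ × ℝ)) (0 : ℝ)
      (hG2 (0, 0)) h1).clm_apply h2
    simpa using this
  have hsymm : IsSymmSndFDerivAt ℝ G (0, 0) :=
    hGs.contDiffAt.isSymmSndFDerivAt (by
      rw [minSmoothness_of_isRCLikeNormedField]
      exact WithTop.coe_le_coe.2 (le_top : (2 : ℕ∞) ≤ ⊤))
  have e5 := e1 0
  rw [one_smul_point diagMatrix_zero] at e5
  have e6 : fderiv ℝ G (0, 0) (μ, 0) = μ * fderiv ℝ G (0, 0) (1, 0) := by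
    rw [← smul_eq_mul, ← map_smul]; simp
  -- The mixed derivatives agree by symmetry, and the derivative of `μ s` leaves `μ` times the first
  -- derivative along `v`.
  rw [e3, e4, e5, e6, hsymm.eq (0, 1) (1, 0)]
  ring

/-! ### The Hamiltonian structures -/

section Hamiltonian

variable (c : ℝˣ)

/-- Fields that generate left translations have brackets opposite to those of their matrices: `[a₀,
a₋] = -a₋`, but `[e₀, e₋] = e₋`. Hence `μ = 1` here and `μ = -1` for `h₋`. -/
theorem isPoissonTensor_hPlus (r : ℝ) :
    IsPoissonTensor model (r • hPlus c : TensorField model (M Γ)) := by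
  refine isPoissonTensor_smul_wedge (μ := 1) r (fun f hf => ?_) (fun f hf => ?_) fun f hf x => ?_
  · simp only [e0_eq]; exact contMDiff_mvfderiv hf _
  · simp only [eMinus_eq]; exact contMDiff_mvfderiv hf _
  · simp only [e0_eq, eMinus_eq]
    have := (isHorocyclic_lower (2 * c)).commutator (hasDerivAt_lower (2 * c) 0) hf x
    rwa [neg_neg] at this

theorem isPoissonTensor_hMinus (r : ℝ) :
    IsPoissonTensor model (r • hMinus c : TensorField model (M Γ)) := by
  refine isPoissonTensor_smul_wedge (μ := -1) r (fun f hf => ?_) (fun f hf => ?_) fun f hf x => ?_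
  · simp only [e0_eq]; exact contMDiff_mvfderiv hf _
  · simp only [ePlus_eq]; exact contMDiff_mvfderiv hf _
  · simp only [e0_eq, ePlus_eq]
    exact (isHorocyclic_upper c).commutator (hasDerivAt_upper c 0) hf x

theorem omega_e0 (x : M Γ) :
    omega0 c x (e0 x) = 1 ∧ omegaPlus c x (e0 x) = 0 ∧ omegaMinus c x (e0 x) = 0 := by
  rw [e0_eq]
  exact ⟨omega0_apply c x _, (omegaPlus_apply c x _).trans (by simp),
    (omegaMinus_apply c x _).trans (by simp)⟩

theorem omega_ePlus (x : M Γ) : omega0 c x (ePlus c x) = 0 ∧ omegaPlus c x (ePlus c x) = 1 ∧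
    omegaMinus c x (ePlus c x) = 0 := by
  rw [ePlus_eq]
  exact ⟨omega0_apply c x _, (omegaPlus_apply c x _).trans (by simp),
    (omegaMinus_apply c x _).trans (by simp)⟩

theorem omega_eMinus (x : M Γ) : omega0 c x (eMinus c x) = 0 ∧ omegaPlus c x (eMinus c x) = 0 ∧
    omegaMinus c x (eMinus c x) = 1 := by
  rw [eMinus_eq]
  have := c.ne_zero
  exact ⟨omega0_apply c x _, (omegaPlus_apply c x _).trans (by simp),
    (omegaMinus_apply c x _).trans (by simp; field_simp)⟩

/-- The covectors annihilated by the tensor are the multiples of `ω₊`: pairing `α` with `ω₋` and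
with `ω₀` isolates `α(e₀)` and `α(e₋)`, so both must vanish. -/
theorem casimirDistribution_hPlus {r : ℝ} (hr : r ≠ 0) (x : M Γ) :
    casimirDistribution (r • hPlus c : TensorField model (M Γ)) x = kernel (omegaPlus c) x := by
  obtain ⟨a0, a1, a2⟩ := omega_e0 c x
  obtain ⟨m0, m1, m2⟩ := omega_eMinus c x
  have key : ∀ α β : Cotangent model x, (r • hPlus c : TensorField model (M Γ)) x α β =
      r * (α (e0 x) * β (eMinus c x) - α (eMinus c x) * β (e0 x)) := fun α β => rfl
  apply le_antisymm
  · intro v hv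
    refine hv (omegaPlus c x) (LinearMap.ext fun β => ?_)
    rw [key, a1, m1]
    simp
  · intro v hv α hα
    have h1 := congrArg (fun L => L (omegaMinus c x)) hα
    have h2 := congrArg (fun L => L (omega0 c x)) hα
    simp only [key, a0, a2, m0, m2, LinearMap.zero_apply] at h1 h2
    have h3 : α (e0 x) = 0 := by simpa [hr] using h1
    have h4 : α (eMinus c x) = 0 := by simpa [hr] using h2
    rw [kernel_omegaPlus_eq_span, Submodule.mem_span_pair] at hv
    obtain ⟨p, q, rfl⟩ := hv
    rw [map_add, map_smul, map_smul, h3, h4]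
    simp

theorem casimirDistribution_hMinus {r : ℝ} (hr : r ≠ 0) (x : M Γ) :
    casimirDistribution (r • hMinus c : TensorField model (M Γ)) x = kernel (omegaMinus c) x := by
  obtain ⟨a0, a1, a2⟩ := omega_e0 c x
  obtain ⟨m0, m1, m2⟩ := omega_ePlus c x
  have key : ∀ α β : Cotangent model x, (r • hMinus c : TensorField model (M Γ)) x α β =
      r * (α (e0 x) * β (ePlus c x) - α (ePlus c x) * β (e0 x)) := fun α β => rfl
  apply le_antisymm
  · intro v hv
    refine hv (omegaMinus c x) (LinearMap.ext fun β => ?_)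
    rw [key, a2, m2]
    simp
  · intro v hv α hα
    have h1 := congrArg (fun L => L (omegaPlus c x)) hα
    have h2 := congrArg (fun L => L (omega0 c x)) hα
    simp only [key, a0, a1, m0, m1, LinearMap.zero_apply] at h1 h2
    have h3 : α (e0 x) = 0 := by simpa [hr] using h1
    have h4 : α (ePlus c x) = 0 := by simpa [hr] using h2
    rw [kernel_omegaMinus_eq_span, Submodule.mem_span_pair] at hv
    obtain ⟨p, q, rfl⟩ := hv
    rw [map_add, map_smul, map_smul, h3, h4]
    simp

theorem hPlus_ne_hMinus (x : M Γ) : hPlus c x ≠ hMinus c x := by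
  intro h
  obtain ⟨a0, a1, a2⟩ := omega_e0 c x
  obtain ⟨m0, m1, m2⟩ := omega_eMinus c x
  obtain ⟨p0, p1, p2⟩ := omega_ePlus c x
  have := congrArg (fun L => L (omega0 c x) (omegaMinus c x)) h
  change omega0 c x (e0 x) * omegaMinus c x (eMinus c x) -
      omega0 c x (eMinus c x) * omegaMinus c x (e0 x) =
    omega0 c x (e0 x) * omegaMinus c x (ePlus c x) -
      omega0 c x (ePlus c x) * omegaMinus c x (e0 x) at this
  rw [a0, a2, m2, m0, p2, p0] at this
  norm_num at this

/-- Constant reparametrizations of a one-parameter group. -/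
theorem IsHorocyclic.hasMFDerivAt_scaled {N : ℝ → SL(2, ℝ)} {μ : ℝ} (h : IsHorocyclic N μ)
    {v : ℝ × ℝ × ℝ} (hv : HasDerivAt (fun q => cellCoordsSL (N q)) v 0) (r : ℝ) (x : M Γ) (t : ℝ) :
    HasMFDerivAt 𝓘(ℝ, ℝ) model (fun q => (N (r * q) : PSL(2, ℝ)) • x) t
      (ContinuousLinearMap.toSpanSingleton ℝ (r • v)) := by
  refine hasMFDerivAt_oneParameter (A := fun q => N (r * q)) (fun i j => ?_) (fun s t => ?_) ?_ x t
  · exact (h.smooth i j).comp (contDiff_const.mul contDiff_id)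
  · simp only [mul_add, h.add]
  · have h1 : HasDerivAt (fun q : ℝ => r * q) r 0 := by
      simpa using (hasDerivAt_id (0 : ℝ)).const_mul r
    have h2 : HasDerivAt (fun q => cellCoordsSL (N q)) v (r * 0) := by simpa using hv
    exact h2.scomp (0 : ℝ) h1

theorem isSmoothField_smul_eMinus (r : ℝ) :
    IsSmoothField model (fun x : M Γ => r • eMinus c x) := by
  have : (fun x : M Γ => r • eMinus c x) =
      fun _ => (r • (1 / (2 * (c : ℝ)), 0, 0) : ℝ × ℝ × ℝ) := funext fun x => by
    rw [eMinus_eq]; rfl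
  rw [this]
  exact isSmoothField_const _

theorem isSmoothField_smul_ePlus (r : ℝ) :
    IsSmoothField model (fun x : M Γ => r • ePlus c x) := by
  have : (fun x : M Γ => r • ePlus c x) =
      fun _ => (r • (0, 0, (c : ℝ)) : ℝ × ℝ × ℝ) := funext fun x => by
    rw [ePlus_eq]; rfl
  rw [this]
  exact isSmoothField_const _

theorem toSpanSingleton_eq_smulRight {E : Type*} [NormedAddCommGroup E] [NormedSpace ℝ E] (v : E) :
    ContinuousLinearMap.toSpanSingleton ℝ v = (1 : ℝ →L[ℝ] ℝ).smulRight v :=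
  ContinuousLinearMap.ext_ring (by simp)

theorem isMIntegralCurve_of_hasMFDerivAt {γ : ℝ → M Γ} {X : ∀ x : M Γ, TangentSpace model x}
    {v : ℝ × ℝ × ℝ} (hX : ∀ x, X x = v)
    (h : ∀ t, HasMFDerivAt 𝓘(ℝ, ℝ) model γ t (ContinuousLinearMap.toSpanSingleton ℝ v)) :
    IsMIntegralCurve γ X := by
  intro t
  rw [hX]
  exact (h t).congr_mfderiv (toSpanSingleton_eq_smulRight v)

theorem isMIntegralCurve_horocyclePlus (r : ℝ) (x : M Γ) :
    IsMIntegralCurve (I := model) (fun t => horocyclePlus c (-(r * t)) x)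
      (fun x => (-r) • eMinus c x) := by
  refine isMIntegralCurve_of_hasMFDerivAt
    (v := (-r) • ((1 / (2 * (c : ℝ)), 0, 0) : ℝ × ℝ × ℝ)) (fun x => by rw [eMinus_eq]; rfl)
    fun t => ?_
  have := (isHorocyclic_lower (2 * c)).hasMFDerivAt_scaled (hasDerivAt_lower _ 0) (-r) x t
  exact hasMFDerivAt_congr_curve (funext fun q => by simp only [horocyclePlus, neg_mul]) this

theorem isMIntegralCurve_horocycleMinus (r : ℝ) (x : M Γ) :
    IsMIntegralCurve (I := model) (fun t => horocycleMinus c (-(r * t)) x)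
      (fun x => (-r) • ePlus c x) := by
  refine isMIntegralCurve_of_hasMFDerivAt
    (v := (-r) • ((0, 0, (c : ℝ)) : ℝ × ℝ × ℝ)) (fun x => by rw [ePlus_eq]; rfl)
    fun t => ?_
  have := (isHorocyclic_upper c).hasMFDerivAt_scaled (hasDerivAt_upper _ 0) (-r) x t
  exact hasMFDerivAt_congr_curve (funext fun q => by simp only [horocycleMinus, neg_mul]) this

/-- In `h₊(β, ω₀)` only the term `-β(e₋) ω₀(e₀)` survives, so the Hamiltonian field is `-r e₋`; this
is the sign in the time parameter. The local potential is the diagonal coordinate. -/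
theorem isHamiltonianFlow_horocyclePlus {r : ℝ} (hr : r ≠ 0) :
    IsHamiltonianFlow model (r • hPlus c : TensorField model (M Γ)) (omega0 c)
      (fun t => horocyclePlus c (-(r * t))) := by
  refine ⟨isPoissonTensor_hPlus c r, isSmoothForm_omega0 c, fun x => ?_,
    fun x => (-r) • eMinus c x, isSmoothField_smul_eMinus c _,
    fun x β => ?_, fun x => ⟨?_, isMIntegralCurve_horocyclePlus c r x⟩⟩
  · refine ⟨_, isOpen_chartAt_preimage x isOpen_univ, mem_chartAt_preimage x (mem_univ _), _,
      contMDiffOn_comp_chartAt (Φ := fun w => w.2.1) (by fun_prop) x, fun y hy v hv => ?_⟩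
    rw [casimirDistribution_hPlus c hr] at hv
    exact (omega0_apply c y v).trans
      (mvfderiv_diagCoord hy.1 ((mem_kernel_omegaPlus c y v).1 hv)).symm
  · have h1 : (r • hPlus c : TensorField model (M Γ)) x β (omega0 c x) =
      r * (β (e0 x) * omega0 c x (eMinus c x) - β (eMinus c x) * omega0 c x (e0 x)) := rfl
    rw [h1, (omega_e0 c x).1, (omega_eMinus c x).1, map_smul, smul_eq_mul]
    ring
  · simp only [mul_zero, neg_zero]
    exact horocyclePlus_zero c x

/-- As for `h₊`, except that the diagonal coordinate is not a potential of `ω₀` on the leaves of `ω₋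
= 0`, because upper unipotent matrices change `g₀₀`; `oppositeHeight` replaces it. -/
theorem isHamiltonianFlow_horocycleMinus {r : ℝ} (hr : r ≠ 0) :
    IsHamiltonianFlow model (r • hMinus c : TensorField model (M Γ)) (omega0 c)
      (fun t => horocycleMinus c (-(r * t))) := by
  refine ⟨isPoissonTensor_hMinus c r, isSmoothForm_omega0 c, fun x => ?_,
    fun x => (-r) • ePlus c x, isSmoothField_smul_ePlus c _,
    fun x β => ?_, fun x => ⟨?_, isMIntegralCurve_horocycleMinus c r x⟩⟩
  · refine ⟨_, isOpen_chartAt_preimage x isOpen_oppositeCell,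
      mem_chartAt_preimage x zero_mem_oppositeCell, _,
      contMDiffOn_comp_chartAt contDiffOn_oppositeHeight x, fun y hy v hv => ?_⟩
    rw [casimirDistribution_hMinus c hr] at hv
    exact (omega0_apply c y v).trans
      (mvfderiv_oppositeHeight hy ((mem_kernel_omegaMinus c y v).1 hv)).symm
  · have h1 : (r • hMinus c : TensorField model (M Γ)) x β (omega0 c x) =
      r * (β (e0 x) * omega0 c x (ePlus c x) - β (ePlus c x) * omega0 c x (e0 x)) := rfl
    rw [h1, (omega_e0 c x).1, (omega_ePlus c x).1, map_smul, smul_eq_mul]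
    ring
  · simp only [mul_zero, neg_zero]
    exact horocycleMinus_zero c x

/-! ### Trajectories and the action of the geodesic flow -/

theorem hasMFDerivAt_geodesicFlow (x : M Γ) (t : ℝ) :
    HasMFDerivAt 𝓘(ℝ, ℝ) model (fun t => geodesicFlow t x) t
      (ContinuousLinearMap.toSpanSingleton ℝ ((0, 1, 0) : ℝ × ℝ × ℝ)) :=
  hasMFDerivAt_oneParameter contDiff_diagMatrix diagMatrix_add (hasDerivAt_diag 0) x t

theorem velocity_geodesicFlow (x : M Γ) (t : ℝ) :
    velocity model (fun t => geodesicFlow t x) t = e0 (geodesicFlow t x) :=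
  (velocity_eq (hasMFDerivAt_geodesicFlow x t)).trans (e0_eq _).symm

theorem velocity_horocyclePlus (x : M Γ) (t : ℝ) :
    velocity model (fun t => horocyclePlus c t x) t = eMinus c (horocyclePlus c t x) :=
  (velocity_eq (hasMFDerivAt_oneParameter (isHorocyclic_lower (2 * c)).smooth
    (isHorocyclic_lower (2 * c)).add (hasDerivAt_lower _ 0) x t)).trans (eMinus_eq c _).symm

theorem velocity_horocycleMinus (x : M Γ) (t : ℝ) :
    velocity model (fun t => horocycleMinus c t x) t = ePlus c (horocycleMinus c t x) :=
  (velocity_eq (hasMFDerivAt_oneParameter (isHorocyclic_upper c).smooth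
    (isHorocyclic_upper c).add (hasDerivAt_upper _ 0) x t)).trans (ePlus_eq c _).symm

/-- The conjugation rule says that the geodesic flow carries a horocycle trajectory to a horocycle
trajectory run at speed `exp (μ t)`. -/
theorem IsHorocyclic.mfderiv_geodesicFlow {N : ℝ → SL(2, ℝ)} {μ : ℝ} (h : IsHorocyclic N μ)
    {v : ℝ × ℝ × ℝ} (hv : HasDerivAt (fun q => cellCoordsSL (N q)) v 0) (x : M Γ) (t : ℝ) :
    (mfderiv model model (geodesicFlow t) x : ℝ × ℝ × ℝ →L[ℝ] ℝ × ℝ × ℝ) v =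
      Real.exp (μ * t) • v := by
  refine mfderiv_apply_of_curve (one_smul_point h.zero x)
    ((contMDiff_smul (diagMatrix t) x).mdifferentiableAt (by simp))
    (hasMFDerivAt_oneParameter h.smooth h.add hv x 0) ?_
  have := h.hasMFDerivAt_scaled hv (Real.exp (μ * t)) (geodesicFlow t x) 0
  refine hasMFDerivAt_congr_curve (funext fun q => ?_) this
  simp only [geodesicFlow, ← mk_mul_smul, h.conj]

theorem mfderiv_geodesicFlow_eMinus (x : M Γ) (t : ℝ) :
    mfderiv model model (geodesicFlow t) x (eMinus c x) =
      Real.exp (-t) • eMinus c (geodesicFlow t x) := by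
  rw [eMinus_eq, eMinus_eq]
  have := (isHorocyclic_lower (2 * c)).mfderiv_geodesicFlow (hasDerivAt_lower _ 0) x t
  rw [neg_one_mul] at this
  exact this

theorem mfderiv_geodesicFlow_ePlus (x : M Γ) (t : ℝ) :
    mfderiv model model (geodesicFlow t) x (ePlus c x) =
      Real.exp t • ePlus c (geodesicFlow t x) := by
  rw [ePlus_eq, ePlus_eq]
  have := (isHorocyclic_upper c).mfderiv_geodesicFlow (hasDerivAt_upper _ 0) x t
  rw [one_mul] at this
  exact this

end Hamiltonian

end Flows

/-! ### Periods, stabilizers and injectivity of the cylinder -/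

section Stabilizer

variable {Γ : Subgroup PSL(2, ℝ)}

theorem diagMatrix_neg (t : ℝ) : diagMatrix (-t) = (diagMatrix t)⁻¹ := by
  rw [eq_inv_iff_mul_eq_one, ← diagMatrix_add, neg_add_cancel, diagMatrix_zero]

theorem geodesicFlow_add (s t : ℝ) (x : M Γ) :
    geodesicFlow (s + t) x = geodesicFlow s (geodesicFlow t x) := by
  simp only [geodesicFlow, ← mk_mul_smul, diagMatrix_add]

theorem geodesicFlow_zero (x : M Γ) : geodesicFlow 0 x = x :=
  one_smul_point diagMatrix_zero x

/-- The group of periods of a trajectory of the geodesic flow. -/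
def periods (x : M Γ) : AddSubgroup ℝ where
  carrier := {t | geodesicFlow t x = x}
  zero_mem' := geodesicFlow_zero x
  add_mem' {s t} hs ht := by
    simp only [mem_ofPred_eq] at *
    rw [geodesicFlow_add, ht, hs]
  neg_mem' {t} ht := by
    simp only [mem_ofPred_eq] at *
    conv_lhs => rw [← ht]
    rw [← geodesicFlow_add, neg_add_cancel, geodesicFlow_zero]

theorem mem_periods {x : M Γ} {t : ℝ} : t ∈ periods x ↔ geodesicFlow t x = x := Iff.rfl

theorem mem_periods_iff {x : M Γ} {T : ℝ} (hT : 0 < T) (hx : geodesicFlow T x = x)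
    (hmin : ∀ s, 0 < s → s < T → geodesicFlow s x ≠ x) {t : ℝ} :
    t ∈ periods x ↔ ∃ k : ℤ, t = k * T := by
  have h : IsLeast {g | g ∈ periods x ∧ 0 < g} T :=
    ⟨⟨hx, hT⟩, fun s hs => not_lt.1 fun hlt => hmin s hs.2 hlt hs.1⟩
  rw [AddSubgroup.cyclic_of_min h, AddSubgroup.mem_closure_singleton]
  simp only [zsmul_eq_mul, eq_comm]

/-- The stabilizers of the points of `PSL(2, ℝ) / Γ` are discrete. -/
theorem eventually_smul_eq_self [DiscreteTopology Γ] (x : M Γ) :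
    ∀ᶠ q in 𝓝 (1 : PSL(2, ℝ)), q • x = x → q = 1 := by
  obtain ⟨g, rfl⟩ := QuotientGroup.mk_surjective x
  obtain ⟨U, hU, hUΓ⟩ := (discreteTopology_subtype_iff'.1 ‹DiscreteTopology Γ›) 1 Γ.one_mem
  have h1 : Continuous fun q : PSL(2, ℝ) => g⁻¹ * q * g :=
    (continuous_const.mul continuous_id).mul continuous_const
  have h2 : (1 : PSL(2, ℝ)) ∈ U := by
    have : (1 : PSL(2, ℝ)) ∈ U ∩ Γ := by rw [hUΓ]; rfl
    exact this.1
  have h3 : ∀ᶠ q in 𝓝 (1 : PSL(2, ℝ)), g⁻¹ * q * g ∈ U := by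
    refine h1.continuousAt.eventually_mem (hU.mem_nhds ?_)
    simpa using h2
  filter_upwards [h3] with q hq hqx
  have h4 : ((q * g : PSL(2, ℝ)) : M Γ) = (g : M Γ) := hqx
  have h5 : g⁻¹ * q * g ∈ Γ := by
    rw [mul_assoc]; exact QuotientGroup.eq.1 h4.symm
  have h6 : g⁻¹ * q * g ∈ U ∩ Γ := ⟨hq, h5⟩
  rw [hUΓ, mem_singleton_iff] at h6
  rw [← mul_inv_cancel g, ← inv_mul_eq_iff_eq_mul, ← mul_inv_eq_one, ← h6]
  group

/-- The parametrization `(u, s) ↦ N s • φ_u x` of the leaf through `x`. -/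
def cylinder (N : ℝ → SL(2, ℝ)) (x : M Γ) (p : ℝ × ℝ) : M Γ :=
  (N p.2 : PSL(2, ℝ)) • geodesicFlow p.1 x

namespace IsHorocyclic

variable {N : ℝ → SL(2, ℝ)} {μ : ℝ}

theorem smul_add (h : IsHorocyclic N μ) (s t : ℝ) (x : M Γ) :
    (N (s + t) : PSL(2, ℝ)) • x = (N s : PSL(2, ℝ)) • (N t : PSL(2, ℝ)) • x := by
  rw [h.add, mk_mul_smul]

theorem geodesicFlow_smul (h : IsHorocyclic N μ) (s t : ℝ) (x : M Γ) :
    geodesicFlow t ((N s : PSL(2, ℝ)) • x) =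
      (N (Real.exp (μ * t) * s) : PSL(2, ℝ)) • geodesicFlow t x := by
  simp only [geodesicFlow, ← mk_mul_smul, h.conj]

/-- The orbit of the group generated by `N` and the geodesic flow is stable under plaques. -/
theorem mem_range_cylinder_iff (h : IsHorocyclic N μ) (x y : M Γ) (s u : ℝ) :
    (N s : PSL(2, ℝ)) • geodesicFlow u y ∈ range (cylinder N x) ↔ y ∈ range (cylinder N x) := by
  constructor
  · rintro ⟨p, hp⟩
    refine ⟨(p.1 - u, Real.exp (μ * (-u)) * (p.2 - s)), ?_⟩
    have h1 : (N (p.2 - s) : PSL(2, ℝ)) • geodesicFlow p.1 x = geodesicFlow u y := by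
      rw [sub_eq_neg_add, h.smul_add]
      change (N (-s) : PSL(2, ℝ)) • cylinder N x p = _
      rw [hp, ← h.smul_add, neg_add_cancel, one_smul_point h.zero]
    have h2 := h.geodesicFlow_smul (p.2 - s) (-u) (geodesicFlow p.1 x)
    rw [h1, ← geodesicFlow_add, ← geodesicFlow_add, neg_add_cancel, geodesicFlow_zero,
      neg_add_eq_sub] at h2
    exact h2.symm
  · rintro ⟨p, rfl⟩
    refine ⟨(u + p.1, s + Real.exp (μ * u) * p.2), ?_⟩
    simp only [cylinder]
    rw [h.geodesicFlow_smul, ← h.smul_add, ← geodesicFlow_add]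

/-- By stability under plaques, membership in the orbit is a locally constant property along the
curve; the line is connected, so it is constant. -/
theorem mem_range_cylinder_of_curve (h : IsHorocyclic N μ) {x : M Γ} {γ : ℝ → M Γ}
    (hloc : ∀ t₀, ∀ᶠ t in 𝓝 t₀, ∃ s u : ℝ,
      γ t = (N s : PSL(2, ℝ)) • geodesicFlow u (γ t₀)) (h0 : γ 0 = x) (t : ℝ) :
    γ t ∈ range (cylinder N x) := by
  have hlc : IsLocallyConstant fun t => γ t ∈ range (cylinder N x) := by
    refine (IsLocallyConstant.iff_eventually_eq _).2 fun t₀ => ?_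
    filter_upwards [hloc t₀] with t ⟨s, u, ht⟩
    rw [ht]
    exact propext (h.mem_range_cylinder_iff x (γ t₀) s u)
  rw [hlc.apply_eq_of_preconnectedSpace t 0, h0]
  refine ⟨(0, 0), ?_⟩
  simp only [cylinder]
  rw [geodesicFlow_zero, one_smul_point h.zero]

variable [DiscreteTopology Γ]

/-- A point on a closed geodesic is not fixed by horocyclic elements. -/
theorem eq_zero_of_smul_eq (h : IsHorocyclic N μ) (hμ : μ ≠ 0)
    (hN : ∀ s, (N s : PSL(2, ℝ)) = 1 → s = 0) {x : M Γ} {T : ℝ} (hT : 0 < T)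
    (hx : geodesicFlow T x = x) {s : ℝ} (hs : (N s : PSL(2, ℝ)) • x = x) : s = 0 := by
  -- The direction of time is chosen so that the flow over one period contracts `N`. Since `φ_τ`
  -- fixes `x`, every contracted element `N (exp (μ τ) ^ k * s)` still fixes `x`.
  obtain ⟨τ, hτ, hμτ⟩ : ∃ τ ∈ periods x, μ * τ < 0 := by
    rcases lt_or_gt_of_ne hμ with hμ | hμ
    · exact ⟨T, hx, mul_neg_of_neg_of_pos hμ hT⟩
    · exact ⟨-T, neg_mem (mem_periods.2 hx), mul_neg_of_pos_of_neg hμ (neg_lt_zero.2 hT)⟩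
  have hfix : ∀ k : ℕ, (N (Real.exp (μ * τ) ^ k * s) : PSL(2, ℝ)) • x = x := by
    intro k
    induction k with
    | zero => simpa using hs
    | succ k ih =>
      have := h.geodesicFlow_smul (Real.exp (μ * τ) ^ k * s) τ x
      rw [ih, mem_periods.1 hτ, ← mul_assoc, ← pow_succ'] at this
      exact this.symm
  have hlim : Tendsto (fun k : ℕ => (N (Real.exp (μ * τ) ^ k * s) : PSL(2, ℝ))) atTop (𝓝 1) := by
    have h1 : Tendsto (fun k : ℕ => Real.exp (μ * τ) ^ k * s) atTop (𝓝 0) := by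
      simpa using (tendsto_pow_atTop_nhds_zero_of_lt_one (Real.exp_pos _).le
        (by rw [← Real.exp_zero]; exact Real.exp_lt_exp.2 hμτ)).mul_const s
    have h2 : Continuous fun s => (N s : PSL(2, ℝ)) :=
      QuotientGroup.continuous_mk.comp (continuous_SL fun i j => (h.smooth i j).continuous)
    have h3 : Tendsto (fun s => (N s : PSL(2, ℝ))) (𝓝 0) (𝓝 ((N 0 : SL(2, ℝ)) : PSL(2, ℝ))) :=
      h2.tendsto 0
    rw [h.zero] at h3
    exact h3.comp h1
  obtain ⟨k, hk⟩ := (hlim.eventually (eventually_smul_eq_self x)).exists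
  have := hN _ (hk (hfix k))
  exact (mul_eq_zero.1 this).resolve_left (pow_ne_zero _ (Real.exp_ne_zero _))

/-- Applying `φ_T` to `N s • φ_u x = x` replaces `s` by `exp (μ T) s` and changes nothing else.
Comparison of the two equations puts `N ((1 - exp (μ T)) s)` into the stabilizer of `x`. -/
theorem eq_zero_of_smul_geodesicFlow_eq (h : IsHorocyclic N μ) (hμ : μ ≠ 0)
    (hN : ∀ s, (N s : PSL(2, ℝ)) = 1 → s = 0) {x : M Γ} {T : ℝ} (hT : 0 < T)
    (hx : geodesicFlow T x = x) {s u : ℝ} (hs : (N s : PSL(2, ℝ)) • geodesicFlow u x = x) :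
    s = 0 ∧ geodesicFlow u x = x := by
  have h1 := h.geodesicFlow_smul s T (geodesicFlow u x)
  rw [hs, hx, ← geodesicFlow_add, add_comm, geodesicFlow_add, hx] at h1
  have h2 : (N (s - Real.exp (μ * T) * s) : PSL(2, ℝ)) • x = x := by
    conv_lhs => rw [h1]
    rw [← h.smul_add, sub_add_cancel, hs]
  have h3 := h.eq_zero_of_smul_eq hμ hN hT hx h2
  have h4 : (1 - Real.exp (μ * T)) * s = 0 := by rw [← h3]; ring
  have h5 : 1 - Real.exp (μ * T) ≠ 0 := by
    rw [sub_ne_zero, ne_comm, Ne, Real.exp_eq_one_iff]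
    exact mul_ne_zero hμ hT.ne'
  have h6 := (mul_eq_zero.1 h4).resolve_left h5
  subst h6
  rw [one_smul_point h.zero] at hs
  exact ⟨rfl, hs⟩

/-- Two points of the cylinder have the same image only if they coincide. -/
theorem smul_geodesicFlow_eq_iff (h : IsHorocyclic N μ) (hμ : μ ≠ 0)
    (hN : ∀ s, (N s : PSL(2, ℝ)) = 1 → s = 0) {x : M Γ} {T : ℝ} (hT : 0 < T)
    (hx : geodesicFlow T x = x) (hmin : ∀ s, 0 < s → s < T → geodesicFlow s x ≠ x) (p q : ℝ × ℝ) :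
    (N p.2 : PSL(2, ℝ)) • geodesicFlow p.1 x = (N q.2 : PSL(2, ℝ)) • geodesicFlow q.1 x ↔
      p.2 = q.2 ∧ ∃ k : ℤ, p.1 - q.1 = k * T := by
  rw [← mem_periods_iff hT hx hmin]
  constructor
  · intro he
    -- Both points are moved along the leaf until the second becomes `x`; the flow by `-q.1`
    -- rescales the horocycle parameter.
    have h1 : (N (Real.exp (μ * (-q.1)) * (p.2 - q.2)) : PSL(2, ℝ)) • geodesicFlow (p.1 - q.1) x
        = x := by
      have h2 : (N (p.2 - q.2) : PSL(2, ℝ)) • geodesicFlow p.1 x = geodesicFlow q.1 x := by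
        rw [sub_eq_neg_add, h.smul_add, he, ← h.smul_add, neg_add_cancel, one_smul_point h.zero]
      have h3 := h.geodesicFlow_smul (p.2 - q.2) (-q.1) (geodesicFlow p.1 x)
      rw [h2, ← geodesicFlow_add, ← geodesicFlow_add, neg_add_cancel, geodesicFlow_zero,
        neg_add_eq_sub] at h3
      exact h3.symm
    obtain ⟨h4, h5⟩ := h.eq_zero_of_smul_geodesicFlow_eq hμ hN hT hx h1
    exact ⟨sub_eq_zero.1 ((mul_eq_zero.1 h4).resolve_left (Real.exp_ne_zero _)), h5⟩
  · rintro ⟨h1, h2⟩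
    rw [h1]
    have : geodesicFlow p.1 x = geodesicFlow q.1 x := by
      conv_rhs => rw [← mem_periods.1 h2]
      rw [← geodesicFlow_add, add_sub_cancel]
    rw [this]

end IsHorocyclic

end Stabilizer

/-! ### The leaves that contain a closed geodesic -/

section Cylinder

variable {Γ : Subgroup PSL(2, ℝ)} [DiscreteTopology Γ]

/-- The curve `γ` stays locally in its plaque when it is tangent to the level sets of a function. -/
theorem eventually_const_along {f : M Γ → ℝ} {U : Set (M Γ)} (hU : IsOpen U)
    (hf : ContMDiffOn model 𝓘(ℝ) ∞ f U) {γ : ℝ → M Γ} (hγ : ContMDiff 𝓘(ℝ, ℝ) model 1 γ)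
    (hd : ∀ t, γ t ∈ U → mvfderiv model f (γ t) (velocity model γ t) = 0) {t₀ : ℝ}
    (h0 : γ t₀ ∈ U) : ∀ᶠ t in 𝓝 t₀, γ t ∈ U ∧ f (γ t) = f (γ t₀) := by
  have hev : ∀ᶠ t in 𝓝 t₀, γ t ∈ U := hγ.continuous.continuousAt.eventually_mem (hU.mem_nhds h0)
  obtain ⟨δ, hδ, hball⟩ := Metric.eventually_nhds_iff_ball.1 hev
  have hder : ∀ t ∈ Metric.ball t₀ δ, HasDerivAt (fun t => f (γ t)) 0 t := by
    intro t ht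
    have h1 : MDifferentiableAt model 𝓘(ℝ) f (γ t) :=
      ((hf _ (hball t ht)).contMDiffAt (hU.mem_nhds (hball t ht))).mdifferentiableAt (by simp)
    have h2 := (hγ t).mdifferentiableAt (by simp)
    have h3 : HasMFDerivAt 𝓘(ℝ, ℝ) model γ t
        (ContinuousLinearMap.toSpanSingleton ℝ (velocity model γ t : ℝ × ℝ × ℝ)) := by
      refine h2.hasMFDerivAt.congr_mfderiv ?_
      exact ContinuousLinearMap.ext_ring (one_smul ℝ (velocity model γ t : ℝ × ℝ × ℝ)).symm
    have h4 := hasDerivAt_comp_of_eq rfl h1 h3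
    have h5 := hd t (hball t ht)
    exact h5 ▸ h4
  filter_upwards [Metric.ball_mem_nhds t₀ hδ] with t ht
  refine ⟨hball t ht, ?_⟩
  exact Metric.isOpen_ball.is_const_of_deriv_eq_zero (convex_ball t₀ δ).isPreconnected
    (fun t ht => (hder t ht).differentiableAt.differentiableWithinAt)
    (fun t ht => (hder t ht).deriv) ht (Metric.mem_ball_self hδ)

theorem cellMatrix_lower (s u : ℝ) : cellMatrix (s, u, 0) = lowerMatrix s * diagMatrix u := by
  ext i j
  rw [Matrix.SpecialLinearGroup.coe_mul, Matrix.mul_apply, Fin.sum_univ_two]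
  fin_cases i <;> fin_cases j <;> simp [cellMatrix, lowerMatrix, diagMatrix]

theorem cellMatrix_upper (u t : ℝ) : cellMatrix (0, u, t) = diagMatrix u * upperMatrix t := by
  ext i j
  rw [Matrix.SpecialLinearGroup.coe_mul, Matrix.mul_apply, Fin.sum_univ_two]
  fin_cases i <;> fin_cases j <;> simp [cellMatrix, upperMatrix, diagMatrix]

/-- In the chart centred at `γ t₀` the first integral is zero at the centre and stays zero along the
curve. The last coordinate therefore vanishes, and the cell matrix is a lower unipotent matrix times
a diagonal one. -/
theorem eventually_mem_plaque_omegaPlus (c : ℝˣ) {γ : ℝ → M Γ} (hγ : ContMDiff 𝓘(ℝ, ℝ) model 1 γ)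
    (hd : ∀ t, velocity model γ t ∈ kernel (omegaPlus c) (γ t)) (t₀ : ℝ) :
    ∀ᶠ t in 𝓝 t₀, ∃ s u : ℝ,
      γ t = (lowerMatrix (s / (2 * c)) : PSL(2, ℝ)) • geodesicFlow u (γ t₀) := by
  have := eventually_const_along (isOpen_chartAt_preimage (γ t₀) isOpen_univ)
    (contMDiffOn_comp_chartAt (Φ := fun w => w.2.2) (by fun_prop) (γ t₀)) hγ
    (fun t ht => (mvfderiv_upperCoord ht.1 _).trans (by
      rw [(mem_kernel_omegaPlus c _ _).1 (hd t), mul_zero]))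
    (mem_chartAt_preimage (γ t₀) (mem_univ _))
  filter_upwards [this] with t ⟨ht, hft⟩
  rw [chartAt_self] at hft
  set w := chartAt (ℝ × ℝ × ℝ) (γ t₀) (γ t) with hw
  have h1 : γ t = (cellMatrix w : PSL(2, ℝ)) • γ t₀ := by
    rw [← chartAt_symm_apply, hw, (chartAt (ℝ × ℝ × ℝ) (γ t₀)).left_inv ht.1]
  refine ⟨2 * c * w.1, w.2.1, ?_⟩
  have hc := c.ne_zero
  have h2 : w = (w.1, w.2.1, 0) := Prod.ext rfl (Prod.ext rfl hft)
  rw [h1, mul_div_cancel_left₀ _ (mul_ne_zero two_ne_zero hc)]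
  conv_lhs => rw [h2]
  rw [cellMatrix_lower, mk_mul_smul]
  rfl

theorem eventually_mem_plaque_omegaMinus (c : ℝˣ) {γ : ℝ → M Γ} (hγ : ContMDiff 𝓘(ℝ, ℝ) model 1 γ)
    (hd : ∀ t, velocity model γ t ∈ kernel (omegaMinus c) (γ t)) (t₀ : ℝ) :
    ∀ᶠ t in 𝓝 t₀, ∃ s u : ℝ,
      γ t = (upperMatrix (c * s) : PSL(2, ℝ)) • geodesicFlow u (γ t₀) := by
  have := eventually_const_along (isOpen_chartAt_preimage (γ t₀) isOpen_oppositeCell)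
    (contMDiffOn_comp_chartAt contDiffOn_oppositeSlope (γ t₀)) hγ
    (fun t ht => by
      obtain ⟨r, -, hr⟩ := mvfderiv_oppositeSlope ht
      exact (hr _).trans (by rw [(mem_kernel_omegaMinus c _ _).1 (hd t), mul_zero]))
    (mem_chartAt_preimage (γ t₀) zero_mem_oppositeCell)
  filter_upwards [this] with t ⟨ht, hft⟩
  rw [chartAt_self] at hft
  set w := chartAt (ℝ × ℝ × ℝ) (γ t₀) (γ t) with hw
  have h1 : γ t = (cellMatrix w : PSL(2, ℝ)) • γ t₀ := by
    rw [← chartAt_symm_apply, hw, (chartAt (ℝ × ℝ × ℝ) (γ t₀)).left_inv ht.1]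
  have h0 : w.1 * Real.exp w.2.1 * w.2.2 + 1 ≠ 0 := ne_of_gt ht.2
  have h3 : w.1 = 0 := by
    simpa [oppositeSlope, h0] using hft
  have hc := c.ne_zero
  -- With first coordinate zero the cell matrix is diagonal times upper unipotent. Moving the
  -- unipotent factor to the left multiplies its parameter by `exp u`; the `1` is the exponent of
  -- the upper group.
  refine ⟨Real.exp (1 * w.2.1) * (w.2.2 / c), w.2.1, ?_⟩
  have h2 : w = (0, w.2.1, w.2.2) := Prod.ext h3 rfl
  have h4 : upperMatrix (c * (w.2.2 / c)) = upperMatrix w.2.2 := by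
    rw [mul_div_cancel₀ _ hc]
  rw [h1, ← (isHorocyclic_upper c).geodesicFlow_smul, h4]
  conv_lhs => rw [h2]
  rw [cellMatrix_upper, mk_mul_smul]
  rfl

/-- The map is smooth, so its derivative is determined by the two coordinate axes, on which one of
the factors is the identity. -/
theorem hasFDerivAt_mul_diag {N : ℝ → SL(2, ℝ)} {μ : ℝ} (h : IsHorocyclic N μ) {v : ℝ × ℝ × ℝ}
    (hv : HasDerivAt (fun q => cellCoordsSL (N q)) v 0) :
    HasFDerivAt (fun p : ℝ × ℝ => cellCoordsSL (N p.1 * diagMatrix p.2))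
      ((ContinuousLinearMap.fst ℝ ℝ ℝ).smulRight v +
        (ContinuousLinearMap.snd ℝ ℝ ℝ).smulRight ((0, 1, 0) : ℝ × ℝ × ℝ)) 0 := by
  have hs : ContDiffAt ℝ ∞ (fun p : ℝ × ℝ => cellCoordsSL (N p.1 * diagMatrix p.2)) 0 := by
    refine contDiffAt_cellCoordsSL (contDiffAt_entry_mul
      (fun i j => ((h.smooth i j).comp contDiff_fst).contDiffAt)
      (fun i j => ((contDiff_diagMatrix i j).comp contDiff_snd).contDiffAt)) ?_
    simp [h.zero, diagMatrix_zero]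
  have hd := (hs.differentiableAt (by simp)).hasFDerivAt
  refine hd.congr_fderiv ?_
  have h1 : HasDerivAt (fun s : ℝ => ((s, 0) : ℝ × ℝ)) (1, 0) 0 :=
    (hasDerivAt_id (0 : ℝ)).prodMk (hasDerivAt_const _ _)
  have h2 : HasDerivAt (fun s : ℝ => ((0, s) : ℝ × ℝ)) (0, 1) 0 :=
    (hasDerivAt_const _ _).prodMk (hasDerivAt_id (0 : ℝ))
  have e1 := (HasFDerivAt.comp_hasDerivAt (f := fun s : ℝ => ((s, 0) : ℝ × ℝ)) (0 : ℝ)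
    hd h1).unique (by simpa [Function.comp_def, diagMatrix_zero] using hv)
  have e2 := (HasFDerivAt.comp_hasDerivAt (f := fun s : ℝ => ((0, s) : ℝ × ℝ)) (0 : ℝ)
    hd h2).unique (by simpa [Function.comp_def, h.zero] using hasDerivAt_diag 0)
  refine ContinuousLinearMap.prod_ext (ContinuousLinearMap.ext_ring ?_)
    (ContinuousLinearMap.ext_ring ?_)
  · simpa using e1
  · simpa using e2

namespace IsHorocyclic

variable {N : ℝ → SL(2, ℝ)} {μ : ℝ}

theorem contMDiff_cylinder (h : IsHorocyclic N μ) (x : M Γ) :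
    ContMDiff 𝓘(ℝ, ℝ × ℝ) model ∞ (cylinder N x) := by
  have he : cylinder N x = fun p =>
      ((N p.2 * diagMatrix p.1 : SL(2, ℝ)) : PSL(2, ℝ)) • x := funext fun p => by
    rw [mk_mul_smul]; rfl
  rw [he]
  exact contMDiff_orbit (A := fun p : ℝ × ℝ => N p.2 * diagMatrix p.1) (fun i j =>
    contDiff_iff_contDiffAt.2 fun p => contDiffAt_entry_mul
      (fun i j => ((h.smooth i j).comp contDiff_snd).contDiffAt)
      (fun i j => ((contDiff_diagMatrix i j).comp contDiff_fst).contDiffAt) i j) x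

/-- The cylinder is rewritten as an orbit map through its own point at `p`. Advancing the flow from
there stretches the height `p.2` by `exp (μ (q.1 - p.1))`, which must be subtracted again; this
gives the term `-μ * a.1 * p.2`. -/
theorem mfderiv_cylinder (h : IsHorocyclic N μ) {v : ℝ × ℝ × ℝ}
    (hv : HasDerivAt (fun q => cellCoordsSL (N q)) v 0)
    (x : M Γ) (p a : ℝ × ℝ) :
    (mfderiv 𝓘(ℝ, ℝ × ℝ) model (cylinder N x) p : ℝ × ℝ →L[ℝ] ℝ × ℝ × ℝ) a =
      (a.2 - μ * a.1 * p.2) • v + a.1 • ((0, 1, 0) : ℝ × ℝ × ℝ) := by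
  set B : ℝ × ℝ → SL(2, ℝ) := fun q =>
    N (q.2 - Real.exp (μ * (q.1 - p.1)) * p.2) * diagMatrix (q.1 - p.1) with hB
  have he : (fun q => (B q : PSL(2, ℝ)) • cylinder N x p) = cylinder N x := by
    funext q
    rw [hB, mk_mul_smul]
    change (N (q.2 - Real.exp (μ * (q.1 - p.1)) * p.2) : PSL(2, ℝ)) •
      geodesicFlow (q.1 - p.1) ((N p.2 : PSL(2, ℝ)) • geodesicFlow p.1 x) = _
    rw [h.geodesicFlow_smul, ← h.smul_add, sub_add_cancel, ← geodesicFlow_add, sub_add_cancel]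
    rfl
  have hBp : B p = 1 := by simp [hB, h.zero, diagMatrix_zero]
  have hBc : Continuous B := by
    have h1 : Continuous N := continuous_SL fun i j => (h.smooth i j).continuous
    have h2 : Continuous diagMatrix := continuous_SL fun i j => (contDiff_diagMatrix i j).continuous
    exact (h1.comp (by fun_prop)).mul (h2.comp (by fun_prop))
  let ℓ : ℝ × ℝ →L[ℝ] ℝ × ℝ :=
    (ContinuousLinearMap.snd ℝ ℝ ℝ - (μ * p.2) • ContinuousLinearMap.fst ℝ ℝ ℝ).prod
      (ContinuousLinearMap.fst ℝ ℝ ℝ)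
  have hℓ : HasFDerivAt (fun q : ℝ × ℝ =>
      ((q.2 - Real.exp (μ * (q.1 - p.1)) * p.2, q.1 - p.1) : ℝ × ℝ)) ℓ p := by
    have h1 : HasFDerivAt (fun v : ℝ × ℝ => v.1) _ p := hasFDerivAt_fst (𝕜 := ℝ)
    have h2 : HasFDerivAt (fun v : ℝ × ℝ => v.2) _ p := hasFDerivAt_snd (𝕜 := ℝ)
    have h3 := (h2.fun_sub ((((h1.sub_const p.1).const_mul μ).exp).mul_const p.2)).prodMk
      (h1.sub_const p.1)
    refine h3.congr_fderiv ?_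
    ext <;> simp [ℓ]
    ring
  have h0 := hasFDerivAt_mul_diag h hv
  have hq : ((p.2 - Real.exp (μ * (p.1 - p.1)) * p.2, p.1 - p.1) : ℝ × ℝ) = 0 := by
    simp
  rw [← hq] at h0
  have hm := hasMFDerivAt_orbit hBc.continuousAt hBp (HasFDerivAt.comp (f := fun q : ℝ × ℝ =>
      ((q.2 - Real.exp (μ * (q.1 - p.1)) * p.2, q.1 - p.1) : ℝ × ℝ)) p h0 hℓ) (cylinder N x p)
  have key : (((ContinuousLinearMap.fst ℝ ℝ ℝ).smulRight v +
      (ContinuousLinearMap.snd ℝ ℝ ℝ).smulRight ((0, 1, 0) : ℝ × ℝ × ℝ)).comp ℓ) a =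
      (a.2 - μ * a.1 * p.2) • v + a.1 • ((0, 1, 0) : ℝ × ℝ × ℝ) := by
    simp only [ℓ, ContinuousLinearMap.comp_apply, _root_.add_apply,
      ContinuousLinearMap.smulRight_apply, ContinuousLinearMap.prod_apply, _root_.sub_apply,
      _root_.smul_apply, ContinuousLinearMap.coe_fst', ContinuousLinearMap.coe_snd', smul_eq_mul]
    rw [mul_right_comm]
  have hm' : (mfderiv 𝓘(ℝ, ℝ × ℝ) model (fun q => (B q : PSL(2, ℝ)) • cylinder N x p) p :
      ℝ × ℝ →L[ℝ] ℝ × ℝ × ℝ) a = (a.2 - μ * a.1 * p.2) • v + a.1 • ((0, 1, 0) : ℝ × ℝ × ℝ) := by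
    rw [hm.mfderiv]
    exact key
  rw [he] at hm'
  exact hm'

/-- Both foliations are treated at once: `hli` makes the cylinder an immersion, `hD` makes it
tangent to `D`, and `hloc` confines tangent curves to plaques, so that the leaf is not larger than
the cylinder. -/
theorem isCoreOfCylindricalLeaf (h : IsHorocyclic N μ) (hμ : μ ≠ 0)
    (hN : ∀ s, (N s : PSL(2, ℝ)) = 1 → s = 0) {v : ℝ × ℝ × ℝ}
    (hv : HasDerivAt (fun q => cellCoordsSL (N q)) v 0)
    (hli : ∀ a b : ℝ, a • v + b • ((0, 1, 0) : ℝ × ℝ × ℝ) = 0 → a = 0 ∧ b = 0)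
    {D : ∀ x : M Γ, Submodule ℝ (TangentSpace model x)}
    (hD : ∀ (x : M Γ) (a b : ℝ), (a • v + b • ((0, 1, 0) : ℝ × ℝ × ℝ) : ℝ × ℝ × ℝ) ∈ D x)
    (hloc : ∀ γ : ℝ → M Γ, ContMDiff 𝓘(ℝ, ℝ) model 1 γ →
      (∀ t, velocity model γ t ∈ D (γ t)) → ∀ t₀, ∀ᶠ t in 𝓝 t₀, ∃ s u : ℝ,
        γ t = (N s : PSL(2, ℝ)) • geodesicFlow u (γ t₀))
    {x : M Γ} {T : ℝ} (hT : 0 < T) (hx : geodesicFlow T x = x)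
    (hmin : ∀ s, 0 < s → s < T → geodesicFlow s x ≠ x) :
    IsCoreOfCylindricalLeaf model D (fun t => geodesicFlow t x) T := by
  have hmem : ∀ p a, mfderiv 𝓘(ℝ, ℝ × ℝ) model (cylinder N x) p a ∈ D (cylinder N x p) :=
    fun p a => by
      have h1 := hD (cylinder N x p) (a.2 - μ * a.1 * p.2) a.1
      rw [← h.mfderiv_cylinder hv x p a] at h1
      exact h1
  refine ⟨cylinder N x, h.contMDiff_cylinder x, fun p => ?_, hmem,
    fun p q => h.smul_geodesicFlow_eq_iff hμ hN hT hx hmin p q, ?_, fun u => ?_⟩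
  · have hinj : Function.Injective (mfderiv 𝓘(ℝ, ℝ × ℝ) model (cylinder N x) p :
        ℝ × ℝ →L[ℝ] ℝ × ℝ × ℝ) := by
      refine (injective_iff_map_eq_zero _).2 fun a ha => ?_
      obtain ⟨h1, h2⟩ := hli _ _ ((h.mfderiv_cylinder hv x p a).symm.trans ha)
      rw [h2] at h1
      have h3 : a.2 = (0 : ℝ) := by simpa using h1
      exact Prod.ext h2 h3
    exact hinj
  · apply Subset.antisymm
    · rintro _ ⟨p, rfl⟩
      -- The segment from the origin to `p` in the parameter plane is mapped to a tangent curve from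
      -- `x` to the given point.
      have hl : ContDiff ℝ ∞ fun t : ℝ => t • p := contDiff_id.smul contDiff_const
      refine ⟨fun t => cylinder N x (t • p), ((h.contMDiff_cylinder x).comp hl.contMDiff).of_le
        (by exact_mod_cast (le_top : (1 : ℕ∞) ≤ ⊤)), ?_, by simp, fun t => ?_⟩
      · simp only [zero_smul, cylinder, Prod.fst_zero, Prod.snd_zero]
        rw [one_smul_point h.zero]
      · have h1 : HasMFDerivAt 𝓘(ℝ, ℝ) 𝓘(ℝ, ℝ × ℝ) (fun t : ℝ => t • p) t
            (ContinuousLinearMap.toSpanSingleton ℝ p) := by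
          have : HasDerivAt (fun t : ℝ => t • p) ((1 : ℝ) • p) t :=
            (hasDerivAt_id t).smul_const p
          rw [one_smul] at this
          exact this.hasFDerivAt.hasMFDerivAt
        have h2 := ((h.contMDiff_cylinder x (t • p)).mdifferentiableAt
          (by simp)).hasMFDerivAt.comp t h1
        have h3 : velocity model (fun t => cylinder N x (t • p)) t =
            mfderiv 𝓘(ℝ, ℝ × ℝ) model (cylinder N x) (t • p) p := by
          rw [velocity]
          have h4 := h2.mfderiv
          refine (congrArg (fun L : ℝ →L[ℝ] ℝ × ℝ × ℝ => L 1) h4).trans ?_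
          exact comp_toSpanSingleton_one (E := ℝ × ℝ) (E' := ℝ × ℝ × ℝ) _ p
        rw [h3]
        exact hmem _ _
    · rintro y ⟨γ, hγ, h0, rfl, hd⟩
      exact h.mem_range_cylinder_of_curve (hloc γ hγ hd) (h0.trans (geodesicFlow_zero x)) 1
  · simp only [cylinder]
    rw [one_smul_point h.zero]

end IsHorocyclic

theorem cellCoordsSL_one : cellCoordsSL 1 = 0 := by
  simp [cellCoordsSL]

theorem cellCoordsSL_eq_zero {A : SL(2, ℝ)} (h : (A : PSL(2, ℝ)) = 1) : cellCoordsSL A = 0 := by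
  rw [← cellCoords_mk, h]
  exact cellCoordsSL_one

theorem isCore_omegaPlus (c : ℝˣ) {x : M Γ} {T : ℝ} (hT : 0 < T) (hx : geodesicFlow T x = x)
    (hmin : ∀ s, 0 < s → s < T → geodesicFlow s x ≠ x) :
    IsCoreOfCylindricalLeaf model (kernel (omegaPlus c)) (fun t => geodesicFlow t x) T := by
  have hc := c.ne_zero
  refine (isHorocyclic_lower (2 * c)).isCoreOfCylindricalLeaf (by norm_num) (fun s hs => ?_)
    (hasDerivAt_lower _ 0) (fun a b hab => ?_) (fun x a b => ?_)
    (fun γ hγ hd => eventually_mem_plaque_omegaPlus c hγ hd) hT hx hmin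
  · have := cellCoordsSL_eq_zero hs
    rw [cellCoordsSL_lowerMatrix] at this
    simpa [hc] using this
  · simpa [hc] using hab
  · exact (mem_kernel_omegaPlus c x _).2 (by simp)

theorem isCore_omegaMinus (c : ℝˣ) {x : M Γ} {T : ℝ} (hT : 0 < T) (hx : geodesicFlow T x = x)
    (hmin : ∀ s, 0 < s → s < T → geodesicFlow s x ≠ x) :
    IsCoreOfCylindricalLeaf model (kernel (omegaMinus c)) (fun t => geodesicFlow t x) T := by
  have hc := c.ne_zero
  refine (isHorocyclic_upper c).isCoreOfCylindricalLeaf (by norm_num) (fun s hs => ?_)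
    (hasDerivAt_upper _ 0) (fun a b hab => ?_) (fun x a b => ?_)
    (fun γ hγ hd => eventually_mem_plaque_omegaMinus c hγ hd) hT hx hmin
  · have := cellCoordsSL_eq_zero hs
    rw [cellCoordsSL_upperMatrix] at this
    simpa [hc] using this
  · simpa [hc, and_comm] using hab
  · exact (mem_kernel_omegaMinus c x _).2 (by simp)

end Cylinder

/-! ### Proper discontinuity on the hyperbolic plane -/

section ProperAction

instance isClosed_center : IsClosed (Subgroup.center SL(2, ℝ) : Set SL(2, ℝ)) := by
  have : (Subgroup.center SL(2, ℝ) : Set SL(2, ℝ)) = ⋂ A : SL(2, ℝ), {B | A * B = B * A} := by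
    ext B
    simp only [SetLike.mem_coe, Subgroup.mem_center_iff, mem_iInter, mem_ofPred_eq]
  rw [this]
  exact isClosed_iInter fun A => isClosed_eq (continuous_const.mul continuous_id)
    (continuous_id.mul continuous_const)

/-- The Hausdorff property makes the discrete subgroup `Γ` closed, so that it meets compact sets in
compact sets. -/
instance t2Space_psl : T2Space PSL(2, ℝ) :=
  have : T3Space PSL(2, ℝ) := QuotientGroup.instT3Space (Subgroup.center SL(2, ℝ))
  inferInstance

theorem im_smul_I (A : SL(2, ℝ)) : (A • I).im = 1 / (A 1 0 ^ 2 + A 1 1 ^ 2) := by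
  have hdet : A 0 0 * A 1 1 - A 0 1 * A 1 0 = 1 := by
    rw [← Matrix.det_fin_two]; exact A.2
  rw [← UpperHalfPlane.coe_im, coe_specialLinearGroup_apply]
  simp [Complex.div_im, Complex.normSq_apply]
  rw [← sub_div, hdet, one_div]
  congr 1
  ring

theorem re_smul_I (A : SL(2, ℝ)) :
    (A • I).re = (A 0 0 * A 1 0 + A 0 1 * A 1 1) / (A 1 0 ^ 2 + A 1 1 ^ 2) := by
  rw [← UpperHalfPlane.coe_re, coe_specialLinearGroup_apply]
  simp [Complex.div_re, Complex.normSq_apply]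
  rw [← add_div]
  congr 1
  · ring
  · ring

/-- Lagrange's identity `(ac + bd)² + (ad - bc)² = (a² + b²)(c² + d²)` with determinant one. A bound
on the displacement of `I` thus bounds the entries of the matrix, which is why the action is proper.
-/
theorem two_cosh_dist_smul_I (A : SL(2, ℝ)) : 2 * Real.cosh (dist I (A • I)) =
    A 0 0 ^ 2 + A 0 1 ^ 2 + A 1 0 ^ 2 + A 1 1 ^ 2 := by
  have hdet : A 0 0 * A 1 1 - A 0 1 * A 1 0 = 1 := by
    rw [← Matrix.det_fin_two]; exact A.2
  have hpos : 0 < A 1 0 ^ 2 + A 1 1 ^ 2 := by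
    have := (A • I).im_pos
    rw [im_smul_I, one_div_pos] at this
    exact this
  rw [cosh_dist', im_smul_I, re_smul_I, I_im, I_re]
  field_simp
  linear_combination (-(A 0 0 * A 1 1 - A 0 1 * A 1 0) - 1) * hdet

theorem isCompact_bounded_entries (C : ℝ) : IsCompact {A : SL(2, ℝ) | ∀ i j, |A i j| ≤ C} := by
  have h1 : IsCompact {A : Matrix (Fin 2) (Fin 2) ℝ | ∀ i j, A i j ∈ Icc (-C) C} := by
    have := isCompact_univ_pi fun _ : Fin 2 => isCompact_univ_pi fun _ : Fin 2 =>
      (isCompact_Icc : IsCompact (Icc (-C) C))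
    have he : {A : Matrix (Fin 2) (Fin 2) ℝ | ∀ i j, A i j ∈ Icc (-C) C} =
        (univ.pi fun _ => univ.pi fun _ => Icc (-C) C : Set (Fin 2 → Fin 2 → ℝ)) :=
      Set.ext fun A => ⟨fun h i _ j _ => h i j, fun h i j => h i trivial j trivial⟩
    rw [he]
    exact this
  have h2 : Topology.IsClosedEmbedding
      (Subtype.val : SL(2, ℝ) → Matrix (Fin 2) (Fin 2) ℝ) :=
    (isClosed_eq (continuous_id.matrix_det) continuous_const).isClosedEmbedding_subtypeVal
  have := h2.isCompact_preimage h1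
  have he : {A : SL(2, ℝ) | ∀ i j, |A i j| ≤ C} =
      Subtype.val ⁻¹' {A : Matrix (Fin 2) (Fin 2) ℝ | ∀ i j, A i j ∈ Icc (-C) C} :=
    Set.ext fun A => ⟨fun h i j => abs_le.1 (h i j), fun h i j => abs_le.2 (h i j)⟩
  rw [he]
  exact this

/-- The action of `PSL(2, ℝ)` on the hyperbolic plane is proper. -/
theorem exists_isCompact_dist_le (r : ℝ) :
    ∃ K : Set PSL(2, ℝ), IsCompact K ∧ ∀ q : PSL(2, ℝ), dist I (q • I) ≤ r → q ∈ K := by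
  -- The squares of the entries are at most `2 cosh r`, hence at most `(2 cosh r + 1)²`; this bound
  -- avoids a square root.
  refine ⟨_, (isCompact_bounded_entries (2 * Real.cosh r + 1)).image
    QuotientGroup.continuous_mk, fun q hq => ?_⟩
  induction q using QuotientGroup.induction_on with
  | H A =>
    refine ⟨A, fun i j => ?_, rfl⟩
    have h1 : Real.cosh (dist I (A • I)) ≤ Real.cosh r :=
      Real.cosh_le_cosh.2 (by
        rw [abs_of_nonneg dist_nonneg]; exact hq.trans (le_abs_self r))
    have h2 := two_cosh_dist_smul_I A
    have h3 : A i j ^ 2 ≤ 2 * Real.cosh r := by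
      have := sq_nonneg (A 0 0); have := sq_nonneg (A 0 1)
      have := sq_nonneg (A 1 0); have := sq_nonneg (A 1 1)
      fin_cases i <;> fin_cases j <;> simp only [Fin.zero_eta, Fin.mk_one] <;> linarith
    have h4 := Real.one_le_cosh r
    exact abs_le_of_sq_le_sq (by nlinarith) (by linarith)

variable (Γ : Subgroup PSL(2, ℝ)) [DiscreteTopology Γ]

/-- Conjugation by `h` reduces the displacement of `h • I` to that of `I`. The elements in question
lie in the intersection of `Γ` with a compact set, which is compact and discrete. -/
theorem finite_dist_le (h : PSL(2, ℝ)) (r : ℝ) :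
    {γ : PSL(2, ℝ) | γ ∈ Γ ∧ dist (h • I) (γ • h • I) ≤ r}.Finite := by
  obtain ⟨K, hK, hKr⟩ := exists_isCompact_dist_le r
  have hc : Continuous fun q : PSL(2, ℝ) => h * q * h⁻¹ :=
    (continuous_const.mul continuous_id).mul continuous_const
  have hcomp : IsCompact ((Γ : Set PSL(2, ℝ)) ∩ (fun q => h * q * h⁻¹) '' K) :=
    (hK.image hc).inter_left Subgroup.isClosed_of_discrete
  have hd : IsDiscrete (Γ : Set PSL(2, ℝ)) := ⟨‹_›⟩
  refine (hcomp.finite (hd.mono inter_subset_left)).subset ?_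
  rintro γ ⟨hγ, hdist⟩
  refine ⟨hγ, h⁻¹ * γ * h, hKr _ ?_, by group⟩
  have he : h * (h⁻¹ * γ * h) = γ * h := by group
  rw [← dist_smul h, smul_smul, he, mul_smul]
  exact hdist

/-- Injectivity radius: a torsion-free discrete group moves every point by a definite amount. -/
theorem exists_le_dist_smul (hΓ : ∀ γ ∈ Γ, IsOfFinOrder γ → γ = 1) (h : PSL(2, ℝ)) :
    ∃ ε > 0, ∀ γ ∈ Γ, γ ≠ 1 → ε ≤ dist (h • I) (γ • h • I) := by
  have hfree : ∀ γ ∈ Γ, γ ≠ 1 → 0 < dist (h • I) (γ • h • I) := by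
    intro γ hγ hne
    rw [dist_pos]
    intro he
    -- The powers of an element that fixes the point all have displacement zero and so form a finite
    -- set; the element has finite order and must be `1`.
    refine hne (hΓ γ hγ (finite_powers.1 ((finite_dist_le Γ h 0).subset ?_)))
    rintro _ ⟨n, rfl⟩
    refine ⟨Γ.pow_mem hγ n, ?_⟩
    have : ∀ n : ℕ, γ ^ n • h • I = h • I := by
      intro n
      induction n with
      | zero => simp
      | succ n ih => rw [pow_succ, mul_smul, ← he, ih]
    simp only [this, dist_self, le_refl]
  -- Only finitely many elements move the point by at most `1`; any small `ε` serves for these, and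
  -- `ε ≤ 1` serves for the others.
  have h1 : ∀ᶠ ε in 𝓝[>] (0 : ℝ), ∀ γ ∈ {γ : PSL(2, ℝ) | γ ∈ Γ ∧ dist (h • I) (γ • h • I) ≤ 1},
      γ ≠ 1 → ε ≤ dist (h • I) (γ • h • I) := by
    refine (eventually_all_finite (finite_dist_le Γ h 1)).2 fun γ hγ => ?_
    by_cases hne : γ = 1
    · exact Eventually.of_forall fun _ h => absurd hne h
    · exact ((eventually_le_nhds (hfree γ hγ.1 hne)).filter_mono nhdsWithin_le_nhds).mono
        fun ε hε _ => hε
  have h2 : ∀ᶠ ε in 𝓝[>] (0 : ℝ), ε ≤ 1 :=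
    (eventually_le_nhds zero_lt_one).filter_mono nhdsWithin_le_nhds
  obtain ⟨ε, ⟨h3, h4⟩, h5⟩ := ((h1.and h2).and self_mem_nhdsWithin).exists
  refine ⟨ε, h5, fun γ hγ hne => ?_⟩
  rcases le_or_gt (dist (h • I) (γ • h • I)) 1 with h6 | h6
  · exact h3 γ ⟨hγ, h6⟩ hne
  · exact h4.trans h6.le

end ProperAction

/-! ### Projected geodesics, their length and the period of the form -/

section Geodesics

theorem dist_diagMatrix_smul_I (s t : ℝ) :
    dist (diagMatrix s • I) (diagMatrix t • I) = |s - t| := by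
  have him : ∀ t, (diagMatrix t • I).im = Real.exp t := by
    intro t
    rw [im_smul_I]
    simp only [diagMatrix]
    simp [← Real.exp_nat_mul, ← Real.exp_neg]
    ring
  have hre : ∀ t, (diagMatrix t • I).re = 0 := by
    intro t
    rw [re_smul_I]
    simp [diagMatrix]
  rw [dist_of_re_eq (by rw [hre, hre]), him, him, Real.log_exp, Real.log_exp, Real.dist_eq]

variable {Γ : Subgroup PSL(2, ℝ)}

/-- The lift to the hyperbolic plane of the trajectory of the geodesic flow through `gΓ`. -/
def geodesicLift (g : PSL(2, ℝ)) (t : ℝ) : ℍ := g⁻¹ • diagMatrix (-t) • I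

theorem footpoint_geodesicFlow (g : PSL(2, ℝ)) (t : ℝ) :
    footpoint (geodesicFlow t (g : M Γ)) = Surface.mk Γ (geodesicLift g t) := by
  change Surface.mk Γ (((diagMatrix t : PSL(2, ℝ)) * g)⁻¹ • I) = _
  rw [mul_inv_rev, mul_smul, ← QuotientGroup.mk_inv, ← diagMatrix_neg]
  rfl

theorem dist_geodesicLift (g : PSL(2, ℝ)) (s t : ℝ) :
    dist (geodesicLift g s) (geodesicLift g t) = |s - t| := by
  rw [geodesicLift, geodesicLift, dist_smul, dist_diagMatrix_smul_I, abs_sub_comm]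
  congr 1; ring

theorem edist_footpoint_le (x : M Γ) (r s : ℝ) :
    edist (footpoint (geodesicFlow r x)) (footpoint (geodesicFlow s x)) ≤
      ENNReal.ofReal |r - s| := by
  obtain ⟨g, rfl⟩ := QuotientGroup.mk_surjective x
  rw [footpoint_geodesicFlow, footpoint_geodesicFlow]
  refine (surfaceDist_le Γ _ _).trans ?_
  rw [edist_dist, dist_geodesicLift]

theorem projectsToGeodesic [DiscreteTopology Γ] (hΓ : ∀ γ ∈ Γ, IsOfFinOrder γ → γ = 1) (x : M Γ) :
    ProjectsToGeodesic (fun t => geodesicFlow t x) := by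
  intro t
  obtain ⟨g, rfl⟩ := QuotientGroup.mk_surjective x
  obtain ⟨ε, hε, hdist⟩ := exists_le_dist_smul Γ hΓ (g⁻¹ * (diagMatrix (-t) : PSL(2, ℝ)))
  have hdist' : ∀ γ ∈ Γ, γ ≠ 1 → ε ≤ dist (geodesicLift g t) (γ • geodesicLift g t) := by
    intro γ hγ hne
    have := hdist γ hγ hne
    rw [mul_smul] at this
    exact this
  -- For `γ ≠ 1` the displacement `ε` of the lifted point at time `t` leaves at least `ε - ε/4 - ε/4
  -- = ε/2` between the lift at time `r` and the `γ`-translate of the lift at time `s`, while `|r -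
  -- s| < ε/2`. So no other pair of representatives is closer than the lifts themselves.
  refine ⟨ε / 4, by positivity, fun r s hr hs => le_antisymm (edist_footpoint_le _ r s) ?_⟩
  simp only [footpoint_geodesicFlow]
  refine le_iInf fun z => le_iInf fun w => le_iInf fun hz => le_iInf fun hw => ?_
  obtain ⟨γ₁, hγ₁⟩ : ∃ γ : Γ, γ • geodesicLift g r = z :=
    Quotient.exact (s := MulAction.orbitRel Γ ℍ) hz
  obtain ⟨γ₂, hγ₂⟩ : ∃ γ : Γ, γ • geodesicLift g s = w :=
    Quotient.exact (s := MulAction.orbitRel Γ ℍ) hw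
  rw [edist_dist]
  refine ENNReal.ofReal_le_ofReal ?_
  set γ : PSL(2, ℝ) := (γ₁ : PSL(2, ℝ))⁻¹ * γ₂ with hγ
  have hzw : dist z w = dist (geodesicLift g r) (γ • geodesicLift g s) := by
    rw [← hγ₁, ← hγ₂, hγ, mul_smul, ← dist_smul (γ₁ : PSL(2, ℝ)) (geodesicLift g r), smul_inv_smul]
    rfl
  rw [hzw]
  by_cases h1 : γ = 1
  · rw [h1, one_smul, dist_geodesicLift]
  · have h2 := hdist' γ (Γ.mul_mem (Γ.inv_mem γ₁.2) γ₂.2) h1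
    have h3 := dist_triangle4 (geodesicLift g t) (geodesicLift g r) (γ • geodesicLift g s)
      (γ • geodesicLift g t)
    rw [dist_smul, dist_geodesicLift, dist_geodesicLift] at h3
    have h4 := abs_sub_le r t s
    rw [abs_sub_comm t r] at h3
    rw [abs_sub_comm t s] at h4
    linarith

/-- The Lipschitz bound gives at most `T`. Conversely, the steps of a fine equidistant partition are
measured exactly by the local isometry and add up to `T`. -/
theorem projectedLength_of_projectsToGeodesic {γ : ℝ → M Γ} (h : ProjectsToGeodesic γ)
    (hle : ∀ r s, edist (footpoint (γ r)) (footpoint (γ s)) ≤ ENNReal.ofReal |r - s|)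
    {T : ℝ} (hT : 0 < T) : projectedLength γ 0 T = ENNReal.ofReal T := by
  apply le_antisymm
  · have hlip : LipschitzOnWith 1 (fun t => footpoint (γ t)) (Icc 0 T) := fun r _ s _ => by
      rw [ENNReal.coe_one, one_mul, edist_dist, Real.dist_eq]
      exact hle r s
    have h1 := hlip.comp_eVariationOn_le (g := id) (s := Icc 0 T) (mapsTo_id _)
    have h2 := (monotone_id.monotoneOn (Icc (0 : ℝ) T)).eVariationOn_eq
      (left_mem_Icc.2 hT.le) (right_mem_Icc.2 hT.le)
    rw [inter_self] at h2
    rw [h2] at h1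
    simpa [projectedLength] using! h1
  · choose δ hδ hloc using h
    -- The radius of isometry depends on the point; a Lebesgue number gives one mesh such that
    -- consecutive partition points always share a ball of isometry.
    obtain ⟨ρ, hρ, hball⟩ := lebesgue_number_lemma_of_metric (isCompact_Icc : IsCompact (Icc 0 T))
      (c := fun t => Metric.ball t (δ t)) (fun t => Metric.isOpen_ball)
      fun t _ => mem_iUnion.2 ⟨t, Metric.mem_ball_self (hδ t)⟩
    obtain ⟨n, hn⟩ := exists_nat_gt (T / ρ)
    have hn0 : (0 : ℝ) < n := (div_pos hT hρ).trans hn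
    have hstep : T / n < ρ := by rwa [div_lt_iff₀ hn0, mul_comm, ← div_lt_iff₀ hρ]
    have hstep0 : 0 < T / n := div_pos hT hn0
    have hmem : ∀ i ≤ n, (i : ℝ) * (T / n) ∈ Icc 0 T := fun i hi => by
      refine ⟨by positivity, ?_⟩
      calc (i : ℝ) * (T / n) ≤ n * (T / n) := by gcongr
        _ = T := by field_simp
    have hsum := eVariationOn.sum_le_of_monotoneOn_Iic (f := fun t => footpoint (γ t))
      (s := Icc 0 T) (n := n) (u := fun i : ℕ => (i : ℝ) * (T / n))
      (fun i _ j _ hij => by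
        have : (i : ℝ) ≤ j := by exact_mod_cast hij
        simp only
        gcongr) hmem
    refine le_trans (le_of_eq ?_) hsum
    have hterm : ∀ i ∈ Finset.range n, edist (footpoint (γ (((i + 1 : ℕ) : ℝ) * (T / n))))
        (footpoint (γ ((i : ℝ) * (T / n)))) = ENNReal.ofReal (T / n) := by
      intro i hi
      obtain ⟨t, ht⟩ := hball _ (hmem i (Finset.mem_range.1 hi).le)
      have h1 := ht (Metric.mem_ball_self hρ)
      have hsub : ((i + 1 : ℕ) : ℝ) * (T / n) - (i : ℝ) * (T / n) = T / n := by
        push_cast; ring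
      have h2 : ((i + 1 : ℕ) : ℝ) * (T / n) ∈ Metric.ball t (δ t) := by
        refine ht ?_
        rw [Metric.mem_ball, Real.dist_eq, hsub, abs_of_pos hstep0]
        exact hstep
      rw [Metric.mem_ball, Real.dist_eq] at h1 h2
      rw [hloc t _ _ h2 h1, hsub, abs_of_pos hstep0]
    rw [Finset.sum_congr rfl hterm, Finset.sum_const, Finset.card_range, nsmul_eq_mul,
      ← ENNReal.ofReal_natCast, ← ENNReal.ofReal_mul hn0.le]
    congr 1
    field_simp

theorem lineIntegral_omega0 [DiscreteTopology Γ] (c : ℝˣ) (x : M Γ) (T : ℝ) :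
    lineIntegral model (omega0 c) (fun t => geodesicFlow t x) 0 T = T := by
  have : ∀ t, omega0 c (geodesicFlow t x) (velocity model (fun t => geodesicFlow t x) t) = 1 :=
    fun t => by rw [velocity_geodesicFlow]; exact (omega_e0 c _).1
  simp [lineIntegral, this]

end Geodesics

end Horocycle

end

theorem proposition2 (Γ : Subgroup PSL(2, ℝ)) [DiscreteTopology Γ] [CompactSpace (M Γ)]
    (hΓ : ∀ γ ∈ Γ, IsOfFinOrder γ → γ = 1) (c : ℝˣ) :
    -- the trajectories of the three flows: `ω₊ = ω₋ = 0` for the geodesic flow (unit speed),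
    -- `ω₊ = ω₀ = 0` and `ω₋ = ω₀ = 0` for the two horocycle flows
    (∀ (x : M Γ) (t : ℝ),
      (omega0 c _ (velocity model (fun t => geodesicFlow t x) t) = 1 ∧
        omegaPlus c _ (velocity model (fun t => geodesicFlow t x) t) = 0 ∧
        omegaMinus c _ (velocity model (fun t => geodesicFlow t x) t) = 0) ∧
      (omega0 c _ (velocity model (fun t => horocyclePlus c t x) t) = 0 ∧
        omegaPlus c _ (velocity model (fun t => horocyclePlus c t x) t) = 0 ∧
        omegaMinus c _ (velocity model (fun t => horocyclePlus c t x) t) = 1) ∧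
      (omega0 c _ (velocity model (fun t => horocycleMinus c t x) t) = 0 ∧
        omegaPlus c _ (velocity model (fun t => horocycleMinus c t x) t) = 1 ∧
        omegaMinus c _ (velocity model (fun t => horocycleMinus c t x) t) = 0)) ∧
    -- the horocycle flows are Hamiltonian with the same 1-form `ω₀` and the tensors `r h₊`, `r h₋`,
    -- `r ≠ 0` being the speed and the direction of the motion
    (∀ r : ℝ, r ≠ 0 →
      IsHamiltonianFlow model (r • hPlus c : TensorField model (M Γ)) (omega0 c)
        (fun t => horocyclePlus c (-(r * t))) ∧
      IsHamiltonianFlow model (r • hMinus c : TensorField model (M Γ)) (omega0 c)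
        (fun t => horocycleMinus c (-(r * t))) ∧
      ∀ x : M Γ,
        casimirDistribution (r • hPlus c : TensorField model (M Γ)) x = kernel (omegaPlus c) x ∧
        casimirDistribution (r • hMinus c : TensorField model (M Γ)) x = kernel (omegaMinus c) x) ∧
    (∀ x : M Γ, hPlus c x ≠ hMinus c x) ∧
    -- `ω₊ = 0` and `ω₋ = 0` are foliations, spanned by the geodesic flow and the direction which
    -- this flow contracts, respectively expands
    IsCodimOneFoliation model (kernel (omegaPlus (Γ := Γ) c)) ∧
    IsCodimOneFoliation model (kernel (omegaMinus (Γ := Γ) c)) ∧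
    (∀ (x : M Γ) (t : ℝ),
      kernel (omegaPlus c) x = Submodule.span ℝ {e0 x, eMinus c x} ∧
      kernel (omegaMinus c) x = Submodule.span ℝ {e0 x, ePlus c x} ∧
      mfderiv model model (geodesicFlow t) x (eMinus c x) =
        Real.exp (-t) • eMinus c (geodesicFlow t x) ∧
      mfderiv model model (geodesicFlow t) x (ePlus c x) =
        Real.exp t • ePlus c (geodesicFlow t x)) ∧
    -- closed geodesics `γ`, `γ(t) = geodesicFlow t x` for `0 ≤ t ≤ T`: the period of `ω₀` is the
    -- length of `γ`, and the leaves that contain a primitive `γ` are cylinders with core `γ`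
    (∀ (x : M Γ) (T : ℝ), 0 < T → geodesicFlow T x = x →
      ProjectsToGeodesic (fun t => geodesicFlow t x) ∧
      0 < lineIntegral model (omega0 c) (fun t => geodesicFlow t x) 0 T ∧
      projectedLength (fun t => geodesicFlow t x) 0 T =
        ENNReal.ofReal (lineIntegral model (omega0 c) (fun t => geodesicFlow t x) 0 T) ∧
      ((∀ s, 0 < s → s < T → geodesicFlow s x ≠ x) →
        IsCoreOfCylindricalLeaf model (kernel (omegaPlus c)) (fun t => geodesicFlow t x) T ∧
        IsCoreOfCylindricalLeaf model (kernel (omegaMinus c)) (fun t => geodesicFlow t x) T)) := by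
  refine ⟨fun x t => ⟨?_, ?_, ?_⟩, fun r hr => ⟨isHamiltonianFlow_horocyclePlus c hr,
    isHamiltonianFlow_horocycleMinus c hr, fun x => ⟨casimirDistribution_hPlus c hr x,
    casimirDistribution_hMinus c hr x⟩⟩, hPlus_ne_hMinus c, isCodimOneFoliation_omegaPlus c,
    isCodimOneFoliation_omegaMinus c, fun x t => ⟨kernel_omegaPlus_eq_span c x,
    kernel_omegaMinus_eq_span c x, mfderiv_geodesicFlow_eMinus c x t,
    mfderiv_geodesicFlow_ePlus c x t⟩, fun x T hT hx => ⟨projectsToGeodesic hΓ x, ?_, ?_,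
    fun hmin => ⟨isCore_omegaPlus c hT hx hmin, isCore_omegaMinus c hT hx hmin⟩⟩⟩
  · rw [velocity_geodesicFlow]
    exact omega_e0 c _
  · rw [velocity_horocyclePlus]
    exact omega_eMinus c _
  · rw [velocity_horocycleMinus]
    exact omega_ePlus c _
  · rw [lineIntegral_omega0]
    exact hT
  · rw [lineIntegral_omega0]
    exact projectedLength_of_projectsToGeodesic (projectsToGeodesic hΓ x)
      (edist_footpoint_le x) hT
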